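/- **Theorem D.** Let $\Gamma$ be a group satisfying the *global WWPD hypothesis*: there are a finite-index normal subgroup $N\lhd\Gamma$, an action $\rho\colon N\to\mathrm{Isom}(X)$ by isometries on a nonempty Gromov hyperbolic length space $X$ (for example a hyperbolic complex, i.e. a connected simplicial complex whose simplices are regular with edge length $1$ and whose path metric is Gromov hyperbolic), and a free subgroup $F\le N$ of rank $2$, such that 1. every element of $N$ acts on $X$ loxodromically or elliptically; 2. the restricted action of $F$ on $X$ is Schottky, and every nontrivial element of $F$ is WWPD with respect to the action $\rho$ of $N$; 3. for every $g\in\Gamma$, writing $\rho_g(\mu)=\rho(g\mu g^{-1})$ for the twisted action of $N$ on $X$, either the restriction of $\rho_g$ to $F$ is Schottky and every nontrivial element of $F$ is WWPD with respect to the action $\rho_g$ of $N$, or every element of $F$ acts elliptically under $\rho_g$. Then $H^2_b(\Gamma;\mathbb R)$ contains an embedded $\ell^1$: there is an injective linear map $\varphi\colon\ell^1\to H^2_b(\Gamma;\mathbb R)$, which can moreover be taken bounded, in the sense that for some constant $C$ each class $\varphi(t)$ is represented by a bounded cocycle $z$ with $\sup|z|\le C\|t\|_1$. Here $H^2_b(\Gamma;\mathbb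 R)$ is the space of bounded functions $z\colon\Gamma^2\to\mathbb R$ with $z(h,k)-z(gh,k)+z(g,hk)-z(g,h)=0$, modulo the functions $(g,h)\mapsto f(g)+f(h)-f(gh)$ with $f\colon\Gamma\to\mathbb R$ bounded. An isometry $h$ is *elliptic* if its orbits $\{h^ix : i\in\mathbb Z\}$ are bounded, and *loxodromic* if its orbit maps $\mathbb Z\to X$, $i\mapsto h^ix$, are quasi-isometric embeddings; a loxodromic $h$ has a repelling and an attracting fixed point $\partial_-h,\partial_+h$ in the Gromov boundary, the limits of $h^{-n}x$ and $h^nx$ as $n\to\infty$. An action of a free group of finite rank is *Schottky* if its orbit maps are quasi-isometric embeddings with respect to the word metric. Given an action of $N$ on $X$, an element $h\in N$ is *WWPD* if it is loxodromic and for all $x\in X$ and $R>0$ there is an integer $M\ge1$ such that every subset $Z\subset N$ with the following two properties is finite: $d(x,gx)<R$ and $d(h^Mx,gh^Mx)<R$ for all $g\in Z$; and no two elements of $Z$ lie in the same left coset of the stabilizer in $N$ of the ordered pair $(\partial_-h,\partial_+h)$. -/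

import Mathlib

universe u v

namespace WWPD

/-! ## Second bounded cohomology with trivial real coefficients -/

section BoundedCohomology

variable (G : Type u) [Group G]

/-- Bounded (inhomogeneous) real 2-cocycles of `G`. -/
def boundedCocycles₂ : Submodule ℝ (G → G → ℝ) where
  carrier := {z | (∃ C : ℝ, ∀ g h, |z g h| ≤ C) ∧
    ∀ g h k, z h k - z (g * h) k + z g (h * k) - z g h = 0}
  zero_mem' := ⟨⟨0, by simp⟩, by simp⟩
  add_mem' := by
    rintro z w ⟨⟨C, hC⟩, hz⟩ ⟨⟨D, hD⟩, hw⟩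
    refine ⟨⟨C + D, fun g h => (abs_add_le _ _).trans (add_le_add (hC g h) (hD g h))⟩, ?_⟩
    intro g h k
    simp only [Pi.add_apply]
    linarith [hz g h k, hw g h k]
  smul_mem' := by
    rintro c z ⟨⟨C, hC⟩, hz⟩
    refine ⟨⟨|c| * C, fun g h => ?_⟩, ?_⟩
    · simp only [Pi.smul_apply, smul_eq_mul, abs_mul]
      exact mul_le_mul_of_nonneg_left (hC g h) (abs_nonneg c)
    · intro g h k
      simp only [Pi.smul_apply, smul_eq_mul]
      linear_combination c * hz g h k

/-- Coboundaries of bounded 1-cochains: `(δ f)(g, h) = f g + f h - f (g * h)` with `f` bounded. -/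
def boundedCoboundaries₂ : Submodule ℝ (G → G → ℝ) where
  carrier := {z | ∃ f : G → ℝ, (∃ C : ℝ, ∀ g, |f g| ≤ C) ∧
    ∀ g h, z g h = f g + f h - f (g * h)}
  zero_mem' := ⟨0, ⟨0, by simp⟩, by simp⟩
  add_mem' := by
    rintro z w ⟨f, ⟨C, hC⟩, hf⟩ ⟨e, ⟨D, hD⟩, he⟩
    refine ⟨f + e, ⟨C + D, fun g => (abs_add_le _ _).trans (add_le_add (hC g) (hD g))⟩, ?_⟩
    intro g h
    simp only [Pi.add_apply, hf g h, he g h]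
    ring
  smul_mem' := by
    rintro c z ⟨f, ⟨C, hC⟩, hf⟩
    refine ⟨c • f, ⟨|c| * C, fun g => ?_⟩, ?_⟩
    · simp only [Pi.smul_apply, smul_eq_mul, abs_mul]
      exact mul_le_mul_of_nonneg_left (hC g) (abs_nonneg c)
    · intro g h
      simp only [Pi.smul_apply, smul_eq_mul, hf g h]
      ring

theorem boundedCoboundaries₂_le : boundedCoboundaries₂ G ≤ boundedCocycles₂ G := by
  rintro z ⟨f, ⟨C, hC⟩, hf⟩
  refine ⟨⟨C + C + C, fun g h => ?_⟩, fun g h k => ?_⟩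
  · rw [hf g h]
    have h1 := abs_le.1 (hC g)
    have h2 := abs_le.1 (hC h)
    have h3 := abs_le.1 (hC (g * h))
    exact abs_le.2 ⟨by linarith, by linarith⟩
  · simp only [hf, mul_assoc]
    ring

/-- The second bounded cohomology `H²_b(G; ℝ)`: bounded 2-cocycles modulo coboundaries of bounded
1-cochains. -/
abbrev H2b : Type u :=
  boundedCocycles₂ G ⧸ (boundedCoboundaries₂ G).submoduleOf (boundedCocycles₂ G)

end BoundedCohomology

/-! ## Gromov hyperbolic spaces and their boundary -/

section Hyperbolic

variable (X : Type v) [MetricSpace X]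

/-- Any two points `x`, `y` are joined, for every `ε > 0`, by a path of length at most
`dist x y + ε` (parametrised here as a 1-Lipschitz path on an interval `[0, L]`). Every geodesic
space, and every connected complex with its path metric, is a length space. -/
def IsLengthSpace : Prop :=
  ∀ x y : X, ∀ ε : ℝ, 0 < ε → ∃ (L : ℝ) (γ : ℝ → X), 0 ≤ L ∧ L ≤ dist x y + ε ∧
    γ 0 = x ∧ γ L = y ∧ LipschitzOnWith 1 γ (Set.Icc 0 L)

variable {X}

/-- The Gromov product `(x | y)_o`. -/
noncomputable def gromovProduct (o x y : X) : ℝ := (dist o x + dist o y - dist x y) / 2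

variable (X)

/-- Gromov hyperbolicity. -/
class GromovHyperbolic : Prop where
  exists_delta : ∃ δ : ℝ, ∀ o x y z : X,
    min (gromovProduct o x y) (gromovProduct o y z) - δ ≤ gromovProduct o x z

variable {X}

/-- `(u_m | v_n)_o → ∞` as `m, n → ∞`, for every base point `o`. -/
def Asymptotic (w w' : ℕ → X) : Prop :=
  ∀ (o : X) (R : ℝ), ∃ k : ℕ, ∀ m ≥ k, ∀ n ≥ k, R ≤ gromovProduct o (w m) (w' n)

theorem Asymptotic.symm {w w' : ℕ → X} (h : Asymptotic w w') : Asymptotic w' w := by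
  intro o R
  obtain ⟨k, hk⟩ := h o R
  refine ⟨k, fun m hm n hn => (hk n hn m hm).trans_eq ?_⟩
  simp only [gromovProduct, dist_comm (w n) (w' m)]
  ring

theorem Asymptotic.trans [GromovHyperbolic X] {w₁ w₂ w₃ : ℕ → X} (h : Asymptotic w₁ w₂)
    (h' : Asymptotic w₂ w₃) : Asymptotic w₁ w₃ := by
  obtain ⟨δ, hδ⟩ := GromovHyperbolic.exists_delta (X := X)
  intro o R
  obtain ⟨k, hk⟩ := h o (R + δ)
  obtain ⟨l, hl⟩ := h' o (R + δ)
  refine ⟨max k l, fun m hm n hn => ?_⟩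
  have h1 := hk m (le_of_max_le_left hm) (max k l) (le_max_left _ _)
  have h2 := hl (max k l) (le_max_right _ _) n (le_of_max_le_right hn)
  have h3 := hδ o (w₁ m) (w₂ (max k l)) (w₃ n)
  linarith [le_min h1 h2]

theorem Asymptotic.map {w w' : ℕ → X} (h : Asymptotic w w') (g : X ≃ᵢ X) :
    Asymptotic (fun n => g (w n)) (fun n => g (w' n)) := by
  intro o R
  obtain ⟨k, hk⟩ := h (g.symm o) R
  refine ⟨k, fun m hm n hn => (hk m hm n hn).trans_eq ?_⟩
  have e : ∀ y, dist (g.symm o) y = dist o (g y) := fun y => by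
    rw [← g.dist_eq (g.symm o) y, g.apply_symm_apply]
  simp only [gromovProduct, e, g.dist_eq]

variable (X)

/-- Sequences converging to infinity. -/
def SeqToInfinity : Type v := {w : ℕ → X // Asymptotic w w}

instance SeqToInfinity.setoid [GromovHyperbolic X] : Setoid (SeqToInfinity X) where
  r w w' := Asymptotic w.1 w'.1
  iseqv := ⟨fun w => w.2, fun h => h.symm, fun h h' => h.trans h'⟩

/-- The Gromov boundary `∂X`. -/
def GromovBoundary [GromovHyperbolic X] : Type v := Quotient (SeqToInfinity.setoid X)

variable {X}

/-- The action of isometries on the Gromov boundary. -/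
instance GromovBoundary.mulAction [GromovHyperbolic X] :
    MulAction (X ≃ᵢ X) (GromovBoundary X) where
  smul g := Quotient.map (fun w => ⟨fun n => g (w.1 n), w.2.map g⟩) fun _ _ h => h.map g
  one_smul ξ := by
    induction ξ using Quotient.inductionOn with
    | h w => rfl
  mul_smul g g' ξ := by
    induction ξ using Quotient.inductionOn with
    | h w => rfl

/-- The sequence `w` converges to the boundary point `ξ`. -/
def TendsToBoundary [GromovHyperbolic X] (w : ℕ → X) (ξ : GromovBoundary X) : Prop :=
  ∃ h : Asymptotic w w, ξ = Quotient.mk (SeqToInfinity.setoid X) ⟨w, h⟩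

/-- `f` is a quasi-isometric embedding into `X` of the set `A` with distance function `d`. -/
def IsQIEmbedding {A : Type*} (d : A → A → ℝ) (f : A → X) : Prop :=
  ∃ K C : ℝ, 1 ≤ K ∧ 0 ≤ C ∧ ∀ a b, d a b / K - C ≤ dist (f a) (f b) ∧
    dist (f a) (f b) ≤ K * d a b + C

/-- Elliptic isometries: the orbits of `⟨h⟩` are bounded. -/
def IsElliptic (h : X ≃ᵢ X) : Prop :=
  ∀ x : X, Bornology.IsBounded (Set.range fun i : ℤ => (h ^ i) x)

/-- Loxodromic isometries: the orbit maps `ℤ → X` are quasi-isometric embeddings. -/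
def IsLoxodromic (h : X ≃ᵢ X) : Prop :=
  ∀ x : X, IsQIEmbedding (fun i j : ℤ => |(i : ℝ) - j|) (fun i : ℤ => (h ^ i) x)

/-- `ξ` is the attracting point `∂₊h` of `h`: `hⁿ x → ξ` as `n → ∞`, for all `x`. -/
def IsAttractor [GromovHyperbolic X] (h : X ≃ᵢ X) (ξ : GromovBoundary X) : Prop :=
  ∀ x : X, TendsToBoundary (fun n : ℕ => (h ^ n) x) ξ

/-- `ξ` is the repelling point `∂₋h` of `h`: `h⁻ⁿ x → ξ` as `n → ∞`, for all `x`. -/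
def IsRepeller [GromovHyperbolic X] (h : X ≃ᵢ X) (ξ : GromovBoundary X) : Prop :=
  IsAttractor h⁻¹ ξ

end Hyperbolic

/-! ## Actions on hyperbolic spaces -/

section Actions

variable {X : Type v} [MetricSpace X]

/-- The stabilizer in `H` of the ordered pair `(∂₋h, ∂₊h)` of a loxodromic element `h`. -/
def endStabilizer [GromovHyperbolic X] {H : Type u} [Group H] (ρ : H →* (X ≃ᵢ X)) (h : H) :
    Subgroup H where
  carrier := {g | ∀ ξ : GromovBoundary X,
    IsRepeller (ρ h) ξ ∨ IsAttractor (ρ h) ξ → ρ g • ξ = ξ}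
  one_mem' := fun ξ _ => by rw [map_one, one_smul]
  mul_mem' := fun {a b} ha hb ξ hξ => by rw [map_mul, mul_smul, hb ξ hξ, ha ξ hξ]
  inv_mem' := fun {a} ha ξ hξ => by rw [map_inv, inv_smul_eq_iff, ha ξ hξ]

/-- `h` is a WWPD element of the action `ρ` of `H` on `X`: it is loxodromic, and for all `x` and
`R > 0` there is `M ≥ 1` such that every set of elements of `H`, in pairwise distinct left cosets
of the stabilizer of `(∂₋h, ∂₊h)`, that move `x` and `h^M x` by less than `R` is finite. -/
def IsWWPD [GromovHyperbolic X] {H : Type u} [Group H] (ρ : H →* (X ≃ᵢ X)) (h : H) : Prop :=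
  IsLoxodromic (ρ h) ∧ ∀ (x : X) (R : ℝ), 0 < R → ∃ M : ℕ, 1 ≤ M ∧ ∀ Z : Set H,
    (∀ g ∈ Z, dist x (ρ g x) < R ∧ dist (ρ (h ^ M) x) (ρ g (ρ (h ^ M) x)) < R) →
    (∀ g ∈ Z, ∀ g' ∈ Z, g ≠ g' → g⁻¹ * g' ∉ endStabilizer ρ h) →
    Z.Finite

/-- The action `σ` of `F` on `X` is Schottky: `F` is free of finite rank, and the orbit maps are
quasi-isometric embeddings with respect to the word metric of a free basis. -/
def IsSchottky {F : Type u} [Group F] (σ : F →* (X ≃ᵢ X)) : Prop :=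
  ∃ (n : ℕ) (b : FreeGroupBasis (Fin n) F), ∀ x : X,
    IsQIEmbedding (fun f f' : F => ((b.repr (f⁻¹ * f')).norm : ℝ)) (fun f : F => σ f x)

/-- The restriction of `ρ` to `F` is Schottky, and each nontrivial element of `F` is WWPD with
respect to the action of the whole group `H`. -/
def IsWWPDSchottky [GromovHyperbolic X] {H : Type u} [Group H] (ρ : H →* (X ≃ᵢ X))
    (F : Subgroup H) : Prop :=
  IsSchottky (ρ.comp F.subtype) ∧ ∀ f ∈ F, f ≠ 1 → IsWWPD ρ f

/-- The action of the normal subgroup `N` obtained from `ρ` by precomposing with the inner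
automorphism `μ ↦ g μ g⁻¹` of `Γ`. -/
def twist {Γ : Type u} [Group Γ] {N : Subgroup Γ} [N.Normal] (ρ : N →* (X ≃ᵢ X)) (g : Γ) :
    N →* (X ≃ᵢ X) :=
  ρ.comp (MulAut.conjNormal g : MulAut N).toMonoidHom

/-- `Γ` satisfies the global WWPD hypothesis with respect to the normal subgroup `N`, the action
`ρ` of `N` on the hyperbolic space `X`, and the subgroup `F` of `N`. -/
structure GlobalWWPD {Γ : Type u} [Group Γ] (N : Subgroup Γ) [N.Normal] [GromovHyperbolic X]
    (ρ : N →* (X ≃ᵢ X)) (F : Subgroup N) : Prop where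
  finiteIndex : N.FiniteIndex
  rank_two : Nonempty (FreeGroupBasis (Fin 2) F)
  lox_or_ell : ∀ μ : N, IsLoxodromic (ρ μ) ∨ IsElliptic (ρ μ)
  schottky : IsWWPDSchottky ρ F
  twisted : ∀ g : Γ, IsWWPDSchottky (twist ρ g) F ∨ ∀ f ∈ F, IsElliptic (twist ρ g f)

end Actions

end WWPD

/-! The classes come from quasimorphisms. Fix a base point `x` and `u` in `N`, and let `D p q` be
the infimum of the costs of chains from `p` to `q`, where the cost is length except that a jump
along a translate of the pair `(x, u x)` is cheaper by `W`. Nearly optimal chains are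
quasi-geodesics with constants depending on `W` only, so the centre of a triangle almost splits
every discounted distance between its vertices. Hence `g ↦ D (g x) x - D x (g x)` is a quasimorphism
of `N` whose defect depends only on `δ` and `W` (`exists_discDiff_cocycle_bound`), and it is bounded
by `dist x (g x)`. A discount is gained only if some translate of `(x, u x)` occurs, in the right
order, near the geodesic (`exists_pair_of_discDist_lt`). So the quasimorphism vanishes on elements
along whose geodesic no translate occurs in either direction, and grows on the powers of `u` if none
occurs backwards along them.

The elements `u` are words `0ⁿ 1ⁿ 2ⁿ` in three positive letters. WWPD enters through
`IsWWPD.exists_asymptotic`: a pigeonhole on cosets of the end stabilizer turns arbitrarily long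
fellow travelling into equality of boundary points. It has two uses. If a translate of a long `0ⁿ 1ⁿ
2ⁿ` lay near the axis of a fixed loxodromic `v`, then `v` would fix the attracting endpoints of the
three blocks, and these are distinct (`eventually_not_near_axis`). For backward occurrences the
letters are first replaced by `a`, `b = a ^ m * 1` and `b ^ m' * 2` with suitable exponents
(`exists_substitution`). Then long powers of one of the first two letters do not run backwards along
powers of a different letter, and a combinatorial argument on blocks excludes reversed copies
(`no_reversed_blocks`, `eventually_not_reversed`). A sparse sequence of exponents gives a triangular
family of quasimorphisms, controlled simultaneously for all Schottky twists of `F`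
(`exists_quasimorphisms`).

Summing over coset representatives transfers the family to `Γ`. Schottky twists contribute
nonnegatively on the diagonal and nothing beyond it; elliptic twists contribute boundedly, because
the quasimorphisms are dominated by displacement (`GlobalWWPD.exists_quasimorphisms`). The linear
map sends `t` to the class of the coboundary of `∑ t n * Q n`. If this class vanishes, the sum is
boundedly close to a homomorphism, which is trivial on the chosen words because they lie in `[F,
F]`. Evaluation on powers of the word belonging to the first nonzero `t i` then gives a bounded
quantity that grows linearly. -/

namespace WWPD

/-! ### Gromov products and the four-point inequality -/

section GromovProduct

variable {X : Type v} [MetricSpace X]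

/-- The four-point inequality with constant `δ ≥ 0`. -/
def IsHyp (X : Type v) [MetricSpace X] (δ : ℝ) : Prop :=
  0 ≤ δ ∧ ∀ o x y z : X,
    min (gromovProduct o x y) (gromovProduct o y z) - δ ≤ gromovProduct o x z

theorem exists_isHyp [GromovHyperbolic X] : ∃ δ : ℝ, IsHyp X δ := by
  obtain ⟨δ, hδ⟩ := GromovHyperbolic.exists_delta (X := X)
  exact ⟨max δ 0, le_max_right _ _, fun o x y z =>
    (sub_le_sub_left (le_max_left _ _) _).trans (hδ o x y z)⟩

theorem gromovProduct_comm (o x y : X) : gromovProduct o x y = gromovProduct o y x := by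
  simp only [gromovProduct, dist_comm x y]; ring

theorem gromovProduct_nonneg (o x y : X) : 0 ≤ gromovProduct o x y := by
  have := dist_triangle_left x y o
  simp only [gromovProduct]; linarith

theorem gromovProduct_self_left (x y : X) : gromovProduct x x y = 0 := by
  simp [gromovProduct]

theorem gromovProduct_self_right (x y : X) : gromovProduct y x y = 0 := by
  simp [gromovProduct, dist_comm x y]

theorem gromovProduct_le_left (o x y : X) : gromovProduct o x y ≤ dist o x := by
  have := dist_triangle o x y
  simp only [gromovProduct]; linarith

theorem gromovProduct_base_le (o o' x y : X) :
    gromovProduct o x y ≤ gromovProduct o' x y + dist o o' := by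
  have h1 := dist_triangle o o' x
  have h2 := dist_triangle o o' y
  simp only [gromovProduct]; linarith

theorem gromovProduct_left_le (o x x' y : X) :
    gromovProduct o x y ≤ gromovProduct o x' y + dist x x' := by
  have h1 := dist_triangle o x' x
  have h2 := dist_triangle x' x y
  rw [dist_comm x' x] at *
  simp only [gromovProduct]; linarith

theorem gromovProduct_right_le (o x y y' : X) :
    gromovProduct o x y ≤ gromovProduct o x y' + dist y y' := by
  rw [gromovProduct_comm o x y, gromovProduct_comm o x y']
  exact gromovProduct_left_le _ _ _ _

theorem gromovProduct_map (g : X ≃ᵢ X) (o x y : X) :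
    gromovProduct (g o) (g x) (g y) = gromovProduct o x y := by
  simp only [gromovProduct, g.dist_eq]

/-- `(x | z)_y + (y | z)_x = d(x, y)`. -/
theorem gromovProduct_add_gromovProduct (x y z : X) :
    gromovProduct x y z + gromovProduct y x z = dist x y := by
  simp only [gromovProduct, dist_comm y x]; ring

theorem dist_add_dist_eq (m x y : X) :
    dist x m + dist m y = dist x y + 2 * gromovProduct m x y := by
  simp only [gromovProduct, dist_comm x m]; ring

variable {δ : ℝ}

theorem IsHyp.four_point (h : IsHyp X δ) (x y z w : X) :
    dist x y + dist z w ≤ max (dist x z + dist y w) (dist x w + dist y z) + 2 * δ := by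
  have h1 := h.2 w x z y
  simp only [gromovProduct, dist_comm w x, dist_comm w y, dist_comm w z, dist_comm z y] at h1
  rcases min_cases ((dist x w + dist z w - dist x z) / 2) ((dist z w + dist y w - dist y z) / 2)
    with ⟨e, _⟩ | ⟨e, _⟩ <;> rw [e] at h1
  · have := le_max_left (dist x z + dist y w) (dist x w + dist y z); linarith
  · have := le_max_right (dist x z + dist y w) (dist x w + dist y z); linarith

/-- As in a tree, a point has a coordinate `gromovProduct x y z` along `[x, y]` and a height
`gromovProduct z x y` over it. A path from `z` to `w` can descend, move along `[x, y]` and climb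
again. -/
theorem IsHyp.dist_le_coord (h : IsHyp X δ) (x y z w : X) :
    dist z w ≤ |gromovProduct x y z - gromovProduct x y w| +
      gromovProduct z x y + gromovProduct w x y + 2 * δ := by
  have h1 := h.four_point x y z w
  have h2 := le_abs_self (gromovProduct x y z - gromovProduct x y w)
  have h3 := neg_abs_le (gromovProduct x y z - gromovProduct x y w)
  simp only [gromovProduct, dist_comm z x, dist_comm z y, dist_comm w x, dist_comm w y] at *
  rcases max_cases (dist x z + dist y w) (dist x w + dist y z) with ⟨e, _⟩ | ⟨e, _⟩ <;>
    rw [e] at h1 <;> linarith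

/-- Projection to `[x, y]` contracts: in a tree, two points whose heights add up to more than their
distance lie on the same branch, hence have the same coordinate. -/
theorem IsHyp.contraction (h : IsHyp X δ) (x y z w : X)
    (hd : dist z w + δ ≤ gromovProduct z x y + gromovProduct w x y) :
    |gromovProduct x y z - gromovProduct x y w| ≤ δ := by
  have h1 := h.four_point x z y w
  have h2 := h.four_point x w y z
  rw [dist_comm w z] at h2
  simp only [gromovProduct, dist_comm z x, dist_comm z y, dist_comm w x, dist_comm w y] at *
  rw [abs_le]
  rcases max_cases (dist x y + dist z w) (dist x w + dist y z) with ⟨e, _⟩ | ⟨e, _⟩ <;>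
  rcases max_cases (dist x y + dist z w) (dist x z + dist y w) with ⟨e', _⟩ | ⟨e', _⟩ <;>
    rw [e] at h1 <;> rw [e'] at h2 <;> constructor <;> linarith

end GromovProduct

/-! ### Stability of discrete quasi-geodesics -/

section Morse

variable {X : Type v} [MetricSpace X]

/-- `z 0, …, z n` is a discrete quasi-geodesic with length labels `l`. -/
structure IsQGChain (z : ℕ → X) (l : ℕ → ℝ) (n : ℕ) (S K C : ℝ) : Prop where
  dist_step : ∀ i < n, dist (z i) (z (i + 1)) ≤ l (i + 1) - l i
  step_le : ∀ i < n, l (i + 1) - l i ≤ S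
  qg : ∀ i j, i ≤ j → j ≤ n → l j - l i ≤ K * dist (z i) (z j) + C

namespace IsQGChain

variable {z : ℕ → X} {l : ℕ → ℝ} {n : ℕ} {S K C δ : ℝ}

theorem dist_le (h : IsQGChain z l n S K C) {i j : ℕ} (hij : i ≤ j) (hj : j ≤ n) :
    dist (z i) (z j) ≤ l j - l i := by
  induction j, hij using Nat.le_induction with
  | base => simp
  | succ j hij ih =>
    have h1 := ih (by omega)
    have h2 := h.dist_step j (by omega)
    have h3 := dist_triangle (z i) (z j) (z (j + 1))
    linarith

theorem label_mono (h : IsQGChain z l n S K C) {i j : ℕ} (hij : i ≤ j) (hj : j ≤ n) :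
    l i ≤ l j := by
  have := (h.dist_le hij hj).trans' dist_nonneg
  linarith

/-- While a chain stays above height `R`, `contraction` applies to pieces of label length at most
`R`. Cutting at the first label increment beyond `R - S` gives such pieces, since a step adds at
most `S`; so the coordinate moves by at most `δ` per length `R - S`. -/
theorem drift (hδ : IsHyp X δ) (h : IsQGChain z l n S K C) {R : ℝ} (hS : 0 ≤ S) (hR : S < R)
    (hRδ : δ ≤ R) (x y : X) (d : ℕ) : ∀ s t : ℕ, t = s + d → t ≤ n →
    (∀ k, s ≤ k → k ≤ t → R < gromovProduct (z k) x y) →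
    |gromovProduct x y (z s) - gromovProduct x y (z t)| ≤ δ * ((l t - l s) / (R - S) + 1) := by
  induction d using Nat.strong_induction_on with
  | _ d ih =>
  intro s t hst htn hk
  have hRS : 0 < R - S := by linarith
  have hst' : s ≤ t := by omega
  by_cases hl : l t - l s ≤ R
  · have h1 := hδ.contraction x y (z s) (z t) (by
      have := h.dist_le hst' htn
      linarith [hk s le_rfl hst', hk t hst' le_rfl])
    have h2 : 0 ≤ δ * ((l t - l s) / (R - S)) :=
      mul_nonneg hδ.1 (div_nonneg (by linarith [h.label_mono hst' htn]) hRS.le)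
    linarith
  · push Not at hl
    have hex : ∃ j, s ≤ j ∧ R - S < l j - l s := ⟨t, hst', by linarith⟩
    classical
    obtain ⟨hj1, hj2⟩ := Nat.find_spec hex
    set j := Nat.find hex with hj
    have hjt : j ≤ t := Nat.find_min' hex ⟨hst', by linarith⟩
    have hsj : s < j := by
      rcases hj1.eq_or_lt with e | e
      · rw [← e] at hj2; linarith
      · exact e
    have hpred : l (j - 1) - l s ≤ R - S := by
      by_contra hc
      exact Nat.find_min hex (m := j - 1) (by omega) ⟨by omega, not_le.1 hc⟩
    have hstep := h.step_le (j - 1) (by omega)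
    rw [Nat.sub_add_cancel (by omega : 1 ≤ j)] at hstep
    have h1 := hδ.contraction x y (z s) (z j) (by
      have := h.dist_le hsj.le (by omega)
      linarith [hk s le_rfl hst', hk j hsj.le hjt])
    have h2 := ih (t - j) (by omega) j t (by omega) htn fun k h1 h2 => hk k (by omega) h2
    have h3 := abs_sub_le (gromovProduct x y (z s)) (gromovProduct x y (z j))
      (gromovProduct x y (z t))
    have h4 : (l t - l j) / (R - S) + 1 ≤ (l t - l s) / (R - S) := by
      rw [div_add_one hRS.ne']
      gcongr
      linarith
    have h5 := mul_le_mul_of_nonneg_left h4 hδ.1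
    linarith

/-- Quasi-geodesics stay close to geodesics. -/
theorem height (hδ : IsHyp X δ) (hS : 0 ≤ S) (hK : 0 ≤ K) (hC : 0 ≤ C) : ∃ R : ℝ, 0 ≤ R ∧
    ∀ (z : ℕ → X) (l : ℕ → ℝ) (n : ℕ), IsQGChain z l n S K C →
      ∀ i ≤ n, gromovProduct (z i) (z 0) (z n) ≤ R := by
  have hδ0 := hδ.1
  -- Since `r > 2 * K * δ`, the drift `δ / r` per unit of label is less than `1 / (2 * K)` when `K >
  -- 0`: over an excursion it accounts for at most half the distance of the ends, up to a constant.
  set r : ℝ := δ + 2 * K * δ + 1 with hr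
  have hKδ : 0 ≤ K * δ := mul_nonneg hK hδ0
  have hr0 : 0 < r := by rw [hr]; linarith
  set R := S + r with hR
  set D : ℝ := 2 * (4 * S + 2 * R + 3 * δ + C) with hD
  have hD0 : 0 ≤ D := by rw [hD]; linarith
  have hKD : 0 ≤ K * D := mul_nonneg hK hD0
  refine ⟨R + (K * D + C), by linarith, ?_⟩
  intro z l n h i hi
  set η : ℕ → ℝ := fun k => gromovProduct (z k) (z 0) (z n) with hη
  by_cases hle : η i ≤ R
  · exact hle.trans (by linarith)
  push Not at hle
  have η0 : η 0 ≤ R := by simp only [hη, gromovProduct_self_left]; linarith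
  have ηn : η n ≤ R := by simp only [hη, gromovProduct_self_right]; linarith
  classical
  -- The excursion above height `R` around `i` lies between `s`, the last low index before `i`, and
  -- `t`, the first low index after it. The ends being low, their distance is controlled by the
  -- drift, which bounds it and then the label length of the excursion.
  have hs := Nat.findGreatest_spec (P := fun k => η k ≤ R) (Nat.zero_le i) η0
  have hsi : Nat.findGreatest (fun k => η k ≤ R) i ≤ i := Nat.findGreatest_le _
  have hsmax : ∀ k, Nat.findGreatest (fun k => η k ≤ R) i < k → k ≤ i → R < η k := fun k h1 h2 =>
    not_le.1 (Nat.findGreatest_is_greatest (P := fun k => η k ≤ R) h1 h2)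
  set s := Nat.findGreatest (fun k => η k ≤ R) i
  have hex : ∃ t, i ≤ t ∧ η t ≤ R := ⟨n, hi, ηn⟩
  obtain ⟨hit, ht⟩ := Nat.find_spec hex
  have htn : Nat.find hex ≤ n := Nat.find_min' hex ⟨hi, ηn⟩
  have htmin : ∀ k, i ≤ k → k < Nat.find hex → R < η k := fun k h1 h2 => by
    by_contra hc
    exact Nat.find_min hex h2 ⟨h1, not_lt.1 hc⟩
  set t := Nat.find hex
  have hsi' : s ≠ i := fun e => by rw [e] at hs; linarith
  have hti' : t ≠ i := fun e => by rw [e] at ht; linarith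
  have hdr := h.drift hδ (R := R) hS (by linarith) (by linarith) (z 0) (z n) (t - 1 - (s + 1))
    (s + 1) (t - 1) (by omega) (by omega) (fun k h1 h2 => by
      rcases le_total k i with h3 | h3
      · exact hsmax k (by omega) h3
      · exact htmin k h3 (by omega))
  have hs1 := h.dist_step s (by omega)
  have hs2 := h.step_le s (by omega)
  have ht1 := h.dist_step (t - 1) (by omega)
  have ht2 := h.step_le (t - 1) (by omega)
  rw [Nat.sub_add_cancel (by omega : 1 ≤ t)] at ht1 ht2
  have hc := hδ.dist_le_coord (z 0) (z n) (z (s + 1)) (z (t - 1))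
  have hη1 := gromovProduct_base_le (z (s + 1)) (z s) (z 0) (z n)
  have hη2 := gromovProduct_base_le (z (t - 1)) (z t) (z 0) (z n)
  rw [dist_comm] at hη1
  have htri := dist_triangle4 (z s) (z (s + 1)) (z (t - 1)) (z t)
  have hqg := h.qg s t (by omega) htn
  have hL : l (t - 1) - l (s + 1) ≤ K * dist (z s) (z t) + C := by
    have := dist_nonneg.trans hs1; have := dist_nonneg.trans ht1; linarith
  have hRS : R - S = r := by rw [hR]; ring
  rw [hRS] at hdr
  have hfrac : δ * ((l (t - 1) - l (s + 1)) / r) ≤ dist (z s) (z t) / 2 + C := by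
    rw [← mul_div_assoc, div_le_iff₀ hr0]
    have h1 := mul_le_mul_of_nonneg_left hL hδ0
    have h2 : 0 ≤ dist (z s) (z t) := dist_nonneg
    rw [hr]
    nlinarith [mul_nonneg h2 hδ0, mul_nonneg hKδ hC]
  have hdist : dist (z s) (z t) ≤ D := by
    rw [hD]
    change gromovProduct (z s) (z 0) (z n) ≤ R at hs
    change gromovProduct (z t) (z 0) (z n) ≤ R at ht
    linarith
  have hfin : η i ≤ η s + dist (z i) (z s) := gromovProduct_base_le _ _ _ _
  have h1 := h.dist_le (i := s) (j := i) (by omega) hi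
  rw [dist_comm] at h1
  have h2 := h.label_mono (i := i) (j := t) hit htn
  have h3 := mul_le_mul_of_nonneg_left hdist hK
  change η i ≤ _
  linarith

end IsQGChain

/-- Discrete intermediate value property. -/
theorem exists_near_of_steps {p : ℕ → ℝ} {n : ℕ} {S v : ℝ} (hS : 0 ≤ S)
    (hp : ∀ i < n, |p (i + 1) - p i| ≤ S)
    (h0 : p 0 ≤ v) (hn : v ≤ p n) : ∃ i ≤ n, |p i - v| ≤ S := by
  classical
  have hex : ∃ i, v ≤ p i := ⟨n, hn⟩
  have hi := Nat.find_spec hex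
  have hin : Nat.find hex ≤ n := Nat.find_min' hex hn
  rcases Nat.eq_zero_or_pos (Nat.find hex) with e | e
  · rw [e] at hi
    exact ⟨0, Nat.zero_le _, by rw [abs_le]; constructor <;> linarith⟩
  · have h1 := Nat.find_min hex (m := Nat.find hex - 1) (by omega)
    have h2 := hp (Nat.find hex - 1) (by omega)
    rw [Nat.sub_add_cancel e] at h2
    have h3 := le_abs_self (p (Nat.find hex) - p (Nat.find hex - 1))
    exact ⟨_, hin, by rw [abs_le]; constructor <;> linarith⟩

namespace IsQGChain

variable {S K C δ : ℝ}

/-- Points close to a geodesic are close to a quasi-geodesic with the same endpoints. -/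
theorem exists_near (hδ : IsHyp X δ) (hS : 0 ≤ S) (hK : 0 ≤ K) (hC : 0 ≤ C) : ∃ R : ℝ, 0 ≤ R ∧
    ∀ (z : ℕ → X) (l : ℕ → ℝ) (n : ℕ), IsQGChain z l n S K C →
      ∀ m, ∃ i ≤ n, dist m (z i) ≤ gromovProduct m (z 0) (z n) + R := by
  obtain ⟨R, hR0, hR⟩ := height hδ hS hK hC
  refine ⟨S + R + 2 * δ, by linarith [hδ.1], fun z l n h m => ?_⟩
  -- The coordinate along `[z 0, z n]` runs from `0` to the full distance in steps of at most `S`,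
  -- so some `z i` has nearly the coordinate of `m`; its height is bounded by `height`.
  obtain ⟨i, hi, hi'⟩ := exists_near_of_steps (p := fun i => gromovProduct (z 0) (z n) (z i))
    (n := n) (S := S) (v := gromovProduct (z 0) (z n) m) hS (fun i hi => by
      have h1 := gromovProduct_right_le (z 0) (z n) (z i) (z (i + 1))
      have h2 := gromovProduct_right_le (z 0) (z n) (z (i + 1)) (z i)
      have h3 := h.dist_step i hi
      have h4 := h.step_le i hi
      rw [dist_comm] at h2
      rw [abs_le]; constructor <;> linarith)
    (by simp only [gromovProduct_self_right]; exact gromovProduct_nonneg _ _ _)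
    (by
      refine (gromovProduct_le_left _ _ _).trans ?_
      simp [gromovProduct])
  refine ⟨i, hi, ?_⟩
  have h1 := hδ.dist_le_coord (z 0) (z n) (z i) m
  rw [dist_comm] at h1
  have h2 := hR z l n h i hi
  linarith

end IsQGChain

end Morse

/-! ### The discounted distance and its coarse additivity -/

section Discount

variable {X : Type v} [MetricSpace X]

/-- Costs of chains from `x` to `y`, where a jump along a pair in `P` gets the discount `W`. -/
inductive IsCost (P : X → X → Prop) (W : ℝ) : X → X → ℝ → Prop
  | direct (x y : X) : IsCost P W x y (dist x y)
  | step (x p q y : X) (c : ℝ) : P p q → IsCost P W q y c →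
      IsCost P W x y (dist x p + (dist p q - W) + c)

/-- The discounted (asymmetric) distance. -/
noncomputable def discDist (P : X → X → Prop) (W : ℝ) (x y : X) : ℝ :=
  sInf {c | IsCost P W x y c}

/-- The pairs in `P` are long compared with the discount `W`. -/
def IsLongFor (W : ℝ) (P : X → X → Prop) : Prop :=
  0 ≤ W ∧ ∀ p q, P p q → 2 * W + 1 ≤ dist p q

variable {P : X → X → Prop} {W : ℝ}

/-- A discounted jump is longer than `2 * W`, so it still costs at least half its length. -/
theorem IsCost.half_le (hP : IsLongFor W P) {x y : X} {c : ℝ} (h : IsCost P W x y c) :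
    dist x y / 2 ≤ c := by
  induction h with
  | direct x y => linarith [dist_nonneg (x := x) (y := y)]
  | step x p q y c hpq _ ih =>
    have h1 := dist_triangle4 x p q y
    have h2 := hP.2 p q hpq
    linarith [dist_nonneg (x := x) (y := p)]

theorem IsCost.trans {x y z : X} {c c' : ℝ} (h : IsCost P W x y c) (h' : IsCost P W y z c') :
    ∃ c'' ≤ c + c', IsCost P W x z c'' := by
  induction h with
  | direct x y =>
    cases h' with
    | direct => exact ⟨_, dist_triangle x y z, .direct x z⟩
    | step _ p q _ c hpq hc =>
      refine ⟨_, ?_, .step x p q z c hpq hc⟩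
      linarith [dist_triangle x y p]
  | step x p q y c hpq _ ih =>
    obtain ⟨c'', hc'', hz⟩ := ih h'
    exact ⟨_, by linarith, .step x p q z c'' hpq hz⟩

theorem bddBelow_cost (hP : IsLongFor W P) (x y : X) : BddBelow {c | IsCost P W x y c} :=
  ⟨dist x y / 2, fun _ h => IsCost.half_le hP h⟩

theorem IsCost.discDist_le (hP : IsLongFor W P) {x y : X} {c : ℝ} (h : IsCost P W x y c) :
    discDist P W x y ≤ c := csInf_le (bddBelow_cost hP x y) h

theorem exists_cost_lt {x y : X} {c : ℝ} (hc : discDist P W x y < c) :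
    ∃ c' < c, IsCost P W x y c' := by
  obtain ⟨c', h, h'⟩ := exists_lt_of_csInf_lt ⟨_, IsCost.direct x y⟩ hc
  exact ⟨c', h', h⟩

theorem discDist_le_dist (hP : IsLongFor W P) (x y : X) : discDist P W x y ≤ dist x y :=
  (IsCost.direct x y).discDist_le hP

theorem half_dist_le_discDist (hP : IsLongFor W P) (x y : X) :
    dist x y / 2 ≤ discDist P W x y :=
  le_csInf ⟨_, IsCost.direct x y⟩ fun _ h => IsCost.half_le hP h

theorem discDist_nonneg (hP : IsLongFor W P) (x y : X) : 0 ≤ discDist P W x y :=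
  (half_dist_le_discDist hP x y).trans' (by positivity)

theorem discDist_triangle (hP : IsLongFor W P) (x y z : X) :
    discDist P W x z ≤ discDist P W x y + discDist P W y z := by
  refine le_of_forall_pos_le_add fun ε hε => ?_
  obtain ⟨c, hc, h⟩ := exists_cost_lt (P := P) (W := W) (x := x) (y := y)
    (c := discDist P W x y + ε / 2) (by linarith)
  obtain ⟨c', hc', h'⟩ := exists_cost_lt (P := P) (W := W) (x := y) (y := z)
    (c := discDist P W y z + ε / 2) (by linarith)
  obtain ⟨c'', hc'', h''⟩ := h.trans h'
  linarith [h''.discDist_le hP]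

theorem discDist_pair_le (hP : IsLongFor W P) {p q : X} (h : P p q) :
    discDist P W p q ≤ dist p q - W := by
  have := (IsCost.step p p q q _ h (.direct q q)).discDist_le hP
  simpa using this

theorem IsCost.map {g : X ≃ᵢ X} (hg : ∀ p q, P p q → P (g p) (g q)) {x y : X} {c : ℝ}
    (h : IsCost P W x y c) : IsCost P W (g x) (g y) c := by
  induction h with
  | direct x y => rw [← g.dist_eq x y]; exact .direct _ _
  | step x p q y c hpq _ ih =>
    rw [← g.dist_eq x p, ← g.dist_eq p q]
    exact .step _ _ _ _ _ (hg _ _ hpq) ih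

theorem discDist_map {g : X ≃ᵢ X} (hg : ∀ p q, P p q ↔ P (g p) (g q)) (x y : X) :
    discDist P W (g x) (g y) = discDist P W x y := by
  refine congrArg sInf (Set.ext fun c => ⟨fun h => ?_, fun h => h.map fun p q => (hg p q).1⟩)
  have := IsCost.map (g := g.symm) (fun p q hpq => (hg _ _).2 (by simpa using hpq)) h
  simpa using this

/-- A discrete path from `x` to `y` with fine steps, almost optimal for `discDist`; `κ` is the cost
so far and `c` the total cost. -/
structure IsTrace (P : X → X → Prop) (W : ℝ) (z : ℕ → X) (κ : ℕ → ℝ) (n : ℕ) (x y : X) (c : ℝ) :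
    Prop where
  start : z 0 = x
  finish : z n = y
  cost_start : κ 0 = 0
  cost_finish : κ n = c
  dist_step : ∀ i < n, dist (z i) (z (i + 1)) ≤ 2 * (κ (i + 1) - κ i)
  step_le : ∀ i < n, κ (i + 1) - κ i ≤ 1
  from_start : ∀ i ≤ n, discDist P W x (z i) ≤ κ i + (W + 1)
  to_finish : ∀ i ≤ n, discDist P W (z i) y ≤ c - κ i + (W + 1)

/-- A single segment, discounted or not, is replaced by an almost shortest path, traversed
proportionally to cost. The strict inequality `dist x y < 2 * c` leaves room for a path of length at
most `2 * c`, hence the factor `2` in `IsTrace.dist_step`. -/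
theorem exists_trace_segment (hX : IsLengthSpace X) (hP : IsLongFor W P) {x y : X} {c : ℝ}
    (hc : c ≤ dist x y) (hc' : dist x y ≤ c + W) (hc2 : dist x y < 2 * c ∨ x = y) (hc0 : 0 ≤ c) :
    ∃ z κ n, IsTrace P W z κ n x y c := by
  have hW := hP.1
  by_cases hxy : x = y
  · subst hxy
    have hc0 : c = 0 := le_antisymm (by simpa using hc) hc0
    have h0 := discDist_le_dist hP x x
    rw [dist_self] at h0
    refine ⟨fun _ => x, fun _ => 0, 0, rfl, rfl, rfl, hc0.symm, by simp, by simp, ?_, ?_⟩ <;>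
    · intro i _; linarith
  replace hc2 := hc2.resolve_right hxy
  obtain ⟨L, γ, hL0, hL, hγ0, hγL, hγ⟩ := hX x y (min 1 (2 * c - dist x y))
    (lt_min one_pos (by linarith))
  have hL1 : L ≤ dist x y + 1 := hL.trans (by linarith [min_le_left 1 (2 * c - dist x y)])
  have hL2 : L ≤ 2 * c := hL.trans (by linarith [min_le_right 1 (2 * c - dist x y)])
  have hdγ : ∀ s t, 0 ≤ s → s ≤ t → t ≤ L → dist (γ s) (γ t) ≤ t - s := fun s t h0 h1 h2 => by
    have := hγ.dist_le_mul s ⟨h0, h1.trans h2⟩ t ⟨h0.trans h1, h2⟩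
    rw [dist_comm s t, Real.dist_eq, abs_of_nonneg (by linarith)] at this
    simpa using this
  have hdL : dist x y ≤ L := by
    have := hdγ 0 L le_rfl hL0 le_rfl
    rw [hγ0, hγL] at this; linarith
  set n : ℕ := ⌈c⌉₊ + 1 with hn
  have hn0 : (0 : ℝ) < n := by rw [hn]; positivity
  have hcn : c / n ≤ 1 := by
    rw [div_le_one hn0, hn]; push_cast; linarith [Nat.le_ceil c]
  have hfrac : ∀ i : ℕ, i ≤ n → (0 : ℝ) ≤ i / n ∧ (i / n : ℝ) ≤ 1 := fun i hi =>
    ⟨by positivity, by rw [div_le_one hn0]; exact_mod_cast hi⟩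
  refine ⟨fun i => γ (i / n * L), fun i => i / n * c, n, by simpa using hγ0, ?_, by simp, ?_, ?_,
    ?_, ?_, ?_⟩
  · simp only [div_self hn0.ne', one_mul]; exact hγL
  · simp only [div_self hn0.ne', one_mul]
  · intro i hi
    obtain ⟨h1, -⟩ := hfrac i hi.le
    obtain ⟨-, h2⟩ := hfrac (i + 1) hi
    have e : ((i + 1 : ℕ) : ℝ) / n = i / n + 1 / n := by push_cast; ring
    have h3 : (0 : ℝ) < 1 / n := by positivity
    rw [e] at h2 ⊢
    refine (hdγ _ _ (by positivity) (by nlinarith) (by nlinarith)).trans ?_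
    nlinarith
  · intro i hi
    have e : ((i + 1 : ℕ) : ℝ) / n = i / n + 1 / n := by push_cast; ring
    rw [e]
    have : (i / n + 1 / n) * c - i / n * c = c / n := by ring
    linarith
  · intro i hi
    obtain ⟨h1, h2⟩ := hfrac i hi
    have h3 := discDist_le_dist hP x (γ (i / n * L))
    have h4 := hdγ 0 (i / n * L) le_rfl (by positivity) (by nlinarith)
    rw [hγ0] at h4
    nlinarith
  · intro i hi
    obtain ⟨h1, h2⟩ := hfrac i hi
    have h3 := discDist_le_dist hP (γ (i / n * L)) y
    have h4 := hdγ (i / n * L) L (by positivity) (by nlinarith) le_rfl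
    rw [hγL] at h4
    nlinarith

theorem IsTrace.append (hP : IsLongFor W P) {z z' : ℕ → X} {κ κ' : ℕ → ℝ} {n n' : ℕ}
    {x m y : X} {c c' : ℝ} (h : IsTrace P W z κ n x m c) (h' : IsTrace P W z' κ' n' m y c')
    (hc : discDist P W x m ≤ c) (hc' : discDist P W m y ≤ c') :
    IsTrace P W (fun i => if i ≤ n then z i else z' (i - n))
      (fun i => if i ≤ n then κ i else c + κ' (i - n)) (n + n') x y (c + c') := by
  have hz : ∀ i, n ≤ i → (if i ≤ n then z i else z' (i - n)) = z' (i - n) := fun i hi => by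
    split_ifs with h1
    · obtain rfl : i = n := by omega
      simp [h.finish, h'.start]
    · rfl
  have hκ : ∀ i, n ≤ i → (if i ≤ n then κ i else c + κ' (i - n)) = c + κ' (i - n) := fun i hi => by
    split_ifs with h1
    · obtain rfl : i = n := by omega
      simp [h.cost_finish, h'.cost_start]
    · rfl
  refine ⟨by simp [h.start], ?_, by simp [h.cost_start], ?_, ?_, ?_, ?_, ?_⟩
  · rw [hz _ (by omega)]; simp [h'.finish]
  · rw [hκ _ (by omega)]; simp [h'.cost_finish]
  · intro i hi
    rcases lt_or_ge i n with hin | hin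
    · rw [if_pos hin.le, if_pos (Nat.succ_le_of_lt hin), if_pos hin.le,
        if_pos (Nat.succ_le_of_lt hin)]
      exact h.dist_step i hin
    · rw [hz i hin, hz (i + 1) (by omega), hκ i hin, hκ (i + 1) (by omega), Nat.sub_add_comm hin]
      linarith [h'.dist_step (i - n) (by omega)]
  · intro i hi
    rcases lt_or_ge i n with hin | hin
    · rw [if_pos hin.le, if_pos (Nat.succ_le_of_lt hin)]
      exact h.step_le i hin
    · rw [hκ i hin, hκ (i + 1) (by omega), Nat.sub_add_comm hin]
      linarith [h'.step_le (i - n) (by omega)]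
  · intro i hi
    rcases le_total i n with hin | hin
    · rw [if_pos hin, if_pos hin]
      exact h.from_start i hin
    · rw [hz i hin, hκ i hin]
      linarith [h'.from_start (i - n) (by omega), discDist_triangle hP x m (z' (i - n))]
  · intro i hi
    rcases le_total i n with hin | hin
    · rw [if_pos hin, if_pos hin]
      linarith [h.to_finish i hin, discDist_triangle hP (z i) m y]
    · rw [hz i hin, hκ i hin]
      linarith [h'.to_finish (i - n) (by omega)]

theorem IsCost.exists_trace (hX : IsLengthSpace X) (hP : IsLongFor W P) {x y : X} {c : ℝ}
    (h : IsCost P W x y c) : ∃ z κ n, IsTrace P W z κ n x y c := by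
  have hW := hP.1
  have key : ∀ x y : X, ∃ z κ n, IsTrace P W z κ n x y (dist x y) := fun x y => by
    refine exists_trace_segment hX hP le_rfl (by linarith) ?_ dist_nonneg
    by_cases hxy : x = y
    · exact .inr hxy
    · left; linarith [dist_pos.2 hxy]
  induction h with
  | direct x y => exact key x y
  | step x p q y c hpq hc ih =>
    obtain ⟨z₁, κ₁, n₁, h₁⟩ := key x p
    obtain ⟨z₃, κ₃, n₃, h₃⟩ := ih
    have h2 := hP.2 p q hpq
    obtain ⟨z₂, κ₂, n₂, h₂⟩ := exists_trace_segment hX hP (x := p) (y := q) (c := dist p q - W)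
      (by linarith) (by linarith) (.inl (by linarith)) (by linarith)
    have hD1 := discDist_le_dist hP x p
    have hD2 := discDist_pair_le hP hpq
    have h12 := h₁.append hP h₂ hD1 hD2
    have hD12 := discDist_triangle hP x p q
    exact ⟨_, _, _, h12.append hP h₃ (by linarith) (hc.discDist_le hP)⟩

/-- A shortcut between two points of a nearly optimal trace would lower the total cost. The
constants depend on `W` and `E` but not on `P`, which is what makes all later bounds uniform in the
word being counted. -/
theorem IsTrace.isQGChain (hP : IsLongFor W P) {z : ℕ → X} {κ : ℕ → ℝ} {n : ℕ} {x y : X}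
    {c E : ℝ} (h : IsTrace P W z κ n x y c) (hc : c ≤ discDist P W x y + E) :
    IsQGChain z (fun i => 2 * κ i) n 2 2 (4 * W + 4 + 2 * E) := by
  refine ⟨fun i hi => ?_, fun i hi => ?_, fun i j hij hj => ?_⟩
  · linarith [h.dist_step i hi]
  · linarith [h.step_le i hi]
  · have h1 := discDist_triangle hP x (z i) y
    have h2 := discDist_triangle hP (z i) (z j) y
    have h3 := discDist_le_dist hP (z i) (z j)
    linarith [h.from_start i (hij.trans hj), h.to_finish j hj]

variable {δ : ℝ}

theorem exists_trace_near (hX : IsLengthSpace X) (hP : IsLongFor W P) (x y : X) :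
    ∃ c ≤ discDist P W x y + 1, discDist P W x y ≤ c ∧ ∃ z κ n, IsTrace P W z κ n x y c := by
  obtain ⟨c, hc, h⟩ := exists_cost_lt (P := P) (W := W) (x := x) (y := y)
    (c := discDist P W x y + 1) (by linarith)
  exact ⟨c, hc.le, h.discDist_le hP, h.exists_trace hX hP⟩

/-- A point almost between `x` and `y` for the discounted distance is almost between them. -/
theorem gromovProduct_le_of_discDist (hδ : IsHyp X δ) (hX : IsLengthSpace X) (hW : 0 ≤ W) {E : ℝ}
    (hE : 0 ≤ E) : ∃ R : ℝ, 0 ≤ R ∧ ∀ P : X → X → Prop, IsLongFor W P → ∀ x y m,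
      discDist P W x m + discDist P W m y ≤ discDist P W x y + E → gromovProduct m x y ≤ R := by
  obtain ⟨R, hR0, hR⟩ := IsQGChain.height hδ (S := 2) (K := 2) (C := 4 * W + 4 + 2 * (E + 2))
    (by norm_num) (by norm_num) (by linarith)
  refine ⟨R, hR0, fun P hP x y m hm => ?_⟩
  obtain ⟨c, hc, hc', z, κ, n, h⟩ := exists_trace_near hX hP x m
  obtain ⟨d, hd, hd', z', κ', n', h'⟩ := exists_trace_near hX hP m y
  -- The concatenation through `m` is still nearly optimal, hence a quasi-geodesic, and its point
  -- `m` is close to the geodesic.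
  have H := h.append hP h' hc' hd'
  have := hR _ _ _ (H.isQGChain hP (E := E + 2) (by linarith)) n (by omega)
  rw [H.start, H.finish, if_pos le_rfl, h.finish] at this
  exact this

/-- A point almost between `x` and `y` is almost between them for the discounted distance. -/
theorem discDist_le_of_gromovProduct (hδ : IsHyp X δ) (hX : IsLengthSpace X) (hW : 0 ≤ W) :
    ∃ R : ℝ, 0 ≤ R ∧ ∀ P : X → X → Prop, IsLongFor W P → ∀ x y m,
      discDist P W x m + discDist P W m y ≤
        discDist P W x y + 2 * gromovProduct m x y + R := by
  obtain ⟨R, hR0, hR⟩ := IsQGChain.exists_near hδ (S := 2) (K := 2) (C := 4 * W + 4 + 2 * 1)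
    (by norm_num) (by norm_num) (by linarith)
  refine ⟨2 * R + 2 * W + 3, by linarith, fun P hP x y m => ?_⟩
  obtain ⟨c, hc, hc', z, κ, n, h⟩ := exists_trace_near hX hP x y
  obtain ⟨i, hi, hm⟩ := hR _ _ _ (h.isQGChain hP hc) m
  rw [h.start, h.finish] at hm
  have h1 := discDist_triangle hP x (z i) m
  have h2 := discDist_triangle hP m (z i) y
  have h3 := discDist_le_dist hP (z i) m
  have h4 := discDist_le_dist hP m (z i)
  rw [dist_comm] at h3
  linarith [h.from_start i hi, h.to_finish i hi]

/-- If the discounted distance is smaller than the distance, some discounted pair occurs in order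
near a geodesic. -/
theorem exists_pair_of_discDist_lt (hδ : IsHyp X δ) (hX : IsLengthSpace X) (hW : 0 ≤ W) :
    ∃ R : ℝ, 0 ≤ R ∧ ∀ P : X → X → Prop, IsLongFor W P → ∀ x y, discDist P W x y < dist x y →
      ∃ p q, P p q ∧ gromovProduct p x y ≤ R ∧ gromovProduct q x y ≤ R ∧
        dist x p + dist p q ≤ dist x q + W + 1 := by
  obtain ⟨R, hR0, hR⟩ := gromovProduct_le_of_discDist hδ hX hW (E := 1) zero_le_one
  refine ⟨R, hR0, fun P hP x y hlt => ?_⟩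
  obtain ⟨c, hc, h⟩ := exists_cost_lt (P := P) (W := W) (x := x) (y := y)
    (c := min (dist x y) (discDist P W x y + 1)) (lt_min hlt (by linarith))
  have hc1 := hc.trans_le (min_le_left _ _)
  have hc2 := hc.trans_le (min_le_right _ _)
  -- A chain cheaper than `dist x y` contains a jump; the first one is taken. Near optimality of the
  -- chain places `p` and `q` almost between `x` and `y` for the discounted distance.
  cases h with
  | direct => exact absurd hc1 (lt_irrefl _)
  | step _ p q _ c hpq hq =>
    have h1 := hq.discDist_le hP
    have h2 := discDist_le_dist hP x p
    have h3 := discDist_pair_le hP hpq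
    have h4 := discDist_triangle hP p q y
    have h5 := discDist_triangle hP x p q
    have h6 := discDist_triangle hP x q y
    have h7 := discDist_le_dist hP x q
    exact ⟨p, q, hpq, hR P hP x y p (by linarith), hR P hP x y q (by linarith), by linarith⟩

/-- The centre is taken on an almost shortest path from `x` to `y`, at parameter `gromovProduct x y
z`, where the tripod of the triangle branches. -/
theorem exists_center (hδ : IsHyp X δ) (hX : IsLengthSpace X) (x y z : X) :
    ∃ m, gromovProduct m x y ≤ 2 + 2 * δ ∧ gromovProduct m x z ≤ 2 + 2 * δ ∧
      gromovProduct m y z ≤ 2 + 2 * δ := by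
  have hδ0 := hδ.1
  obtain ⟨L, γ, hL0, hL, hγ0, hγL, hγ⟩ := hX x y 1 one_pos
  have hs0 := gromovProduct_nonneg x y z
  have hsd := gromovProduct_le_left x y z
  set s := gromovProduct x y z with hs
  have hdL : dist x y ≤ L := by
    have := hγ.dist_le_mul 0 ⟨le_rfl, hL0⟩ L ⟨hL0, le_rfl⟩
    rw [hγ0, hγL, dist_comm 0 L, Real.dist_eq, sub_zero, abs_of_nonneg hL0] at this
    simpa using this
  have h1 : dist x (γ s) ≤ s := by
    have := hγ.dist_le_mul 0 ⟨le_rfl, hL0⟩ s ⟨hs0, hsd.trans hdL⟩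
    rw [hγ0, dist_comm 0 s, Real.dist_eq, sub_zero, abs_of_nonneg hs0] at this
    simpa using this
  have h2 : dist y (γ s) ≤ L - s := by
    have := hγ.dist_le_mul L ⟨hL0, le_rfl⟩ s ⟨hs0, hsd.trans hdL⟩
    rw [hγL, Real.dist_eq, abs_of_nonneg (by linarith)] at this
    simpa using this
  have h3 := hδ.dist_le_coord x y (γ s) z
  have h4 := dist_triangle_right x y (γ s)
  have h5 : |gromovProduct x y (γ s) - gromovProduct x y z| ≤ 1 := by
    rw [abs_le, ← hs]
    simp only [gromovProduct]
    constructor <;> linarith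
  have h6 : gromovProduct (γ s) x y ≤ 1 / 2 := by
    simp only [gromovProduct, dist_comm (γ s)]; linarith
  refine ⟨γ s, by linarith, ?_, ?_⟩ <;>
  · simp only [gromovProduct, dist_comm (γ s) x, dist_comm (γ s) y, dist_comm z x,
      dist_comm z y] at h3 h5 h6 hs ⊢
    linarith

/-- `H(x, y) = D(y, x) - D(x, y)`. -/
noncomputable def discDiff (P : X → X → Prop) (W : ℝ) (x y : X) : ℝ :=
  discDist P W y x - discDist P W x y

theorem abs_discDiff_le (hP : IsLongFor W P) (x y : X) : |discDiff P W x y| ≤ dist x y := by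
  have h1 := discDist_le_dist hP x y
  have h2 := discDist_le_dist hP y x
  have h3 := discDist_nonneg hP x y
  have h4 := discDist_nonneg hP y x
  rw [dist_comm y x] at h2
  rw [abs_le]; unfold discDiff
  constructor <;> linarith

/-- The centre `m` almost splits each of the six discounted distances between the vertices; after
splitting, all terms cancel. -/
theorem exists_discDiff_cocycle_bound (hδ : IsHyp X δ) (hX : IsLengthSpace X) (hW : 0 ≤ W) :
    ∃ B : ℝ, 0 ≤ B ∧ ∀ P : X → X → Prop, IsLongFor W P → ∀ x y z,
      |discDiff P W x y + discDiff P W y z - discDiff P W x z| ≤ B := by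
  obtain ⟨R, hR0, hR⟩ := discDist_le_of_gromovProduct hδ hX hW
  refine ⟨3 * (2 * (2 + 2 * δ) + R), by linarith [hδ.1], fun P hP x y z => ?_⟩
  obtain ⟨m, h1, h2, h3⟩ := exists_center hδ hX x y z
  have a1 := hR P hP x y m
  have a2 := hR P hP y x m
  have a3 := hR P hP x z m
  have a4 := hR P hP z x m
  have a5 := hR P hP y z m
  have a6 := hR P hP z y m
  rw [gromovProduct_comm m y x] at a2
  rw [gromovProduct_comm m z x] at a4
  rw [gromovProduct_comm m z y] at a6
  have b1 := discDist_triangle hP x m y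
  have b2 := discDist_triangle hP y m x
  have b3 := discDist_triangle hP x m z
  have b4 := discDist_triangle hP z m x
  have b5 := discDist_triangle hP y m z
  have b6 := discDist_triangle hP z m y
  rw [abs_le]; unfold discDiff
  constructor <;> linarith

end Discount

/-! ### Quasi-geodesic rays and fixed points of loxodromic isometries -/

section Rays

variable {X : Type v} [MetricSpace X] {δ : ℝ}

theorem asymptotic_of_base (o : X) {w w' : ℕ → X}
    (h : ∀ T : ℝ, ∃ k : ℕ, ∀ m ≥ k, ∀ n ≥ k, T ≤ gromovProduct o (w m) (w' n)) :
    Asymptotic w w' := by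
  intro o' T
  obtain ⟨k, hk⟩ := h (T + dist o o')
  refine ⟨k, fun m hm n hn => ?_⟩
  linarith [hk m hm n hn, gromovProduct_base_le o o' (w m) (w' n)]

theorem Asymptotic.of_bounded {w w' w'' : ℕ → X} (h : Asymptotic w w') {D : ℝ}
    (hD : ∀ n, dist (w' n) (w'' n) ≤ D) : Asymptotic w w'' := by
  intro o T
  obtain ⟨k, hk⟩ := h o (T + D)
  refine ⟨k, fun m hm n hn => ?_⟩
  linarith [hk m hm n hn, gromovProduct_right_le o (w m) (w' n) (w'' n), hD n]

/-- A discrete quasi-geodesic ray, through the consequences of quasi-geodesicity that hold with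
constant `R` in a hyperbolic space. -/
structure IsGoodRay (z : ℕ → X) (R : ℝ) : Prop where
  between : ∀ i j k, i ≤ j → j ≤ k → gromovProduct (z j) (z i) (z k) ≤ R
  near : ∀ n m, ∃ i ≤ n, dist m (z i) ≤ gromovProduct m (z 0) (z n) + R
  proper : ∀ T : ℝ, ∃ k : ℕ, ∀ i j, i + k ≤ j → T ≤ dist (z i) (z j)

theorem isGoodRay_of_quasiGeodesic (hδ : IsHyp X δ) {B K C : ℝ} (hB : 0 ≤ B) (hK : 0 ≤ K)
    (hC : 0 ≤ C) : ∃ R : ℝ, 0 ≤ R ∧ ∀ z : ℕ → X, (∀ i, dist (z i) (z (i + 1)) ≤ B) →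
      (∀ i j : ℕ, i ≤ j → (j : ℝ) - i ≤ K * dist (z i) (z j) + C) → IsGoodRay z R := by
  obtain ⟨R₁, hR₁, h₁⟩ := IsQGChain.height hδ hB (mul_nonneg hB hK) (mul_nonneg hB hC)
  obtain ⟨R₂, hR₂, h₂⟩ := IsQGChain.exists_near hδ hB (mul_nonneg hB hK) (mul_nonneg hB hC)
  refine ⟨max R₁ R₂, hR₁.trans (le_max_left _ _), fun z hz hq => ?_⟩
  have chain : ∀ s n, IsQGChain (fun i => z (s + i)) (fun i => B * i) n B (B * K) (B * C) :=
    fun s n => by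
      refine ⟨fun i _ => ?_, fun i _ => ?_, fun i j hij _ => ?_⟩
      · have := hz (s + i)
        push_cast
        rw [add_assoc] at this; linarith
      · push_cast; linarith
      · have := mul_le_mul_of_nonneg_left (hq (s + i) (s + j) (by omega)) hB
        push_cast at this
        linarith
  refine ⟨fun i j k hij hjk => ?_, fun n m => ?_, fun T => ?_⟩
  · have := h₁ _ _ _ (chain i (k - i)) (j - i) (by omega)
    simp only [add_zero, show i + (j - i) = j by omega, show i + (k - i) = k by omega] at this
    exact this.trans (le_max_left _ _)
  · obtain ⟨i, hi, h⟩ := h₂ _ _ _ (chain 0 n) m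
    simp only [zero_add] at h
    exact ⟨i, hi, h.trans (by linarith [le_max_right R₁ R₂])⟩
  · obtain ⟨k, hk⟩ := exists_nat_gt (K * T + C)
    refine ⟨k, fun i j hij => ?_⟩
    by_contra hc
    push Not at hc
    have h1 := hq i j (by omega)
    have h2 := mul_le_mul_of_nonneg_left hc.le hK
    have h3 : (i : ℝ) + k ≤ j := by exact_mod_cast hij
    linarith

namespace IsGoodRay

variable {z : ℕ → X} {R : ℝ}

theorem nonneg (h : IsGoodRay z R) : 0 ≤ R :=
  (gromovProduct_nonneg _ _ _).trans (h.between 0 0 0 le_rfl le_rfl)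

theorem map (h : IsGoodRay z R) (g : X ≃ᵢ X) : IsGoodRay (fun n => g (z n)) R := by
  refine ⟨fun i j k hij hjk => ?_, fun n m => ?_, fun T => ?_⟩
  · rw [gromovProduct_map]; exact h.between i j k hij hjk
  · obtain ⟨i, hi, h'⟩ := h.near n (g.symm m)
    refine ⟨i, hi, ?_⟩
    have e := gromovProduct_map g (g.symm m) (z 0) (z n)
    rw [← g.dist_eq, g.apply_symm_apply] at h'
    rw [g.apply_symm_apply] at e
    rwa [e]
  · obtain ⟨k, hk⟩ := h.proper T
    exact ⟨k, fun i j hij => by rw [g.dist_eq]; exact hk i j hij⟩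

theorem le_gromovProduct (h : IsGoodRay z R) {m n : ℕ} (hmn : m ≤ n) :
    dist (z 0) (z m) - R ≤ gromovProduct (z 0) (z m) (z n) := by
  have h1 := h.between 0 m n (Nat.zero_le _) hmn
  have h2 := gromovProduct_add_gromovProduct (z 0) (z m) (z n)
  linarith

theorem asymptotic_self (h : IsGoodRay z R) : Asymptotic z z := by
  refine asymptotic_of_base (z 0) fun T => ?_
  obtain ⟨k, hk⟩ := h.proper (T + R)
  refine ⟨k, fun m hm n hn => ?_⟩
  rcases le_total m n with hmn | hmn
  · linarith [h.le_gromovProduct hmn, hk 0 m (by omega)]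
  · rw [gromovProduct_comm]
    linarith [h.le_gromovProduct hmn, hk 0 n (by omega)]

theorem asymptotic_of_frequently (hδ : IsHyp X δ) (h : IsGoodRay z R) {ξ : ℕ → X}
    (hξ : ∀ I : ℕ, ∃ i ≥ I, ∃ n₀ : ℕ, ∀ n ≥ n₀,
      dist (z 0) (z i) / 2 - δ ≤ gromovProduct (z 0) (ξ n) (z i)) : Asymptotic ξ z := by
  have hδ0 := hδ.1
  have hR := h.nonneg
  refine asymptotic_of_base (z 0) fun T => ?_
  obtain ⟨I, hI⟩ := h.proper (2 * (max T 0 + R + 2 * δ))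
  obtain ⟨i, hi, n₀, hn₀⟩ := hξ I
  refine ⟨max n₀ i, fun m hm n hn => ?_⟩
  have h1 := hn₀ m (le_of_max_le_left hm)
  have h2 := h.le_gromovProduct (le_of_max_le_right hn)
  have h3 := hI 0 i (by omega)
  have h4 := hδ.2 (z 0) (ξ m) (z i) (z n)
  have hT := le_max_left T 0
  have hT0 := le_max_right T 0
  have h5 : max T 0 + δ ≤ min (gromovProduct (z 0) (ξ m) (z i)) (gromovProduct (z 0) (z i) (z n)) :=
    le_min (by linarith) (by linarith)
  linarith

/-- Points far out between `P 0` and the endpoint of `P` are close to a ray asymptotic to `P`. -/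
theorem exists_close (hδ : IsHyp X δ) (h : IsGoodRay z R) {P : ℕ → X} (hP : Asymptotic P z)
    {R' : ℝ} {m : X} (hm : dist (z 0) (P 0) + R' + δ + 1 ≤ dist (z 0) m)
    (hbtw : ∃ k₀, ∀ k ≥ k₀, gromovProduct m (P 0) (P k) ≤ R') :
    ∃ i, dist m (z i) ≤ R' + 2 * δ + R := by
  obtain ⟨k₀, hk₀⟩ := hbtw
  obtain ⟨k₁, hk₁⟩ := hP m (R' + 2 * δ + 1)
  have h0 := hk₀ (max k₀ k₁) (le_max_left _ _)
  have h1 := hk₁ (max k₀ k₁) (le_max_right _ _) (max k₀ k₁) (le_max_right _ _)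
  set k := max k₀ k₁
  -- Seen from `m`, the points `P 0` and `z 0` are close together, and so are `P k` and `z k`. Thus
  -- `P 0`, `P k` can be exchanged for `z 0`, `z k` at the cost of `2 * δ`.
  have h2 : R' + δ + 1 ≤ gromovProduct m (P 0) (z 0) := by
    have := dist_triangle_right (z 0) m (P 0)
    simp only [gromovProduct, dist_comm m (z 0), dist_comm (P 0) (z 0)] at *
    linarith
  have h3 := hδ.2 m (P 0) (z 0) (P k)
  have h4 : gromovProduct m (z 0) (P k) ≤ R' + δ := by
    by_contra hc
    have := lt_min (lt_of_lt_of_le (lt_add_one (R' + δ)) h2) (not_le.1 hc)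
    linarith
  have h5 := hδ.2 m (z 0) (z k) (P k)
  rw [gromovProduct_comm m (z k) (P k)] at h5
  have h6 : gromovProduct m (z 0) (z k) ≤ R' + 2 * δ := by
    by_contra hc
    have := lt_min (not_le.1 hc) (lt_of_lt_of_le (lt_add_one (R' + 2 * δ)) h1)
    linarith
  obtain ⟨i, -, hi⟩ := h.near k m
  exact ⟨i, by linarith⟩

end IsGoodRay

theorem IsLoxodromic.inv {h : X ≃ᵢ X} (hh : IsLoxodromic h) : IsLoxodromic h⁻¹ := by
  intro x
  obtain ⟨K, C, hK, hC, hq⟩ := hh x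
  refine ⟨K, C, hK, hC, fun i j => ?_⟩
  have := hq (-i) (-j)
  simp only [Int.cast_neg, zpow_neg] at this
  rw [neg_sub_neg, abs_sub_comm] at this
  simpa only [inv_zpow] using this

theorem IsLoxodromic.exists_isGoodRay (hδ : IsHyp X δ) {h : X ≃ᵢ X} (hh : IsLoxodromic h) (x : X) :
    ∃ R, IsGoodRay (fun n : ℕ => (h ^ n) x) R := by
  obtain ⟨K, C, hK, hC, hq⟩ := hh x
  obtain ⟨R, -, hR⟩ := isGoodRay_of_quasiGeodesic hδ (X := X) (B := K + C) (K := K) (C := K * C)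
    (by linarith) (by linarith) (mul_nonneg (by linarith) hC)
  refine ⟨R, hR _ (fun i => ?_) fun i j hij => ?_⟩
  · have := (hq i (i + 1 : ℕ)).2
    simp only [zpow_natCast] at this
    refine this.trans_eq ?_
    push_cast
    rw [show ((i : ℝ) - (i + 1)) = -1 by ring]
    simp
  · have h1 := (hq i j).1
    simp only [zpow_natCast, Int.cast_natCast] at h1
    rw [abs_sub_comm, abs_of_nonneg (sub_nonneg.2 (Nat.cast_le.2 hij)), sub_le_iff_le_add,
      div_le_iff₀ (by linarith)] at h1
    nlinarith

/-- A fixed boundary point of a loxodromic isometry is one of its two endpoints. -/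
theorem asymptotic_of_fixed [GromovHyperbolic X] (hδ : IsHyp X δ) {v : X ≃ᵢ X}
    (hv : IsLoxodromic v) (p : X) {ξ : ℕ → X} (hξ : Asymptotic ξ ξ) (hfix : Asymptotic (fun n => v (ξ n)) ξ) :
    Asymptotic ξ (fun n => (v ^ n) p) ∨ Asymptotic ξ (fun n => (v⁻¹ ^ n) p) := by
  obtain ⟨R₁, h₁⟩ := hv.exists_isGoodRay hδ p
  obtain ⟨R₂, h₂⟩ := hv.inv.exists_isGoodRay hδ p
  have hfixi : ∀ i : ℕ, Asymptotic (fun n => (v ^ i) (ξ n)) ξ := by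
    intro i
    induction i with
    | zero => simpa using hξ
    | succ i ih =>
      have := (hfix.map (v ^ i)).trans ih
      simpa only [pow_succ, IsometryEquiv.mul_apply] using this
  have hfixi' : ∀ i : ℕ, Asymptotic ξ (fun n => (v⁻¹ ^ i) (ξ n)) := by
    intro i
    have := (hfixi i).map (v⁻¹ ^ i)
    simpa only [← IsometryEquiv.mul_apply, inv_pow, inv_mul_cancel, IsometryEquiv.coe_one, id]
      using this
  have hinv : ∀ (i : ℕ) (y : X), (v⁻¹ ^ i) ((v ^ i) y) = y := fun i y => by
    rw [← IsometryEquiv.mul_apply, inv_pow, inv_mul_cancel]; rfl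
  -- The products of `ξ` with `v ^ i p` at `p`, and with `p` at `v ^ i p`, add up to `dist p (v ^ i
  -- p)`, so one of them is at least half. The second is moved to base point `p` by `v⁻¹ ^ i`, which
  -- fixes the endpoint of `ξ`.
  have key : ∀ i : ℕ,
      (∃ n₀ : ℕ, ∀ n ≥ n₀, dist p ((v ^ i) p) / 2 - δ ≤ gromovProduct p (ξ n) ((v ^ i) p)) ∨
      (∃ n₀ : ℕ, ∀ n ≥ n₀,
        dist p ((v⁻¹ ^ i) p) / 2 - δ ≤ gromovProduct p (ξ n) ((v⁻¹ ^ i) p)) := by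
    intro i
    have hd0 : 0 ≤ dist p ((v ^ i) p) := dist_nonneg
    have hd : dist p ((v⁻¹ ^ i) p) = dist p ((v ^ i) p) := by
      rw [← (v⁻¹ ^ i).dist_eq p ((v ^ i) p), hinv, dist_comm]
    obtain ⟨k₁, hk₁⟩ := hξ p (dist p ((v ^ i) p))
    obtain ⟨k₂, hk₂⟩ := hfixi' i p (dist p ((v ^ i) p))
    set n₀ := max k₁ k₂
    have hsum := gromovProduct_add_gromovProduct p ((v ^ i) p) (ξ n₀)
    by_cases hA : dist p ((v ^ i) p) / 2 ≤ gromovProduct p (ξ n₀) ((v ^ i) p)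
    · left
      refine ⟨n₀, fun n hn => ?_⟩
      have h1 := hk₁ n ((le_max_left _ _).trans hn) n₀ (le_max_left _ _)
      have h2 := hδ.2 p (ξ n) (ξ n₀) ((v ^ i) p)
      have h3 := le_min ((half_le_self hd0).trans h1) hA
      linarith
    · right
      refine ⟨n₀, fun n hn => ?_⟩
      have h1 := hk₂ n ((le_max_right _ _).trans hn) n₀ (le_max_right _ _)
      have h2 := hδ.2 p (ξ n) ((v⁻¹ ^ i) (ξ n₀)) ((v⁻¹ ^ i) p)
      have h3 := gromovProduct_map (v⁻¹ ^ i) ((v ^ i) p) (ξ n₀) p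
      rw [hinv] at h3
      rw [gromovProduct_comm _ (ξ n₀) p] at h3
      rw [gromovProduct_comm p (ξ n₀)] at hA
      have h4 := le_min ((half_le_self hd0).trans h1)
        (show dist p ((v ^ i) p) / 2 ≤ gromovProduct p ((v⁻¹ ^ i) (ξ n₀)) ((v⁻¹ ^ i) p) by
          linarith)
      linarith
  by_cases hfr : ∀ I : ℕ, ∃ i ≥ I, ∃ n₀ : ℕ, ∀ n ≥ n₀,
      dist p ((v ^ i) p) / 2 - δ ≤ gromovProduct p (ξ n) ((v ^ i) p)
  · left
    exact h₁.asymptotic_of_frequently hδ (by simpa using hfr)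
  · right
    push Not at hfr
    obtain ⟨I, hI⟩ := hfr
    refine h₂.asymptotic_of_frequently hδ fun J => ⟨max I J, le_max_right _ _, ?_⟩
    rcases key (max I J) with ⟨n₀, h⟩ | h
    · obtain ⟨n, hn, hlt⟩ := hI (max I J) (le_max_left _ _) n₀
      exact absurd (h n hn) (not_le.2 hlt)
    · simpa using h

/-- A loxodromic isometry has at most two fixed points at infinity. -/
theorem exists_asymptotic_of_three_fixed [GromovHyperbolic X] {v : X ≃ᵢ X} (hv : IsLoxodromic v)
    {ξ : Fin 3 → ℕ → X} (hξ : ∀ i, Asymptotic (ξ i) (ξ i))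
    (hfix : ∀ i, Asymptotic (fun n => v (ξ i n)) (ξ i)) :
    ∃ i j, i < j ∧ Asymptotic (ξ i) (ξ j) := by
  obtain ⟨δ, hδ⟩ := exists_isHyp (X := X)
  have key := fun i => asymptotic_of_fixed hδ hv (ξ 0 0) (hξ i) (hfix i)
  rcases key 0 with h0 | h0 <;> rcases key 1 with h1 | h1 <;> rcases key 2 with h2 | h2
  · exact ⟨0, 1, by decide, h0.trans h1.symm⟩
  · exact ⟨0, 1, by decide, h0.trans h1.symm⟩
  · exact ⟨0, 2, by decide, h0.trans h2.symm⟩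
  · exact ⟨1, 2, by decide, h1.trans h2.symm⟩
  · exact ⟨1, 2, by decide, h1.trans h2.symm⟩
  · exact ⟨0, 2, by decide, h0.trans h2.symm⟩
  · exact ⟨0, 1, by decide, h0.trans h1.symm⟩
  · exact ⟨0, 1, by decide, h0.trans h1.symm⟩

end Rays

/-! ### Consequences of WWPD for fellow travelling axes -/

section WWPDElements

variable {X : Type v} [MetricSpace X] {G : Type u} [Group G] {ρ : G →* (X ≃ᵢ X)}

theorem map_mul_apply' (ρ : G →* (X ≃ᵢ X)) (g h : G) (x : X) : ρ (g * h) x = ρ g (ρ h x) := by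
  rw [map_mul, IsometryEquiv.mul_apply]

theorem dist_map_mul (ρ : G →* (X ≃ᵢ X)) (g h k : G) (x : X) :
    dist (ρ (g * h) x) (ρ (g * k) x) = dist (ρ h x) (ρ k x) := by
  rw [map_mul_apply', map_mul_apply', (ρ g).dist_eq]

theorem gromovProduct_map_mul (ρ : G →* (X ≃ᵢ X)) (g h k l : G) (x : X) :
    gromovProduct (ρ (g * h) x) (ρ (g * k) x) (ρ (g * l) x) =
      gromovProduct (ρ h x) (ρ k x) (ρ l x) := by
  simp only [map_mul_apply', gromovProduct_map]

theorem exists_isGoodRay_pow {δ : ℝ} (hδ : IsHyp X δ) {a : G} (ha : IsLoxodromic (ρ a)) (x : X) :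
    ∃ R, IsGoodRay (fun n : ℕ => ρ (a ^ n) x) R := by
  simpa only [map_pow] using ha.exists_isGoodRay hδ x

/-- An element commuting with `k` moves `k p` exactly as far as `p`. With `k` a power of `v`, this
bounds displacements near the axis of `v`. -/
theorem dist_translate_le (ρ : G →* (X ≃ᵢ X)) {v h k : G} {x : X} {R : ℝ}
    (hc : Commute v k) {p : X} (hy : dist (ρ h x) (ρ k p) ≤ R) :
    dist (ρ (v * h) x) (ρ h x) ≤ 2 * R + dist (ρ v p) p := by
  have h1 := dist_triangle4 (ρ (v * h) x) (ρ (v * k) p) (ρ k p) (ρ h x)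
  rw [map_mul_apply' ρ v h, map_mul_apply' ρ v k, (ρ v).dist_eq] at h1
  have h2 : dist (ρ v (ρ k p)) (ρ k p) = dist (ρ v p) p := by
    rw [← map_mul_apply', hc.eq, map_mul_apply', (ρ k).dist_eq]
  rw [h2, dist_comm (ρ k p)] at h1
  rw [map_mul_apply']
  linarith

variable [GromovHyperbolic X]

theorem asymptotic_of_mem_endStabilizer {a : G} (ha : IsLoxodromic (ρ a)) {h : G}
    (hh : h ∈ endStabilizer ρ a) (x : X) :
    Asymptotic (fun n => ρ (h * a ^ n) x) (fun n => ρ (a ^ n) x) := by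
  obtain ⟨δ, hδ⟩ := exists_isHyp (X := X)
  obtain ⟨R, hR⟩ := exists_isGoodRay_pow hδ ha x
  have hatt : IsAttractor (ρ a) (Quotient.mk (SeqToInfinity.setoid X) ⟨_, hR.asymptotic_self⟩) := by
    intro y
    obtain ⟨R', hR'⟩ := exists_isGoodRay_pow hδ ha y
    simp only [← map_pow]
    refine ⟨hR'.asymptotic_self, Quotient.sound (s := SeqToInfinity.setoid X) ?_⟩
    exact hR.asymptotic_self.of_bounded (D := dist x y) fun n => ((ρ (a ^ n)).dist_eq x y).le
  have := Quotient.exact (s := SeqToInfinity.setoid X) (hh _ (.inr hatt))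
  simp only [map_mul_apply']
  exact this

/-- If translates of longer and longer segments of the axis of a WWPD element follow a given ray,
then some translate of the axis is asymptotic to it. -/
theorem IsWWPD.exists_asymptotic {a : G} (ha : IsWWPD ρ a) (x : X) {z : ℕ → X} {Rz R : ℝ}
    (hz : IsGoodRay z Rz) (g : ℕ → G) (s : ℕ → ℕ) (hs : ∀ k, k ≤ s k)
    (h0 : ∀ k, dist (ρ (g k) x) (z 0) ≤ R)
    (h1 : ∀ k, ∃ j, dist (ρ (g k * a ^ s k) x) (z j) ≤ R) :
    ∃ k, Asymptotic (fun n => ρ (g k * a ^ n) x) z := by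
  obtain ⟨δ, hδ⟩ := exists_isHyp (X := X)
  obtain ⟨Ra, hRa⟩ := exists_isGoodRay_pow hδ ha.1 x
  have hR : 0 ≤ R := dist_nonneg.trans (h0 0)
  have hRz := hz.nonneg
  have hRa0 := hRa.nonneg
  have ρ0 : ∀ k, ρ (g k * a ^ 0) x = ρ (g k) x := fun k => by rw [pow_zero, mul_one]
  set R₁ := Ra + 2 * R + Rz with hR₁
  have close : ∀ k M, M ≤ s k → ∃ i, dist (ρ (g k * a ^ M) x) (z i) ≤ R₁ := by
    intro k M hM
    obtain ⟨j, hj⟩ := h1 k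
    obtain ⟨i, -, hi⟩ := hz.near j (ρ (g k * a ^ M) x)
    refine ⟨i, hi.trans ?_⟩
    have e1 := gromovProduct_left_le (ρ (g k * a ^ M) x) (z 0) (ρ (g k * a ^ 0) x) (z j)
    have e2 := gromovProduct_right_le (ρ (g k * a ^ M) x) (ρ (g k * a ^ 0) x) (z j)
      (ρ (g k * a ^ s k) x)
    rw [gromovProduct_map_mul] at e2
    have e3 := hRa.between 0 M (s k) (Nat.zero_le _) hM
    have e4 := h0 k
    rw [dist_comm, ← ρ0 k] at e4
    rw [dist_comm] at hj
    linarith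
  set R₂ := 4 * R₁ + 2 * R + 2 * Rz with hR₂
  have close2 : ∀ k k' M, M ≤ s k → M ≤ s k' →
      dist (ρ (g k * a ^ M) x) (ρ (g k' * a ^ M) x) ≤ R₂ := by
    intro k k' M hM hM'
    obtain ⟨i, hi⟩ := close k M hM
    obtain ⟨i', hi'⟩ := close k' M hM'
    have hd : ∀ k i, dist (ρ (g k * a ^ M) x) (z i) ≤ R₁ →
        |dist (z 0) (z i) - dist (ρ (a ^ 0) x) (ρ (a ^ M) x)| ≤ R + R₁ := by
      intro k i hi
      have e1 := dist_triangle4 (z 0) (ρ (g k * a ^ 0) x) (ρ (g k * a ^ M) x) (z i)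
      have e2 := dist_triangle4 (ρ (g k * a ^ 0) x) (z 0) (z i) (ρ (g k * a ^ M) x)
      have e4 := h0 k
      rw [← ρ0 k] at e4
      rw [dist_map_mul] at e1 e2
      rw [dist_comm (z 0) (ρ (g k * a ^ 0) x)] at e1
      rw [dist_comm (z i) (ρ (g k * a ^ M) x)] at e2
      rw [abs_le]; constructor <;> linarith
    have b1 := abs_le.1 (hd k i hi)
    have b2 := abs_le.1 (hd k' i' hi')
    have hzz : dist (z i) (z i') ≤ 2 * R + 2 * R₁ + 2 * Rz := by
      rcases le_total i i' with h | h
      · have e1 := dist_add_dist_eq (z i) (z 0) (z i')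
        have e2 := hz.between 0 i i' (Nat.zero_le _) h
        linarith
      · have e1 := dist_add_dist_eq (z i') (z 0) (z i)
        have e2 := hz.between 0 i' i (Nat.zero_le _) h
        rw [dist_comm (z i') (z i)] at e1
        linarith
    have e1 := dist_triangle4 (ρ (g k * a ^ M) x) (z i) (z i') (ρ (g k' * a ^ M) x)
    rw [dist_comm (z i') (ρ (g k' * a ^ M) x)] at e1
    linarith
  -- For `k ≥ M` the segment of `g k` has length `s k ≥ M`, so the points `g k * a ^ M` all lie near
  -- one another. Relative to `g M`, the elements `g (M + n)` therefore move both `x` and `a ^ M x`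
  -- by a bounded amount, as WWPD requires.
  obtain ⟨M, -, hM⟩ := ha.2 x (R₂ + 2 * R + 1) (by linarith)
  set f : ℕ → G := fun n => (g M)⁻¹ * g (M + n) with hf
  -- One representative per coset: WWPD makes this set finite, so infinitely many `f n` share a
  -- coset of the stabilizer, and the corresponding translates of the axis share their attracting
  -- endpoint.
  obtain ⟨Z, hZ, hbij⟩ := Set.exists_subset_bijOn (Set.range f)
    (fun u : G => (u : G ⧸ endStabilizer ρ a))
  have hZfin : Z.Finite := by
    refine hM Z (fun u hu => ?_) (fun u hu u' hu' hne hmem => ?_)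
    · obtain ⟨n, rfl⟩ := hZ hu
      constructor
      · rw [← (ρ (g M)).dist_eq x, ← map_mul_apply', hf]
        simp only [mul_inv_cancel_left]
        have e1 := dist_triangle_right (ρ (g M) x) (ρ (g (M + n)) x) (z 0)
        linarith [h0 M, h0 (M + n)]
      · rw [← (ρ (g M)).dist_eq (ρ (a ^ M) x), ← map_mul_apply', ← map_mul_apply',
          ← map_mul_apply', hf]
        simp only [mul_inv_cancel_left]
        have e1 := close2 M (M + n) M (hs M) ((Nat.le_add_right _ _).trans (hs _))
        linarith
    · exact hne (hbij.injOn hu hu' (QuotientGroup.eq.2 hmem))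
  have hfin : (Set.range fun n => (f n : G ⧸ endStabilizer ρ a)).Finite := by
    have := hZfin.image (fun u : G => (u : G ⧸ endStabilizer ρ a))
    rw [hbij.image_eq, ← Set.range_comp] at this
    exact this
  have := hfin.to_subtype
  obtain ⟨q, hq⟩ := Finite.exists_infinite_fiber
    (Set.rangeFactorization fun n => (f n : G ⧸ endStabilizer ρ a))
  have hinf : {n | (f n : G ⧸ endStabilizer ρ a) = q.1}.Infinite := by
    refine (Set.infinite_coe_iff.1 hq).mono fun n hn => ?_
    exact congrArg Subtype.val hn
  obtain ⟨n₁, hn₁⟩ := hinf.nonempty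
  refine ⟨M + n₁, asymptotic_of_base (z 0) fun T => ?_⟩
  -- Given `T`, another index `k` of the same coset is chosen, whose segment follows the ray beyond
  -- distance `T`. The required product is estimated through this translate and the end `y` of its
  -- segment.
  obtain ⟨I, hI⟩ := hRa.proper (max T 0 + 2 * δ + Ra + Rz + 4 * R)
  obtain ⟨n, hn, hnI⟩ := hinf.exists_gt I
  set k := M + n with hk
  have hasym : Asymptotic (fun i => ρ (g (M + n₁) * a ^ i) x) (fun i => ρ (g k * a ^ i) x) := by
    have hmem : (f n₁)⁻¹ * f n ∈ endStabilizer ρ a :=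
      QuotientGroup.eq.1 (Eq.trans hn₁ hn.symm)
    have := ((asymptotic_of_mem_endStabilizer ha.1 hmem x).map (ρ (g (M + n₁)))).symm
    simp only [← map_mul_apply'] at this
    convert this using 3 with i
    simp only [hf, hk]
    group
  obtain ⟨j, hj⟩ := h1 k
  obtain ⟨k₀, hk₀⟩ := hasym (z 0) (max T 0 + 2 * δ)
  have hδ0 := hδ.1
  have hsk : I ≤ s k := by have := hs k; omega
  have hlarge := hI 0 (s k) (by omega)
  refine ⟨max k₀ (max (s k) j), fun m hm n' hn' => ?_⟩
  simp only [ge_iff_le, max_le_iff] at hm hn'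
  set y := ρ (g k * a ^ s k) x
  have hg0 := h0 k
  rw [← ρ0 k] at hg0
  have c1 := hk₀ m hm.1 m hm.1
  have c2 : max T 0 + 2 * δ ≤ gromovProduct (z 0) (ρ (g k * a ^ m) x) y := by
    have e1 := gromovProduct_base_le (ρ (g k * a ^ 0) x) (z 0) (ρ (g k * a ^ m) x) y
    rw [gromovProduct_map_mul, gromovProduct_comm] at e1
    have e2 := hRa.le_gromovProduct hm.2.1
    linarith
  have c3 : max T 0 + 2 * δ ≤ gromovProduct (z 0) y (z n') := by
    have e1 := gromovProduct_left_le (z 0) (z j) y (z n')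
    have e2 := hz.le_gromovProduct hn'.2.2
    have e3 := dist_triangle4 (ρ (g k * a ^ 0) x) (z 0) (z j) y
    rw [dist_map_mul] at e3
    rw [dist_comm (z j) y] at e1 e3
    linarith
  have d1 := hδ.2 (z 0) (ρ (g k * a ^ m) x) y (z n')
  have d2 := hδ.2 (z 0) (ρ (g (M + n₁) * a ^ m) x) (ρ (g k * a ^ m) x) (z n')
  have d3 := le_min c2 c3
  have d4 := le_min ((show max T 0 + δ ≤ max T 0 + 2 * δ by linarith).trans c1)
    (show max T 0 + δ ≤ gromovProduct (z 0) (ρ (g k * a ^ m) x) (z n') by linarith)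
  linarith [le_max_left T 0]

/-- An element that moves the ends of a long segment of the axis of a WWPD element a bounded amount
fixes the attracting endpoint. -/
theorem IsWWPD.exists_asymptotic_of_small {a : G} (ha : IsWWPD ρ a) (x : X) (R : ℝ) :
    ∃ M : ℕ, ∀ s ≥ M, ∀ u h : G, dist (ρ (u * h) x) (ρ h x) ≤ R →
      dist (ρ (u * (h * a ^ s)) x) (ρ (h * a ^ s) x) ≤ R →
      Asymptotic (fun n => ρ u (ρ (h * a ^ n) x)) (fun n => ρ (h * a ^ n) x) := by
  obtain ⟨δ, hδ⟩ := exists_isHyp (X := X)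
  obtain ⟨Ra, hRa⟩ := exists_isGoodRay_pow hδ ha.1 x
  by_contra hcon
  push Not at hcon
  choose s hs u h h1 h2 h3 using hcon
  -- Conjugation by `h k` brings the segment back to the base point; the ray to be followed is the
  -- axis of `a` itself.
  obtain ⟨k, hk⟩ := ha.exists_asymptotic x hRa (fun k => (h k)⁻¹ * (u k * h k)) s hs (R := R)
    (fun k => by
      rw [← (ρ (h k)).dist_eq, ← map_mul_apply', mul_inv_cancel_left, pow_zero, ← map_mul_apply',
        mul_one]
      exact h1 k)
    (fun k => ⟨s k, by
      rw [← (ρ (h k)).dist_eq, ← map_mul_apply', ← map_mul_apply', mul_assoc, mul_inv_cancel_left,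
        mul_assoc]
      exact h2 k⟩)
  refine h3 k ?_
  have := hk.map (ρ (h k))
  simp only [← map_mul_apply'] at this ⊢
  convert this using 3 with n
  group

/-- If no translate of the axis of the WWPD element `a` is asymptotic to a ray, then translates of
long segments of the axis do not follow the ray. -/
theorem IsWWPD.exists_bound {a : G} (ha : IsWWPD ρ a) (x : X) {z : ℕ → X} {Rz : ℝ}
    (hz : IsGoodRay z Rz) (hne : ∀ g : G, ¬ Asymptotic (fun n => ρ (g * a ^ n) x) z) (R : ℝ) :
    ∃ M : ℕ, ∀ s ≥ M, ∀ (g : G) (j : ℕ), dist (ρ g x) (z 0) ≤ R →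
      ¬ dist (ρ (g * a ^ s) x) (z j) ≤ R := by
  by_contra hcon
  push Not at hcon
  choose s hs g j h1 h2 using hcon
  obtain ⟨k, hk⟩ := ha.exists_asymptotic x hz g s hs h1 fun k => ⟨j k, h2 k⟩
  exact hne _ hk

end WWPDElements

/-! ### Three words generating a free monoid in the commutator subgroup of the free group -/

section FreeWords

/-- Three reduced words of `[F₂, F₂]` with distinct first letters, whose positive products are
reduced as written. -/
def letterWord : Fin 3 → List (Fin 2 × Bool)
  | 0 => [(0, true), (1, false), (0, false), (1, true)]
  | 1 => [(0, false), (1, false), (0, true), (1, true)]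
  | 2 => [(1, true), (0, true), (1, false), (1, false), (0, false), (1, true)]

/-- The positive products of the three words `letterWord i`. -/
def wordHom : FreeMonoid (Fin 3) →* FreeGroup (Fin 2) :=
  FreeMonoid.lift fun i => FreeGroup.mk (letterWord i)

theorem wordHom_apply (w : FreeMonoid (Fin 3)) :
    wordHom w = FreeGroup.mk (w.toList.flatMap letterWord) := by
  induction w using FreeMonoid.recOn with
  | one => rfl
  | of_mul i w ih =>
    rw [map_mul, ih]
    simp [wordHom, FreeGroup.mul_mk]

/-- All three words end with the letter prefixed here, and none begins with its inverse, so this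
strengthened form passes through the induction. -/
theorem isReduced_cons_flatMap (L : List (Fin 3)) :
    FreeGroup.IsReduced (((1 : Fin 2), true) :: L.flatMap letterWord) := by
  induction L with
  | nil => simp
  | cons i L ih =>
    fin_cases i <;> simp [letterWord, FreeGroup.isReduced_cons_cons, ih]

theorem isReduced_flatMap (L : List (Fin 3)) : FreeGroup.IsReduced (L.flatMap letterWord) :=
  (isReduced_cons_flatMap L).infix ⟨[(1, true)], [], by simp⟩

theorem length_le_length_flatMap (L : List (Fin 3)) : L.length ≤ (L.flatMap letterWord).length := by
  induction L with
  | nil => simp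
  | cons i L ih =>
    rw [List.flatMap_cons, List.length_append, List.length_cons]
    have : 1 ≤ (letterWord i).length := by fin_cases i <;> simp [letterWord]
    omega

theorem length_le_norm_wordHom (w : FreeMonoid (Fin 3)) : w.length ≤ (wordHom w).norm := by
  rw [wordHom_apply, FreeGroup.norm, FreeGroup.toWord_mk, (isReduced_flatMap _).reduce_eq]
  exact length_le_length_flatMap _

theorem length_add_le_norm_wordHom {i j : Fin 3} (hij : i ≠ j) (w w' : FreeMonoid (Fin 3)) :
    (FreeMonoid.of i * w).length + (FreeMonoid.of j * w').length ≤
      ((wordHom (FreeMonoid.of i * w))⁻¹ * wordHom (FreeMonoid.of j * w')).norm := by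
  rw [wordHom_apply, wordHom_apply, FreeGroup.inv_mk, FreeGroup.mul_mk, FreeGroup.norm,
    FreeGroup.toWord_mk, FreeGroup.IsReduced.reduce_eq, List.length_append,
    FreeGroup.invRev_length]
  · exact Nat.add_le_add (length_le_length_flatMap _) (length_le_length_flatMap _)
  · unfold FreeGroup.IsReduced
    rw [List.isChain_append]
    refine ⟨?_, isReduced_flatMap _, ?_⟩
    · refine FreeGroup.IsReduced.of_reduce_eq ?_
      rw [FreeGroup.reduce_invRev, (isReduced_flatMap _).reduce_eq]
    · fin_cases i <;> fin_cases j <;> simp [letterWord, FreeGroup.invRev] at hij ⊢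

/-- Each generator has exponent sum zero in each of the three words. This removes the homomorphism
that a trivial class leaves undetermined. -/
theorem map_wordHom_eq_one {A : Type*} [CommGroup A] (φ : FreeGroup (Fin 2) →* A)
    (w : FreeMonoid (Fin 3)) : φ (wordHom w) = 1 := by
  suffices h : φ.comp wordHom = 1 from DFunLike.congr_fun h w
  refine FreeMonoid.hom_eq fun i => ?_
  have key : ∀ L : List (Fin 2 × Bool), φ (FreeGroup.mk L) =
      (L.map fun p => if p.2 then φ (FreeGroup.of p.1) else (φ (FreeGroup.of p.1))⁻¹).prod := by
    intro L
    induction L with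
    | nil => exact map_one φ
    | cons p L ih =>
      rw [List.map_cons, List.prod_cons, ← ih, ← List.singleton_append, ← FreeGroup.mul_mk, map_mul]
      rcases p with ⟨a, _ | _⟩
      · simp only [Bool.false_eq_true, if_false, ← map_inv]; rfl
      · rfl
  rw [MonoidHom.comp_apply, wordHom, FreeMonoid.lift_eval_of, key]
  fin_cases i <;> simp [letterWord]

theorem exists_norm_map_le {ι κ : Type*} [Finite ι] [DecidableEq ι] [DecidableEq κ]
    (φ : FreeGroup ι →* FreeGroup κ) :
    ∃ K : ℕ, ∀ g, (φ g).norm ≤ K * g.norm := by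
  have := Fintype.ofFinite ι
  refine ⟨∑ i, (φ (FreeGroup.of i)).norm, fun g => ?_⟩
  have key : ∀ L : List (ι × Bool), (φ (FreeGroup.mk L)).norm ≤
      (∑ i, (φ (FreeGroup.of i)).norm) * L.length := by
    intro L
    induction L with
    | nil => rw [← FreeGroup.one_eq_mk, map_one]; simp
    | cons p L ih =>
      rw [← List.singleton_append, ← FreeGroup.mul_mk, map_mul, List.length_append, mul_add]
      refine (FreeGroup.norm_mul_le _ _).trans (Nat.add_le_add ?_ ih)
      have h1 : (φ (FreeGroup.mk [p])).norm = (φ (FreeGroup.of p.1)).norm := by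
        rcases p with ⟨a, _ | _⟩
        · rw [← FreeGroup.norm_inv_eq, ← map_inv]; rfl
        · rfl
      rw [h1, List.length_singleton, mul_one]
      exact Finset.single_le_sum (f := fun i => (φ (FreeGroup.of i)).norm)
        (fun _ _ => Nat.zero_le _) (Finset.mem_univ _)
  have := key g.toWord
  rwa [FreeGroup.mk_toWord] at this

end FreeWords

/-! ### Quasi-geodesics labelled by positive words -/

section WordSystems

variable {X : Type v} [MetricSpace X] {G : Type u} [Group G] {ρ : G →* (X ≃ᵢ X)} {x : X}
  {σ : FreeMonoid (Fin 3) →* G} {δ : ℝ}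

/-- Positive words label quasi-geodesics in the orbit of `x`, through the consequences of
quasi-geodesicity in a hyperbolic space. -/
structure IsWordSystem (ρ : G →* (X ≃ᵢ X)) (x : X) (σ : FreeMonoid (Fin 3) →* G) (R : ℝ) :
    Prop where
  lower : ∀ w, (w.length : ℝ) ≤ R * dist x (ρ (σ w) x) + R
  upper : ∀ w, dist x (ρ (σ w) x) ≤ R * w.length
  between : ∀ w w', gromovProduct (ρ (σ w) x) x (ρ (σ (w * w')) x) ≤ R
  near : ∀ w m, ∃ w₁ w₂, w = w₁ * w₂ ∧
    dist m (ρ (σ w₁) x) ≤ gromovProduct m x (ρ (σ w) x) + R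

theorem dist_word_mul (w w' : FreeMonoid (Fin 3)) :
    dist (ρ (σ w) x) (ρ (σ (w * w')) x) = dist x (ρ (σ w') x) := by
  rw [map_mul, map_mul_apply', (ρ (σ w)).dist_eq]

theorem exists_letter_bound (ρ : G →* (X ≃ᵢ X)) (x : X) (σ : FreeMonoid (Fin 3) →* G) :
    ∃ B : ℝ, 0 ≤ B ∧ ∀ i, dist x (ρ (σ (FreeMonoid.of i)) x) ≤ B :=
  ⟨∑ i, dist x (ρ (σ (FreeMonoid.of i)) x), Finset.sum_nonneg fun _ _ => dist_nonneg, fun i =>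
    Finset.single_le_sum (f := fun i => dist x (ρ (σ (FreeMonoid.of i)) x))
      (fun _ _ => dist_nonneg) (Finset.mem_univ i)⟩

/-- The point of the orbit labelled by the prefix of length `t`. -/
def wordPoint (ρ : G →* (X ≃ᵢ X)) (x : X) (σ : FreeMonoid (Fin 3) →* G) (w : FreeMonoid (Fin 3))
    (t : ℕ) : X := ρ (σ (FreeMonoid.ofList (w.toList.take t))) x

theorem exists_prefix (w : FreeMonoid (Fin 3)) {s t : ℕ} (hst : s ≤ t) (ht : t ≤ w.length) :
    ∃ w', FreeMonoid.ofList (w.toList.take t) = FreeMonoid.ofList (w.toList.take s) * w' ∧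
      w'.length = t - s := by
  refine ⟨FreeMonoid.ofList ((w.toList.take t).drop s), ?_, ?_⟩
  · rw [← FreeMonoid.ofList_append]
    congr 1
    have := List.take_append_drop s (w.toList.take t)
    rw [List.take_take, min_eq_left hst] at this
    exact this.symm
  · change (List.drop s (List.take t w.toList)).length = t - s
    have h : min t w.toList.length = t := min_eq_left ht
    rw [List.length_drop, List.length_take, h]

theorem wordPoint_zero (w : FreeMonoid (Fin 3)) : wordPoint ρ x σ w 0 = x := by
  simp [wordPoint]

theorem wordPoint_length (w : FreeMonoid (Fin 3)) :
    wordPoint ρ x σ w w.length = ρ (σ w) x := by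
  have : w.toList.take w.length = w.toList := List.take_length
  rw [wordPoint, this, FreeMonoid.ofList_toList]

theorem wordPoint_mul (w w' : FreeMonoid (Fin 3)) :
    wordPoint ρ x σ (w * w') w.length = ρ (σ w) x := by
  have : (w * w').toList.take w.length = w.toList := List.take_left
  rw [wordPoint, this, FreeMonoid.ofList_toList]

theorem dist_wordPoint_succ_le {B : ℝ} (hB : ∀ i, dist x (ρ (σ (FreeMonoid.of i)) x) ≤ B)
    (w : FreeMonoid (Fin 3)) {t : ℕ} (ht : t < w.length) :
    dist (wordPoint ρ x σ w t) (wordPoint ρ x σ w (t + 1)) ≤ B := by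
  obtain ⟨w', h, h'⟩ := exists_prefix w (Nat.le_succ t) ht
  rw [wordPoint, wordPoint, h, dist_word_mul]
  obtain ⟨i, rfl⟩ := FreeMonoid.length_eq_one.1 (h'.trans (by omega))
  exact hB i

theorem sub_le_dist_wordPoint {K C : ℝ}
    (hlow : ∀ w, (w.length : ℝ) ≤ K * dist x (ρ (σ w) x) + C) (w : FreeMonoid (Fin 3)) {s t : ℕ}
    (hst : s ≤ t) (ht : t ≤ w.length) :
    (t : ℝ) - s ≤ K * dist (wordPoint ρ x σ w s) (wordPoint ρ x σ w t) + C := by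
  obtain ⟨w', h, h'⟩ := exists_prefix w hst ht
  have := hlow w'
  rw [h', Nat.cast_sub hst] at this
  rw [wordPoint, wordPoint, h, dist_word_mul]
  exact this

theorem isQGChain_wordPoint {B K C : ℝ} (hB0 : 0 ≤ B)
    (hB : ∀ i, dist x (ρ (σ (FreeMonoid.of i)) x) ≤ B)
    (hlow : ∀ w, (w.length : ℝ) ≤ K * dist x (ρ (σ w) x) + C) (w : FreeMonoid (Fin 3)) :
    IsQGChain (wordPoint ρ x σ w) (fun t => B * t) w.length B (B * K) (B * C) := by
  refine ⟨fun i hi => ?_, fun i hi => ?_, fun i j hij hj => ?_⟩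
  · have := dist_wordPoint_succ_le hB w hi
    push_cast; linarith
  · push_cast; linarith
  · have := mul_le_mul_of_nonneg_left (sub_le_dist_wordPoint hlow w hij hj) hB0
    linarith

theorem exists_isWordSystem (hδ : IsHyp X δ) {K C : ℝ} (hK : 0 ≤ K) (hC : 0 ≤ C)
    (hlow : ∀ w, (w.length : ℝ) ≤ K * dist x (ρ (σ w) x) + C) :
    ∃ R, 0 ≤ R ∧ IsWordSystem ρ x σ R := by
  obtain ⟨B, hB0, hB⟩ := exists_letter_bound ρ x σ
  obtain ⟨R₁, hR₁, h₁⟩ := IsQGChain.height hδ hB0 (mul_nonneg hB0 hK) (mul_nonneg hB0 hC)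
  obtain ⟨R₂, hR₂, h₂⟩ := IsQGChain.exists_near hδ hB0 (mul_nonneg hB0 hK) (mul_nonneg hB0 hC)
  have chain := isQGChain_wordPoint hB0 hB hlow
  refine ⟨B + K + C + R₁ + R₂, by linarith, fun w => ?_, fun w => ?_, fun w w' => ?_,
    fun w m => ?_⟩
  · have h0 : 0 ≤ dist x (ρ (σ w) x) := dist_nonneg
    have := mul_le_mul_of_nonneg_right (show K ≤ B + K + C + R₁ + R₂ by linarith) h0
    linarith [hlow w]
  · have h1 := (chain w).dist_le (Nat.zero_le _) le_rfl
    rw [wordPoint_zero, wordPoint_length] at h1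
    have h0 : (0 : ℝ) ≤ w.length := Nat.cast_nonneg _
    have := mul_le_mul_of_nonneg_right (show B ≤ B + K + C + R₁ + R₂ by linarith) h0
    simp only [Nat.cast_zero, mul_zero, sub_zero] at h1
    linarith
  · have h1 := h₁ _ _ _ (chain (w * w')) w.length (by rw [FreeMonoid.length_mul]; omega)
    rw [wordPoint_mul, wordPoint_zero, wordPoint_length] at h1
    linarith
  · obtain ⟨t, ht, h⟩ := h₂ _ _ _ (chain w) m
    rw [wordPoint_zero, wordPoint_length] at h
    refine ⟨FreeMonoid.ofList (w.toList.take t), FreeMonoid.ofList (w.toList.drop t), ?_, ?_⟩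
    · rw [← FreeMonoid.ofList_append, List.take_append_drop, FreeMonoid.ofList_toList]
    · refine h.trans ?_
      linarith

/-- Words with different first letters diverge immediately. -/
theorem exists_fork_bound (hδ : IsHyp X δ) {K C : ℝ} (hK : 0 ≤ K) (hC : 0 ≤ C)
    (hlow : ∀ w, (w.length : ℝ) ≤ K * dist x (ρ (σ w) x) + C)
    (hdiv : ∀ i j : Fin 3, i ≠ j → ∀ w w',
      (((FreeMonoid.of i * w).length + (FreeMonoid.of j * w').length : ℕ) : ℝ) ≤
        K * dist (ρ (σ (FreeMonoid.of i * w)) x) (ρ (σ (FreeMonoid.of j * w')) x) + C) :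
    ∃ R, 0 ≤ R ∧ ∀ i j : Fin 3, i ≠ j → ∀ w w',
      gromovProduct x (ρ (σ (FreeMonoid.of i * w)) x) (ρ (σ (FreeMonoid.of j * w')) x) ≤ R := by
  obtain ⟨B, hB0, hB⟩ := exists_letter_bound ρ x σ
  obtain ⟨R, hR, h⟩ := IsQGChain.height hδ hB0 (mul_nonneg hB0 hK) (mul_nonneg hB0 hC)
  refine ⟨R, hR, fun i j hij w w' => ?_⟩
  set p := FreeMonoid.of i * w with hp
  set q := FreeMonoid.of j * w' with hq
  have hcross : ∀ s t, s ≤ p.length → t ≤ q.length →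
      (s : ℝ) + t ≤ K * dist (wordPoint ρ x σ p s) (wordPoint ρ x σ q t) + C := by
    intro s t hs ht
    rcases s with _ | s
    · have := sub_le_dist_wordPoint hlow q (Nat.zero_le t) ht
      rw [wordPoint_zero] at this ⊢
      simpa using this
    rcases t with _ | t
    · have := sub_le_dist_wordPoint hlow p (Nat.zero_le (s + 1)) hs
      rw [wordPoint_zero, dist_comm] at this
      rw [wordPoint_zero (w := q)]
      simpa using this
    have := hdiv i j hij (FreeMonoid.ofList (w.toList.take s))
      (FreeMonoid.ofList (w'.toList.take t))
    have hs' : s ≤ w.length := by rw [hp, FreeMonoid.length_mul, FreeMonoid.length_of] at hs; omega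
    have ht' : t ≤ w'.length := by rw [hq, FreeMonoid.length_mul, FreeMonoid.length_of] at ht; omega
    have e1 : (FreeMonoid.ofList (w.toList.take s)).length = s := by
      change (List.take s w.toList).length = s
      rw [List.length_take]; exact min_eq_left hs'
    have e2 : (FreeMonoid.ofList (w'.toList.take t)).length = t := by
      change (List.take t w'.toList).length = t
      rw [List.length_take]; exact min_eq_left ht'
    rw [FreeMonoid.length_mul, FreeMonoid.length_mul, e1, e2, FreeMonoid.length_of,
      FreeMonoid.length_of] at this
    have e3 : (((1 + s + (1 + t) : ℕ)) : ℝ) = ((s + 1 : ℕ) : ℝ) + ((t + 1 : ℕ) : ℝ) := by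
      push_cast; ring
    rw [e3] at this
    exact this
  -- The path backwards along `p` to `x` and then forwards along `q` is a quasi-geodesic, because
  -- the two words do not cancel. It passes through `x` at index `p.length`, so `x` is close to the
  -- geodesic of its ends.
  set z : ℕ → X := fun t => if t ≤ p.length then wordPoint ρ x σ p (p.length - t) else
    wordPoint ρ x σ q (t - p.length) with hz
  have z1 : ∀ t, t ≤ p.length → z t = wordPoint ρ x σ p (p.length - t) := fun t ht => if_pos ht
  have z2 : ∀ t, p.length ≤ t → z t = wordPoint ρ x σ q (t - p.length) := fun t ht => by
    rcases ht.eq_or_lt with rfl | ht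
    · rw [z1 _ le_rfl, Nat.sub_self, wordPoint_zero, wordPoint_zero]
    · exact if_neg (by omega)
  have chain : IsQGChain z (fun t => B * t) (p.length + q.length) B (B * K) (B * C) := by
    refine ⟨fun t ht => ?_, fun t ht => ?_, fun s t hst ht => ?_⟩
    · push_cast
      suffices dist (z t) (z (t + 1)) ≤ B by linarith
      rcases lt_or_ge t p.length with h | h
      · rw [z1 t h.le, z1 (t + 1) h, dist_comm]
        have := dist_wordPoint_succ_le hB p (t := p.length - (t + 1)) (by omega)
        rwa [show p.length - (t + 1) + 1 = p.length - t by omega] at this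
      · rw [z2 t h, z2 (t + 1) (by omega)]
        have := dist_wordPoint_succ_le hB q (t := t - p.length) (by omega)
        rwa [show t - p.length + 1 = t + 1 - p.length by omega] at this
    · push_cast; linarith
    · suffices (t : ℝ) - s ≤ K * dist (z s) (z t) + C by
        have := mul_le_mul_of_nonneg_left this hB0
        linarith
      rcases le_total t p.length with h | h
      · rw [z1 t h, z1 s (hst.trans h), dist_comm]
        have := sub_le_dist_wordPoint hlow p (s := p.length - t) (t := p.length - s)
          (by omega) (by omega)
        rw [Nat.cast_sub (hst.trans h), Nat.cast_sub h] at this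
        linarith
      rcases le_total p.length s with h' | h'
      · rw [z2 t h, z2 s h']
        have := sub_le_dist_wordPoint hlow q (s := s - p.length) (t := t - p.length)
          (by omega) (by omega)
        rw [Nat.cast_sub h', Nat.cast_sub h] at this
        linarith
      · rw [z2 t h, z1 s h']
        have := hcross (p.length - s) (t - p.length) (by omega) (by omega)
        rw [Nat.cast_sub h', Nat.cast_sub h] at this
        linarith
  have := h _ _ _ chain p.length (by omega)
  rw [z2 _ le_rfl, z1 0 (Nat.zero_le _), z2 (p.length + q.length) (by omega), Nat.sub_self,
    wordPoint_zero, Nat.sub_zero, Nat.add_sub_cancel_left, wordPoint_length, wordPoint_length]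
    at this
  exact this

/-- Common first letters are stripped, each moving the base point by at most `B`. Since `e` occurs
in `p` but not in `q`, the words part, or `q` ends, before `p` is exhausted. -/
theorem gromovProduct_word_le {R B : ℝ} (hR : 0 ≤ R) (hB0 : 0 ≤ B)
    (hB : ∀ i, dist x (ρ (σ (FreeMonoid.of i)) x) ≤ B)
    (hfork : ∀ i j : Fin 3, i ≠ j → ∀ w w',
      gromovProduct x (ρ (σ (FreeMonoid.of i * w)) x) (ρ (σ (FreeMonoid.of j * w')) x) ≤ R)
    {e : Fin 3} (p p' : FreeMonoid (Fin 3)) (he : e ∈ p) : ∀ q : FreeMonoid (Fin 3), e ∉ q →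
      gromovProduct x (ρ (σ (p * p')) x) (ρ (σ q) x) ≤ R + B * p.length := by
  induction p using FreeMonoid.recOn with
  | one => exact absurd he FreeMonoid.notMem_one
  | of_mul i p ih =>
    intro q hq
    have hlen : (0 : ℝ) ≤ B * (FreeMonoid.of i * p).length := by positivity
    induction q using FreeMonoid.recOn with
    | one =>
      rw [map_one, map_one]
      change gromovProduct x _ x ≤ _
      rw [gromovProduct_comm, gromovProduct_self_left]
      linarith
    | of_mul j q _ =>
      rcases ne_or_eq i j with hij | rfl
      · rw [mul_assoc]
        exact (hfork i j hij _ _).trans (by linarith)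
      · rw [FreeMonoid.mem_mul, not_or] at hq
        have hep : e ∈ p := by
          rcases FreeMonoid.mem_mul.1 he with h | h
          · exact absurd h hq.1
          · exact h
        have h1 := ih hep q hq.2
        have h2 := gromovProduct_base_le x (ρ (σ (FreeMonoid.of i)) x)
          (ρ (σ (FreeMonoid.of i * p * p')) x) (ρ (σ (FreeMonoid.of i * q)) x)
        rw [mul_assoc, map_mul σ _ (p * p'), map_mul σ _ q, map_mul_apply' ρ _ (σ (p * p')),
          map_mul_apply' ρ _ (σ q), gromovProduct_map] at h2
        rw [mul_assoc, map_mul σ _ (p * p'), map_mul σ _ q, map_mul_apply' ρ _ (σ (p * p')),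
          map_mul_apply' ρ _ (σ q), FreeMonoid.length_mul, FreeMonoid.length_of]
        push_cast
        linarith [hB i]

/-- Distinct letters separate infinite words at infinity: the system `σ` separates the words `P n`,
which eventually contain `e` in a common prefix, from the words `Q n`, which avoid `e`. -/
def SeparatesWords (ρ : G →* (X ≃ᵢ X)) (x : X) (σ : FreeMonoid (Fin 3) →* G) : Prop :=
  ∀ (e : Fin 3) (w α β : FreeMonoid (Fin 3)), (e ∈ w ∨ e ∈ α) → e ∉ β →
    ¬ Asymptotic (fun n : ℕ => ρ (σ (w * α ^ n)) x) (fun n : ℕ => ρ (σ (β ^ n)) x)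

theorem FreeMonoid.notMem_pow {e : Fin 3} {β : FreeMonoid (Fin 3)} (he : e ∉ β) (n : ℕ) :
    e ∉ β ^ n := by
  induction n with
  | zero => exact FreeMonoid.notMem_one
  | succ n ih => rw [pow_succ, FreeMonoid.mem_mul]; tauto

theorem separatesWords_of_fork {R : ℝ} (hR : 0 ≤ R)
    (hfork : ∀ i j : Fin 3, i ≠ j → ∀ w w',
      gromovProduct x (ρ (σ (FreeMonoid.of i * w)) x) (ρ (σ (FreeMonoid.of j * w')) x) ≤ R) :
    SeparatesWords ρ x σ := by
  obtain ⟨B, hB0, hB⟩ := exists_letter_bound ρ x σ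
  intro e w α β he hβ has
  obtain ⟨k, hk⟩ := has x (R + B * (w * α).length + 1)
  have h1 := hk (k + 1) (by omega) k le_rfl
  have h2 := gromovProduct_word_le hR hB0 hB hfork (w * α) (α ^ k) (FreeMonoid.mem_mul.2 he)
    (β ^ k) (FreeMonoid.notMem_pow hβ k)
  rw [mul_assoc, ← pow_succ'] at h2
  linarith

end WordSystems

/-! ### Axes avoiding the repelling endpoints of other words -/

section Inequivalence

variable {X : Type v} [MetricSpace X] {G : Type u} [Group G] {ρ : G →* (X ≃ᵢ X)} {x : X} {δ : ℝ}

theorem IsLoxodromic.conj {h : X ≃ᵢ X} (hh : IsLoxodromic h) (g : X ≃ᵢ X) :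
    IsLoxodromic (g * h * g⁻¹) := by
  intro y
  obtain ⟨K, C, hK, hC, hq⟩ := hh (g⁻¹ y)
  refine ⟨K, C, hK, hC, fun i j => ?_⟩
  simpa only [conj_zpow, IsometryEquiv.mul_apply, g.dist_eq] using hq i j

theorem IsLoxodromic.map_conj {a : G} (ha : IsLoxodromic (ρ a)) (g : G) :
    IsLoxodromic (ρ (g * a * g⁻¹)) := by
  rw [map_mul, map_mul, map_inv]
  exact ha.conj _

variable {σ τ : FreeMonoid (Fin 3) →* G} {R R' : ℝ}

theorem IsWordSystem.nonneg (h : IsWordSystem ρ x σ R) : 0 ≤ R :=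
  (gromovProduct_nonneg _ _ _).trans (h.between 1 1)

theorem IsWordSystem.tendsto (h : IsWordSystem ρ x σ R) (T : ℝ) :
    ∃ k : ℕ, ∀ w : FreeMonoid (Fin 3), k ≤ w.length → T ≤ dist x (ρ (σ w) x) := by
  have hR := h.nonneg
  obtain ⟨k, hk⟩ := exists_nat_gt (R * T + R)
  refine ⟨k, fun w hw => ?_⟩
  by_contra hc
  have h1 := mul_le_mul_of_nonneg_left (not_le.1 hc).le hR
  have h2 := h.lower w
  have h3 : (k : ℝ) ≤ w.length := by exact_mod_cast hw
  linarith

theorem FreeMonoid.length_pow' (w : FreeMonoid (Fin 3)) (n : ℕ) :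
    (w ^ n).length = n * w.length := by
  induction n with
  | zero => simp
  | succ n ih => rw [pow_succ, FreeMonoid.length_mul, ih]; ring

theorem exists_isGoodRay_inv_pow (hδ : IsHyp X δ) {a : G} (ha : IsLoxodromic (ρ a)) (x : X) :
    ∃ R, IsGoodRay (fun n : ℕ => ρ ((a ^ n)⁻¹) x) R := by
  have : IsLoxodromic (ρ a⁻¹) := by rw [map_inv]; exact ha.inv
  simpa only [inv_pow] using exists_isGoodRay_pow hδ this x

variable [GromovHyperbolic X]

/-- If a ray moved a bounded amount by a loxodromic `v` is asymptotic to a path containing infinitely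
many translates of a long segment of the axis of the WWPD element `b`, then two of these translates
have the same attracting endpoint. -/
theorem IsWWPD.exists_asymptotic_translates (hδ : IsHyp X δ) {b : G} (hb : IsWWPD ρ b) (x : X)
    (Rz R D : ℝ) : ∃ M : ℕ, ∀ m ≥ M, ∀ (v : G) (z P : ℕ → X) (h : ℕ → G), IsLoxodromic (ρ v) →
      IsGoodRay z Rz → (∀ i, dist (ρ v (z i)) (z i) ≤ D) → Asymptotic P z →
      (∀ k, ∃ k₀, ∀ k' ≥ k₀, gromovProduct (ρ (h k) x) (P 0) (P k') ≤ R) →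
      (∀ k, ∃ k₀, ∀ k' ≥ k₀, gromovProduct (ρ (h k * b ^ m) x) (P 0) (P k') ≤ R) →
      (∀ T : ℝ, ∃ k₀, ∀ k ≥ k₀, T ≤ dist (z 0) (ρ (h k) x)) →
      ∃ k k', k < k' ∧
        Asymptotic (fun n => ρ (h k * b ^ n) x) (fun n => ρ (h k' * b ^ n) x) := by
  obtain ⟨M, hM⟩ := hb.exists_asymptotic_of_small x (2 * (R + 2 * δ + Rz) + D)
  obtain ⟨Rb, hRb⟩ := exists_isGoodRay_pow hδ hb.1 x
  refine ⟨M, fun m hm v z P h hv hz hD hP h1 h2 h3 => ?_⟩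
  have disp : ∀ y, dist (z 0) (P 0) + R + δ + 1 ≤ dist (z 0) y →
      (∃ k₀, ∀ k' ≥ k₀, gromovProduct y (P 0) (P k') ≤ R) →
      dist (ρ v y) y ≤ 2 * (R + 2 * δ + Rz) + D := by
    intro y hy hy'
    obtain ⟨i, hi⟩ := hz.exists_close hδ hP hy hy'
    have e := dist_triangle4 (ρ v y) (ρ v (z i)) (z i) y
    rw [(ρ v).dist_eq, dist_comm (z i) y] at e
    linarith [hD i]
  obtain ⟨k₀, hk₀⟩ := h3 (dist (z 0) (P 0) + R + δ + 1 + dist x (ρ (b ^ m) x))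
  have hfix : ∀ k ≥ k₀, Asymptotic (fun n => ρ v (ρ (h k * b ^ n) x))
      (fun n => ρ (h k * b ^ n) x) := by
    intro k hk
    have hd := hk₀ k hk
    have hd' : dist (z 0) (P 0) + R + δ + 1 ≤ dist (z 0) (ρ (h k * b ^ m) x) := by
      have e := dist_triangle_right (z 0) (ρ (h k) x) (ρ (h k * b ^ m) x)
      rw [map_mul_apply' ρ (h k) (b ^ m), (ρ (h k)).dist_eq] at e
      rw [map_mul_apply' ρ (h k) (b ^ m)]
      linarith
    refine hM m hm v (h k) ?_ ?_
    · rw [map_mul_apply']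
      refine disp _ ?_ (h1 k)
      linarith [dist_nonneg (x := x) (y := ρ (b ^ m) x)]
    · rw [map_mul_apply']
      exact disp _ hd' (h2 k)
  -- Far out, `v` moves both ends of each translate a bounded amount, so it fixes the attracting
  -- endpoints of three consecutive translates; a loxodromic element fixes at most two boundary
  -- points.
  obtain ⟨i, j, hij, has⟩ := exists_asymptotic_of_three_fixed hv
    (ξ := fun (i : Fin 3) n => ρ (h (k₀ + i) * b ^ n) x)
    (fun i => by
      have := (hRb.map (ρ (h (k₀ + i)))).asymptotic_self
      simpa only [← map_mul_apply'] using this)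
    (fun i => hfix (k₀ + i) (by omega))
  exact ⟨k₀ + i, k₀ + j, by omega, has⟩

/-- The positive words of `σ` act as quasi-geodesic WWPD elements. -/
structure IsWWPDSystem (ρ : G →* (X ≃ᵢ X)) (x : X) (σ : FreeMonoid (Fin 3) →* G) (R : ℝ) : Prop
    extends IsWordSystem ρ x σ R where
  wwpd : ∀ w, w ≠ 1 → IsWWPD ρ (σ w)

/-- The word `β ^ m * e`. -/
def powLetter (β : FreeMonoid (Fin 3)) (e : Fin 3) (m : ℕ) : FreeMonoid (Fin 3) :=
  β ^ m * FreeMonoid.of e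

theorem one_le_length_powLetter (β : FreeMonoid (Fin 3)) (e : Fin 3) (m : ℕ) :
    1 ≤ (powLetter β e m).length := by
  rw [powLetter, FreeMonoid.length_mul, FreeMonoid.length_of]; omega

theorem le_length_powLetter_pow (β : FreeMonoid (Fin 3)) (e : Fin 3) (m k : ℕ) :
    k ≤ (powLetter β e m ^ k).length := by
  rw [FreeMonoid.length_pow']
  exact Nat.le_mul_of_pos_right _ (one_le_length_powLetter β e m)

theorem mem_powLetter_pow (β : FreeMonoid (Fin 3)) (e : Fin 3) (m : ℕ) {k : ℕ} (hk : 0 < k) :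
    e ∈ powLetter β e m ^ k := by
  obtain ⟨k, rfl⟩ := Nat.exists_eq_add_of_lt hk
  rw [pow_succ]
  exact FreeMonoid.mem_mul.2 (.inr (FreeMonoid.mem_mul.2 (.inr FreeMonoid.mem_of_self)))

/-- For `m` large, no translate of the axis of `σ α` ends at the repelling endpoint of
`τ (β ^ m * e)`. -/
theorem not_asymptotic_inv_powLetter (hδ : IsHyp X δ) (hτ : IsWWPDSystem ρ x τ R)
    (hsep : SeparatesWords ρ x τ) {a : G} (ha : IsLoxodromic (ρ a)) {β : FreeMonoid (Fin 3)}
    {e : Fin 3} (hβ : β ≠ 1) (he : e ∉ β) : ∀ᶠ m in Filter.atTop, ∀ g : G,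
      ¬ Asymptotic (fun n => ρ (g * a ^ n) x)
        (fun n => ρ ((τ (powLetter β e m) ^ n)⁻¹) x) := by
  obtain ⟨Ra, hRa⟩ := exists_isGoodRay_pow hδ ha x
  obtain ⟨M, hM⟩ := (hτ.wwpd β hβ).exists_asymptotic_translates hδ x Ra R (dist (ρ a x) x)
  filter_upwards [Filter.eventually_ge_atTop M] with m hm g has
  set y := powLetter β e m with hy
  have hz : IsGoodRay (fun n => ρ (g * a ^ n) x) Ra := by
    have := hRa.map (ρ g)
    simpa only [← map_mul_apply'] using this
  have hbtw : ∀ k w w', w * w' = y → ∃ k₀, ∀ k' ≥ k₀, gromovProduct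
      (ρ ((τ y ^ (k + 1))⁻¹ * τ w) x) (ρ ((τ y ^ 0)⁻¹) x) (ρ ((τ y ^ k')⁻¹) x) ≤ R := by
    intro k w w' hww
    refine ⟨k + 1, fun k' hk' => ?_⟩
    have h1 := hτ.between (y ^ (k' - (k + 1)) * w) (w' * y ^ k)
    have e2 : y ^ (k' - (k + 1)) * w * (w' * y ^ k) = y ^ k' := by
      rw [mul_assoc, ← mul_assoc w, hww, ← pow_succ', ← pow_add]; congr 1; omega
    rw [e2, gromovProduct_comm, ← gromovProduct_map (ρ ((τ y ^ k')⁻¹))] at h1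
    have e3 : (τ y ^ k')⁻¹ * (τ y ^ (k' - (k + 1)) * τ w) = (τ y ^ (k + 1))⁻¹ * τ w := by
      have : τ y ^ k' = τ y ^ (k' - (k + 1)) * τ y ^ (k + 1) := by
        rw [← pow_add]; congr 1; omega
      rw [this]; group
    rw [map_mul τ, map_pow τ, map_pow τ, ← map_mul_apply', ← map_mul_apply', inv_mul_cancel,
      e3] at h1
    rwa [pow_zero, inv_one]
  -- The backward axis of `y = β ^ m * e` contains a translate of the segment of `β ^ m` in each
  -- period. The conjugate `g * a * g⁻¹` moves the points of its own ray a bounded amount.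
  obtain ⟨k, k', hkk, hasy⟩ := hM m hm (g * a * g⁻¹) _ (fun n => ρ ((τ y ^ n)⁻¹) x)
    (fun k => (τ y ^ (k + 1))⁻¹) (ha.map_conj g) hz
    (fun i => by
      rw [← map_mul_apply', show g * a * g⁻¹ * (g * a ^ i) = g * (a ^ i * a) by
        rw [← pow_succ, pow_succ']; group, dist_map_mul, map_mul_apply', (ρ _).dist_eq])
    has.symm
    (fun k => by simpa using hbtw k 1 y (one_mul _))
    (fun k => by simpa only [map_pow] using hbtw k (β ^ m) (FreeMonoid.of e) rfl)
    (fun T => by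
      obtain ⟨k₀, hk₀⟩ := hτ.tendsto (T + dist x (ρ g x))
      refine ⟨k₀, fun k hk => ?_⟩
      have h1 := hk₀ (y ^ (k + 1))
        ((hk.trans (Nat.le_succ k)).trans (le_length_powLetter_pow β e m (k + 1)))
      have h2 := dist_triangle x (ρ g x) (ρ ((τ y ^ (k + 1))⁻¹) x)
      have h3 : dist x (ρ ((τ y ^ (k + 1))⁻¹) x) = dist x (ρ (τ (y ^ (k + 1))) x) := by
        rw [← (ρ (τ (y ^ (k + 1)))).dist_eq, ← map_mul_apply', map_pow, mul_inv_cancel, map_one,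
          dist_comm]; rfl
      rw [pow_zero, mul_one]
      linarith)
  -- After translation, the infinite words `y ^ (k' - k) β β …` and `β β …` have the same endpoint,
  -- although only the first contains `e`.
  have := hasy.map (ρ (τ y ^ (k' + 1)))
  simp only [← map_mul_apply'] at this
  refine hsep e (y ^ (k' - k)) β β (.inl (mem_powLetter_pow β e m (by omega))) he ?_
  convert this using 3 with n n
  · rw [map_mul, map_pow, map_pow, ← mul_assoc, show k' + 1 = (k' - k) + (k + 1) by omega,
      pow_add (τ y)]
    group
  · rw [map_pow]; group

/-- For `m` large, no translate of the axis of `σ (β ^ m * e)` ends at the repelling endpoint of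
`a`. -/
theorem not_asymptotic_powLetter (hδ : IsHyp X δ) (hσ : IsWWPDSystem ρ x σ R)
    (hsep : SeparatesWords ρ x σ) {a : G} (ha : IsLoxodromic (ρ a)) {β : FreeMonoid (Fin 3)}
    {e : Fin 3} (hβ : β ≠ 1) (he : e ∉ β) : ∀ᶠ m in Filter.atTop, ∀ g : G,
      ¬ Asymptotic (fun n => ρ (g * σ (powLetter β e m) ^ n) x)
        (fun n => ρ ((a ^ n)⁻¹) x) := by
  obtain ⟨Ra, hRa⟩ := exists_isGoodRay_inv_pow hδ ha x
  obtain ⟨M, hM⟩ := (hσ.wwpd β hβ).exists_asymptotic_translates hδ x Ra R (dist (ρ a⁻¹ x) x)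
  filter_upwards [Filter.eventually_ge_atTop M] with m hm g has
  set y := powLetter β e m with hy
  have hbtw : ∀ k w w', w * w' = y → ∃ k₀, ∀ k' ≥ k₀, gromovProduct
      (ρ (g * σ y ^ k * σ w) x) (ρ (g * σ y ^ 0) x) (ρ (g * σ y ^ k') x) ≤ R := by
    intro k w w' hww
    refine ⟨k + 1, fun k' hk' => ?_⟩
    have h1 := hσ.between (y ^ k * w) (w' * y ^ (k' - (k + 1)))
    have e2 : y ^ k * w * (w' * y ^ (k' - (k + 1))) = y ^ k' := by
      rw [mul_assoc, ← mul_assoc w, hww, ← pow_succ', ← pow_add]; congr 1; omega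
    rw [e2, ← gromovProduct_map (ρ g)] at h1
    simp only [← map_mul_apply', map_mul σ, map_pow σ] at h1
    rw [mul_assoc, pow_zero, mul_one]
    exact h1
  obtain ⟨k, k', hkk, hasy⟩ := hM m hm a⁻¹ _ (fun n => ρ (g * σ y ^ n) x)
    (fun k => g * σ y ^ k) (by rw [map_inv]; exact ha.inv) hRa
    (fun i => by
      rw [← map_mul_apply', show a⁻¹ * (a ^ i)⁻¹ = (a ^ i)⁻¹ * a⁻¹ by
        rw [← mul_inv_rev, ← mul_inv_rev, ← pow_succ, ← pow_succ'], map_mul_apply',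
        (ρ _).dist_eq])
    has
    (fun k => by simpa using hbtw k 1 y (one_mul _))
    (fun k => by simpa only [map_pow] using hbtw k (β ^ m) (FreeMonoid.of e) rfl)
    (fun T => by
      obtain ⟨k₀, hk₀⟩ := hσ.tendsto (T + dist x (ρ g x))
      refine ⟨k₀, fun k hk => ?_⟩
      have h1 := hk₀ (y ^ k) (hk.trans (le_length_powLetter_pow β e m k))
      have h2 := dist_triangle_left (ρ g x) (ρ (g * σ y ^ k) x) x
      rw [map_mul_apply' ρ g (σ y ^ k), (ρ g).dist_eq, ← map_pow] at h2
      simp only [pow_zero, inv_one, map_one]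
      rw [map_mul_apply' ρ g (σ y ^ k), ← map_pow]
      change T ≤ dist x _
      linarith)
  have := (hasy.map (ρ ((g * σ y ^ k)⁻¹))).symm
  simp only [← map_mul_apply'] at this
  refine hsep e (y ^ (k' - k)) β β (.inl (mem_powLetter_pow β e m (by omega))) he ?_
  convert this using 3 with n n
  · rw [map_mul, map_pow, map_pow]
    nth_rw 2 [show k' = k + (k' - k) by omega]
    rw [pow_add (a := σ y)]
    group
  · rw [map_pow]; group

end Inequivalence

/-! ### Reversed matchings of block sequences -/

section Combinatorics

/-- Two cyclic sequences of blocks `0, 1, 2` of length `n` cannot be matched with the orientation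
reversed, if long pieces of the blocks `0` and `1` of the first match no other block of the
second. -/
theorem no_reversed_blocks {A : ℕ} (hA : 1 ≤ A) (L₁ : ℕ) : ∃ M : ℕ, ∀ n ≥ M, ∀ f : ℕ → ℤ,
    (∀ i, 0 ≤ f i) →
    (∀ i < 3 * n, |f (i + 1) - f i| ≤ A) →
    (∀ i i', i ≤ i' → i' ≤ 3 * n → (i' : ℤ) - i ≤ A * |f i' - f i| + A) →
    f (3 * n) < f 0 →
    (∀ X Y : ℕ, X < 2 → Y < 3 → X ≠ Y → ∀ q i i' : ℕ, X * n ≤ i → i ≤ i' → i' ≤ (X + 1) * n →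
      (3 * n * q + Y * n : ℤ) ≤ f i' → f i' ≤ f i → f i ≤ 3 * n * q + (Y + 1) * n →
      i' < i + L₁) → False := by
  -- Indices at least `L₀` apart have values more than `A` apart, so a step cannot cross over and
  -- `f` decreases at scale `L₀`. An interval of length `L₂`, trimmed by `2 * A` at each end, still
  -- has length `A * (L₀ + L₁)`, which forces its preimages `L₀ + L₁` apart.
  set L₀ : ℕ := A * A + A + 1 with hL₀
  set L₂ : ℕ := 4 * A + A * (L₀ + L₁) with hL₂
  refine ⟨L₀ + 2 * (A * L₂) + A + 2 * L₂ + 1, fun n hn f hf0 hlip hqi hrev hex => ?_⟩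
  have hfar : ∀ i i', i + L₀ ≤ i' → i' ≤ 3 * n → (A : ℤ) < |f i' - f i| := by
    intro i i' h1 h2
    have h3 := hqi i i' (by omega) h2
    by_contra hc
    have h4 : (A : ℤ) * |f i' - f i| ≤ A * A :=
      mul_le_mul_of_nonneg_left (not_lt.1 hc) (Int.natCast_nonneg A)
    have h5 : ((i : ℤ) + (A * A + A + 1)) ≤ i' := by exact_mod_cast h1
    linarith
  have hmono0 : ∀ j, L₀ + j ≤ 3 * n → f (3 * n - j) < f 0 := by
    intro j
    induction j with
    | zero => intro _; simpa using hrev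
    | succ j ih =>
      intro hj
      have h1 := ih (by omega)
      have h2 := hfar 0 (3 * n - j) (by omega) (by omega)
      have h3 := hlip (3 * n - (j + 1)) (by omega)
      rw [show 3 * n - (j + 1) + 1 = 3 * n - j by omega] at h3
      rw [abs_of_neg (by linarith)] at h2
      have h4 := (abs_le.1 h3).1
      linarith
  have hmono : ∀ i' ≤ 3 * n, ∀ i, i + L₀ ≤ i' → f i' < f i := by
    intro i' hi' i
    induction i with
    | zero =>
      intro h
      have := hmono0 (3 * n - i') (by omega)
      rwa [show 3 * n - (3 * n - i') = i' by omega] at this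
    | succ i ih =>
      intro h
      have h1 := ih (by omega)
      have h2 := hfar i i' (by omega) hi'
      have h3 := hlip i (by omega)
      rw [abs_of_neg (by linarith)] at h2
      have h4 := (abs_le.1 h3).1
      linarith
  have hlip' : ∀ i i', i ≤ i' → i' ≤ 3 * n → |f i' - f i| ≤ A * ((i' : ℤ) - i) := by
    intro i i' h
    induction i', h using Nat.le_induction with
    | base => intro _; simp
    | succ i' h ih =>
      intro h2
      have h3 := ih (by omega)
      have h4 := hlip i' (by omega)
      have h5 := abs_sub_le (f (i' + 1)) (f i') (f i)
      push_cast
      linarith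
  have hA0 : (0 : ℤ) < A := by exact_mod_cast hA
  -- If the values on block `X` sweep an interval of length `L₂` inside a block `Y ≠ X`, the
  -- intermediate value property gives a long piece of `X` matched backwards into `Y`, which is
  -- excluded.
  have claim : ∀ X Y : ℕ, X < 2 → Y < 3 → X ≠ Y → ∀ (q : ℕ) (t₁ t₂ : ℤ), t₁ + L₂ ≤ t₂ →
      (3 * n * q + Y * n : ℤ) ≤ t₁ → t₂ ≤ 3 * n * q + (Y + 1) * n →
      f ((X + 1) * n) ≤ t₁ → t₂ ≤ f (X * n) → False := by
    intro X Y hX hY hXY q t₁ t₂ ht hq1 hq2 hf1 hf2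
    have hXn : (X + 1) * n = X * n + n := by ring
    have hX3 : (X + 1) * n ≤ 3 * n := Nat.mul_le_mul_right _ (by omega)
    have hL₂' : (L₂ : ℤ) = 4 * A + A * (L₀ + L₁) := by rw [hL₂]; push_cast; ring
    have hpos : (0 : ℤ) ≤ A * (L₀ + L₁) := by positivity
    have ivt : ∀ v : ℤ, t₁ ≤ v → v ≤ t₂ →
        ∃ i, X * n ≤ i ∧ i ≤ (X + 1) * n ∧ |f i - v| ≤ A := by
      intro v h1 h2
      obtain ⟨i, hi, h⟩ := exists_near_of_steps (p := fun i => (f ((X + 1) * n - i) : ℝ)) (n := n)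
        (S := A) (v := v) (Nat.cast_nonneg _) (fun i hi => by
          have := hlip ((X + 1) * n - (i + 1)) (by omega)
          rw [show (X + 1) * n - (i + 1) + 1 = (X + 1) * n - i by omega, abs_sub_comm] at this
          exact_mod_cast this)
        (by
          rw [Nat.sub_zero]; exact_mod_cast hf1.trans h1)
        (by
          rw [show (X + 1) * n - n = X * n by omega]; exact_mod_cast h2.trans hf2)
      exact ⟨(X + 1) * n - i, by omega, by omega, by exact_mod_cast h⟩
    obtain ⟨i₁, a1, b1, c1⟩ := ivt (t₁ + A) (by linarith) (by linarith)
    obtain ⟨i₂, a2, b2, c2⟩ := ivt (t₂ - A) (by linarith) (by linarith)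
    rw [abs_le] at c1 c2
    have hgap : (A : ℤ) * (L₀ + L₁) ≤ f i₂ - f i₁ := by linarith
    have hdiff : ∀ i i' : ℕ, i ≤ i' → i' ≤ 3 * n → (A : ℤ) * (L₀ + L₁) ≤ |f i' - f i| →
        i + (L₀ + L₁) ≤ i' := by
      intro i i' h1 h2 h3
      have h4 := h3.trans (hlip' i i' h1 h2)
      have h5 := le_of_mul_le_mul_left h4 hA0
      omega
    rcases le_total i₁ i₂ with h | h
    · have h1 := hdiff i₁ i₂ h (by omega) (hgap.trans (le_abs_self _))
      have h2 := hmono i₂ (by omega) i₁ (by omega)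
      linarith
    · have h1 := hdiff i₂ i₁ h (by omega) (by rw [abs_sub_comm]; exact hgap.trans (le_abs_self _))
      have h2 := hex X Y hX hY hXY q i₂ i₁ a2 h b1 (by linarith) (by linarith) (by linarith)
      omega
  have hΛ : ∀ X : ℕ, X < 2 → f ((X + 1) * n) + 2 * L₂ ≤ f (X * n) := by
    intro X hX
    have hXn : (X + 1) * n = X * n + n := by ring
    have hX3 : (X + 1) * n ≤ 3 * n := Nat.mul_le_mul_right _ (by omega)
    have h1 := hmono _ hX3 (X * n) (by omega)
    have h2 := hqi (X * n) ((X + 1) * n) (by omega) hX3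
    rw [abs_of_neg (by linarith)] at h2
    have h3 : ((((X + 1) * n : ℕ) : ℤ) - ((X * n : ℕ) : ℤ)) = n := by push_cast; ring
    rw [h3] at h2
    have h4 : ((L₀ + 2 * (A * L₂) + A + 2 * L₂ + 1 : ℕ) : ℤ) ≤ n := by exact_mod_cast hn
    push_cast at h4
    have h5 : (A : ℤ) * (2 * L₂) ≤ A * -(f ((X + 1) * n) - f (X * n)) := by
      have : (0 : ℤ) ≤ A * A := by positivity
      linarith [Int.natCast_nonneg L₀, Int.natCast_nonneg L₂]
    have h6 := le_of_mul_le_mul_left h5 hA0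
    linarith
  have h0 := hΛ 0 (by norm_num)
  have h1 := hΛ 1 (by norm_num)
  simp only [zero_add, one_mul, zero_mul, one_add_one_eq_two] at h0 h1
  have hn' : ((L₀ + 2 * (A * L₂) + A + 2 * L₂ + 1 : ℕ) : ℤ) ≤ n := by exact_mod_cast hn
  have hnL : (2 * L₂ : ℤ) < n := by
    have : (0 : ℤ) ≤ A * L₂ := by positivity
    push_cast at hn'
    linarith [Int.natCast_nonneg L₀]
  have hL₂0 : (0 : ℤ) ≤ L₂ := Int.natCast_nonneg _
  have hn0 : (0 : ℤ) < 3 * n := by linarith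
  -- The junction `n` of the blocks `0` and `1` decides. By `hΛ`, block `1` sweeps the values just
  -- below `e` and block `0` those just above, so whatever block contains `e`, one of the two sides
  -- lies in a block of a different letter.
  set e := f n with he
  obtain ⟨q, hq⟩ := Int.eq_ofNat_of_zero_le (Int.ediv_nonneg (hf0 n) hn0.le)
  have hdm := Int.emod_add_mul_ediv (f n) (3 * n)
  have hr0 := Int.emod_nonneg (f n) hn0.ne'
  have hr1 := Int.emod_lt_of_pos (f n) hn0
  set r := f n % (3 * n)
  rw [hq] at hdm
  have c10 := claim 1 0 (by norm_num) (by norm_num) (by norm_num)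
  have c12 := claim 1 2 (by norm_num) (by norm_num) (by norm_num)
  have c01 := claim 0 1 (by norm_num) (by norm_num) (by norm_num)
  have c02 := claim 0 2 (by norm_num) (by norm_num) (by norm_num)
  simp only [zero_add, one_mul, zero_mul, one_add_one_eq_two, Nat.cast_zero, Nat.cast_one,
    Nat.cast_ofNat] at c10 c12 c01 c02
  rcases lt_or_ge r n with hA | hA
  · rcases le_or_gt (L₂ : ℤ) r with h | h
    · exact c10 q (e - L₂) e (by linarith) (by linarith) (by linarith) (by linarith) le_rfl
    -- Here `e` is near the start of a block `0`, and below it lies the block `2` of the previous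
    -- period. In the first period there is none, but then `f (2 * n)` would be negative.
    · rcases q with _ | q
      · have := hf0 (2 * n)
        simp only [Nat.cast_zero, mul_zero, add_zero] at hdm
        linarith
      · push_cast at hdm
        exact c12 q (e - r - L₂) (e - r) (by linarith) (by linarith) (by linarith) (by linarith)
          (by linarith)
  rcases lt_or_ge r (2 * n) with hB | hB
  · rcases le_or_gt (r + L₂) (2 * n) with h | h
    · exact c01 q e (e + L₂) le_rfl (by linarith) (by linarith) le_rfl (by linarith)
    · exact c02 q (3 * n * q + 2 * n) (3 * n * q + 2 * n + L₂) le_rfl le_rfl (by linarith)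
        (by linarith) (by linarith)
  · rcases le_or_gt ((2 : ℤ) * n + L₂) r with h | h
    · exact c12 q (e - L₂) e (by linarith) (by linarith) (by linarith) (by linarith) le_rfl
    · exact c02 q e (e + L₂) le_rfl (by linarith) (by linarith) le_rfl (by linarith)

end Combinatorics

/-! ### Prefixes of powers of the block word -/

section BlockWords

/-- The part of the word `0ⁿ 1ⁿ 2ⁿ` before the block of the letter `Y`. -/
def blockPrefix (n : ℕ) : Fin 3 → FreeMonoid (Fin 3)
  | 0 => 1
  | 1 => FreeMonoid.of 0 ^ n
  | 2 => FreeMonoid.of 0 ^ n * FreeMonoid.of 1 ^ n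

/-- The word `0ⁿ 1ⁿ 2ⁿ`. -/
def blockWord (n : ℕ) : FreeMonoid (Fin 3) :=
  FreeMonoid.of 0 ^ n * FreeMonoid.of 1 ^ n * FreeMonoid.of 2 ^ n

theorem length_of_pow (i : Fin 3) (n : ℕ) : (FreeMonoid.of i ^ n).length = n := by
  rw [FreeMonoid.length_pow', FreeMonoid.length_of, mul_one]

theorem length_blockPrefix (n : ℕ) (Y : Fin 3) : (blockPrefix n Y).length = Y * n := by
  fin_cases Y <;> simp [blockPrefix, FreeMonoid.length_mul, length_of_pow, two_mul]

theorem length_blockWord (n : ℕ) : (blockWord n).length = 3 * n := by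
  simp only [blockWord, FreeMonoid.length_mul, length_of_pow]; ring

theorem exists_blockWord_eq (n : ℕ) (Y : Fin 3) :
    ∃ w, blockWord n = blockPrefix n Y * FreeMonoid.of Y ^ n * w := by
  fin_cases Y
  · exact ⟨FreeMonoid.of 1 ^ n * FreeMonoid.of 2 ^ n, by simp [blockPrefix, blockWord, mul_assoc]⟩
  · exact ⟨FreeMonoid.of 2 ^ n, rfl⟩
  · exact ⟨1, by simp [blockPrefix, blockWord]⟩

theorem take_of_eq_mul {w u v : FreeMonoid (Fin 3)} (h : w = u * v) {t : ℕ} (ht : t = u.length) :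
    FreeMonoid.ofList (w.toList.take t) = u := by
  subst h ht
  exact congrArg FreeMonoid.ofList List.take_left

theorem take_blockWord_pow {n : ℕ} (hn : 0 < n) (k q : ℕ) (Y : Fin 3) {s : ℕ} (hs : s ≤ n)
    (hle : 3 * n * q + Y * n + s ≤ 3 * n * k) :
    FreeMonoid.ofList ((blockWord n ^ k).toList.take (3 * n * q + Y * n + s)) =
      blockWord n ^ q * blockPrefix n Y * FreeMonoid.of Y ^ s := by
  have hlen : 3 * n * q + Y * n + s =
      (blockWord n ^ q * blockPrefix n Y * FreeMonoid.of Y ^ s).length := by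
    rw [FreeMonoid.length_mul, FreeMonoid.length_mul, length_of_pow, length_blockPrefix,
      FreeMonoid.length_pow', length_blockWord]
    ring
  rcases lt_or_ge q k with hq | hq
  · obtain ⟨w, hw⟩ := exists_blockWord_eq n Y
    refine take_of_eq_mul (v := FreeMonoid.of Y ^ (n - s) * w * blockWord n ^ (k - q - 1)) ?_ hlen
    calc blockWord n ^ k = blockWord n ^ q * blockWord n * blockWord n ^ (k - q - 1) := by
          rw [← pow_succ, ← pow_add]; congr 1; omega
      _ = blockWord n ^ q * (blockPrefix n Y * (FreeMonoid.of Y ^ s * FreeMonoid.of Y ^ (n - s)) * w)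
          * blockWord n ^ (k - q - 1) := by
          rw [← pow_add, Nat.add_sub_cancel' hs, ← hw]
      _ = _ := by simp only [mul_assoc]
  -- The whole word `blockWord n ^ k` counts as the empty prefix of a further period.
  · have h1 : 3 * n * k ≤ 3 * n * q := Nat.mul_le_mul_left _ hq
    have hs0 : s = 0 := by omega
    have hY0 : (Y : ℕ) * n = 0 := by omega
    have hY : Y = 0 := by
      rcases Nat.mul_eq_zero.1 hY0 with h | h
      · exact Fin.ext h
      · omega
    have hqk : q = k := by
      have : 3 * n * q = 3 * n * k := by omega
      exact Nat.eq_of_mul_eq_mul_left (by omega) this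
    subst hs0 hY hqk
    exact take_of_eq_mul (v := 1) (by simp [blockPrefix]) hlen

end BlockWords

/-! ### Long block words do not lie near a given axis -/

section Occurrences

variable {X : Type v} [MetricSpace X] {G : Type u} [Group G] {ρ : G →* (X ≃ᵢ X)} {x : X} {δ : ℝ}
  {σ τ : FreeMonoid (Fin 3) →* G} {R R' : ℝ}

/-- Neighbourhoods of geodesics are coarsely convex. This passes from the ends of a translated
segment to all its points. -/
theorem IsHyp.gromovProduct_le_of_between (hδ : IsHyp X δ) {x y p q m : X} {S S' : ℝ}
    (hp : gromovProduct p x y ≤ S) (hq : gromovProduct q x y ≤ S) (hm : gromovProduct m p q ≤ S') :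
    gromovProduct m x y ≤ S + 2 * S' + 2 * δ := by
  have h1 := hδ.four_point m x p q
  have h2 := hδ.four_point m y p q
  have a1 := dist_triangle m p q
  have a2 := dist_triangle_left p q m
  have a3 := dist_triangle x p q
  have a4 := dist_triangle x q p
  have a5 := dist_triangle y p q
  have a6 := dist_triangle y q p
  simp only [gromovProduct, dist_comm p x, dist_comm p y, dist_comm q x, dist_comm q y,
    dist_comm q p] at *
  have b1 := dist_triangle m q p
  have b2 := dist_triangle m p q
  rw [dist_comm q p] at b1
  rcases max_cases (dist m p + dist x q) (dist m q + dist x p) with ⟨e, _⟩ | ⟨e, _⟩ <;>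
  rcases max_cases (dist m p + dist y q) (dist m q + dist y p) with ⟨e', _⟩ | ⟨e', _⟩ <;>
    rw [e] at h1 <;> rw [e'] at h2 <;> linarith

theorem IsWordSystem.dist_wordPoint_le (h : IsWordSystem ρ x σ R) (w : FreeMonoid (Fin 3)) {s t : ℕ}
    (hs : s ≤ w.length) (ht : t ≤ w.length) :
    dist (wordPoint ρ x σ w s) (wordPoint ρ x σ w t) ≤ R * |(t : ℝ) - s| := by
  wlog hst : s ≤ t generalizing s t
  · rw [dist_comm, abs_sub_comm]
    exact this ht hs (le_of_not_ge hst)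
  obtain ⟨w', e, e'⟩ := exists_prefix w hst ht
  have := h.upper w'
  rw [e', Nat.cast_sub hst] at this
  rwa [wordPoint, wordPoint, e, dist_word_mul, abs_of_nonneg (sub_nonneg.2 (Nat.cast_le.2 hst))]

theorem IsWordSystem.abs_sub_le (h : IsWordSystem ρ x σ R) (w : FreeMonoid (Fin 3)) {s t : ℕ}
    (hs : s ≤ w.length) (ht : t ≤ w.length) :
    |(t : ℝ) - s| ≤ R * dist (wordPoint ρ x σ w s) (wordPoint ρ x σ w t) + R := by
  wlog hst : s ≤ t generalizing s t
  · rw [dist_comm, abs_sub_comm]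
    exact this ht hs (le_of_not_ge hst)
  rw [abs_of_nonneg (sub_nonneg.2 (Nat.cast_le.2 hst))]
  exact sub_le_dist_wordPoint h.lower w hst ht

theorem IsWordSystem.gromovProduct_wordPoint_le (h : IsWordSystem ρ x σ R)
    (w : FreeMonoid (Fin 3)) {r s t : ℕ} (hrs : r ≤ s) (hst : s ≤ t) (ht : t ≤ w.length) :
    gromovProduct (wordPoint ρ x σ w s) (wordPoint ρ x σ w r) (wordPoint ρ x σ w t) ≤ R := by
  obtain ⟨w₁, e₁, -⟩ := exists_prefix w hrs (hst.trans ht)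
  obtain ⟨w₂, e₂, -⟩ := exists_prefix w hst ht
  have := h.between w₁ w₂
  rw [wordPoint, wordPoint, wordPoint, e₂, e₁, mul_assoc, map_mul σ _ w₁, map_mul σ _ (w₁ * w₂),
    map_mul_apply', map_mul_apply', gromovProduct_map]
  exact this

theorem IsWordSystem.exists_near_wordPoint (h : IsWordSystem ρ x σ R) (w : FreeMonoid (Fin 3))
    (m : X) : ∃ t ≤ w.length,
      dist m (wordPoint ρ x σ w t) ≤ gromovProduct m x (ρ (σ w) x) + R := by
  obtain ⟨w₁, w₂, rfl, hm⟩ := h.near w m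
  exact ⟨w₁.length, by rw [FreeMonoid.length_mul]; omega, by rwa [wordPoint_mul]⟩

theorem exists_eq_pow_mul_of_prefix {f : FreeMonoid (Fin 3)} (k : ℕ) : ∀ {u v : FreeMonoid (Fin 3)},
    f ^ k = u * v → ∃ (s : ℕ) (u' : FreeMonoid (Fin 3)), u = f ^ s * u' ∧ u'.length ≤ f.length := by
  induction k with
  | zero =>
    intro u v h
    have : u.length = 0 := by
      have := congrArg FreeMonoid.length h
      rw [FreeMonoid.length_mul, pow_zero, FreeMonoid.length_one] at this
      omega
    exact ⟨0, u, by simp, by omega⟩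
  | succ k ih =>
    intro u v h
    rw [pow_succ'] at h
    rcases List.append_eq_append_iff.1 h with ⟨a, ha, ha'⟩ | ⟨a, ha, ha'⟩
    · obtain ⟨s, u', hu, hu'⟩ := ih (u := a) (v := v) ha'
      refine ⟨s + 1, u', ?_, hu'⟩
      rw [pow_succ', mul_assoc, ← hu]
      exact ha
    · refine ⟨0, u, by simp, ?_⟩
      have : f = u * (show FreeMonoid (Fin 3) from a) := ha
      rw [this, FreeMonoid.length_mul]; omega

/-- If translates of the segment of `0ⁿ 1ⁿ 2ⁿ` lie near the axis of `τ f`, then all its points are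
moved a bounded amount by `τ f`. -/
theorem IsWordSystem.dist_translate_prefix_le (hδ : IsHyp X δ) (hσ : IsWordSystem ρ x σ R)
    (hτ : IsWordSystem ρ x τ R') {f : FreeMonoid (Fin 3)} {S : ℝ} {k : ℕ} {g : G}
    {w w' : FreeMonoid (Fin 3)} (hp : gromovProduct (ρ g x) x (ρ (τ f ^ k) x) ≤ S)
    (hq : gromovProduct (ρ (g * σ (w * w')) x) x (ρ (τ f ^ k) x) ≤ S) :
    dist (ρ (τ f * (g * σ w)) x) (ρ (g * σ w) x) ≤
      2 * (S + 2 * R + 2 * δ + R' + R' * f.length) + dist (ρ (τ f) x) x := by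
  have h1 : gromovProduct (ρ (g * σ w) x) (ρ g x) (ρ (g * σ (w * w')) x) ≤ R := by
    have := hσ.between w w'
    rw [← gromovProduct_map (ρ g)] at this
    simpa only [map_mul_apply'] using this
  have h2 := hδ.gromovProduct_le_of_between hp hq h1
  rw [← map_pow] at h2
  obtain ⟨u, u', hu, hnear⟩ := hτ.near (f ^ k) (ρ (g * σ w) x)
  -- The nearby prefix of `f ^ k` is a power of `f` up to a word of length at most that of `f`, so
  -- the point is near `(τ f) ^ s x`, which `τ f` moves as far as `x`.
  obtain ⟨s, u₂, rfl, hlen⟩ := exists_eq_pow_mul_of_prefix k hu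
  refine dist_translate_le ρ (k := τ f ^ s) ((Commute.refl _).pow_right s) (p := x) ?_
  have h3 := dist_word_mul (ρ := ρ) (x := x) (σ := τ) (f ^ s) u₂
  have h4 := hτ.upper u₂
  have h5 := mul_le_mul_of_nonneg_left (Nat.cast_le (α := ℝ).2 hlen) hτ.nonneg
  have h6 := dist_triangle_right (ρ (g * σ w) x) (ρ (τ (f ^ s)) x) (ρ (τ (f ^ s * u₂)) x)
  rw [← map_pow]
  linarith

variable [GromovHyperbolic X]

/-- The infinite words obtained by following `0ⁿ 1ⁿ 2ⁿ` and then one of its letters forever have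
different endpoints. -/
def SeparatesBlocks (ρ : G →* (X ≃ᵢ X)) (x : X) (σ : FreeMonoid (Fin 3) →* G) : Prop :=
  ∀ i j : Fin 3, i < j → ∀ n : ℕ,
    ¬ Asymptotic (fun m => ρ (σ (blockPrefix n i) * σ (FreeMonoid.of i) ^ m) x)
      (fun m => ρ (σ (blockPrefix n j) * σ (FreeMonoid.of j) ^ m) x)

/-- If `v` moved every point of a translated `0ⁿ 1ⁿ 2ⁿ` by at most `D`, it would fix the attracting
endpoint of each of the three long blocks. These endpoints are distinct by `hsep`, and `v` fixes at
most two: this is why three letters are used. -/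
theorem IsWWPDSystem.eventually_displaced (hσ : IsWWPDSystem ρ x σ R)
    (hsep : SeparatesBlocks ρ x σ) {v : G} (hv : IsLoxodromic (ρ v)) (D : ℝ) :
    ∀ᶠ n in Filter.atTop, ∀ g : G, ¬ ∀ w w', blockWord n = w * w' →
      dist (ρ (v * (g * σ w)) x) (ρ (g * σ w) x) ≤ D := by
  obtain ⟨δ, hδ⟩ := exists_isHyp (X := X)
  choose M hM using fun i : Fin 3 =>
    (hσ.wwpd (FreeMonoid.of i) (FreeMonoid.of_ne_one i)).exists_asymptotic_of_small x D
  filter_upwards [Filter.eventually_all.2 fun i : Fin 3 => Filter.eventually_ge_atTop (M i)]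
    with n hn g hall
  obtain ⟨i, j, hij, has⟩ := exists_asymptotic_of_three_fixed hv
    (ξ := fun i m => ρ (g * σ (blockPrefix n i) * σ (FreeMonoid.of i) ^ m) x)
    (fun i => by
      obtain ⟨Ri, hRi⟩ := exists_isGoodRay_pow hδ
        (hσ.wwpd (FreeMonoid.of i) (FreeMonoid.of_ne_one i)).1 x
      have := (hRi.map (ρ (g * σ (blockPrefix n i)))).asymptotic_self
      simpa only [← map_mul_apply'] using this)
    (fun i => by
      obtain ⟨w, hw⟩ := exists_blockWord_eq n i
      refine hM i n (hn i) v (g * σ (blockPrefix n i)) ?_ ?_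
      · exact hall _ _ (hw.trans (mul_assoc _ _ _))
      · have := hall _ _ hw
        rwa [map_mul σ, map_pow σ, ← mul_assoc g] at this)
  refine hsep i j hij n ?_
  have := has.map (ρ g⁻¹)
  simp only [← map_mul_apply'] at this
  simpa only [mul_assoc, inv_mul_cancel_left] using this

/-- Translates of the segment of `0ⁿ 1ⁿ 2ⁿ` with `n` large do not lie near the axis of a given
element. -/
theorem eventually_not_near_axis (hδ : IsHyp X δ) (hσ : IsWWPDSystem ρ x σ R)
    (hsep : SeparatesBlocks ρ x σ) (hτ : IsWWPDSystem ρ x τ R') {f : FreeMonoid (Fin 3)}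
    (hf : f ≠ 1) (S : ℝ) : ∀ᶠ n in Filter.atTop, ∀ (k : ℕ) (g : G),
      gromovProduct (ρ g x) x (ρ (τ f ^ k) x) ≤ S →
      ¬ gromovProduct (ρ (g * σ (blockWord n)) x) x (ρ (τ f ^ k) x) ≤ S := by
  filter_upwards [hσ.eventually_displaced hsep (hτ.wwpd f hf).1
    (2 * (S + 2 * R + 2 * δ + R' + R' * f.length) + dist (ρ (τ f) x) x)] with n hn k g hp hq
  refine hn g fun w w' hw => ?_
  rw [hw] at hq
  exact IsWordSystem.dist_translate_prefix_le hδ hσ.toIsWordSystem hτ.toIsWordSystem hp hq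

/-- Translates of the axes of `σ 0` and `σ 1` do not end at the repelling endpoints of the other two
letters of `τ`. -/
def AvoidsReversed (ρ : G →* (X ≃ᵢ X)) (x : X) (σ τ : FreeMonoid (Fin 3) →* G) : Prop :=
  ∀ i j : Fin 3, i ≠ 2 → i ≠ j → ∀ g : G,
    ¬ Asymptotic (fun n => ρ (g * σ (FreeMonoid.of i) ^ n) x)
      (fun n => ρ ((τ (FreeMonoid.of j) ^ n)⁻¹) x)

theorem exists_reversed_bound (hδ : IsHyp X δ) (hσ : IsWWPDSystem ρ x σ R)
    (hτ : IsWWPDSystem ρ x τ R') (hav : AvoidsReversed ρ x σ τ) (S : ℝ) :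
    ∃ L : ℕ, ∀ i j : Fin 3, i ≠ 2 → i ≠ j → ∀ s ≥ L, ∀ (g : G) (t : ℕ),
      dist (ρ g x) x ≤ S →
      ¬ dist (ρ (g * σ (FreeMonoid.of i) ^ s) x) (ρ ((τ (FreeMonoid.of j) ^ t)⁻¹) x) ≤ S := by
  have key : ∀ i j : Fin 3, ∃ M : ℕ, i ≠ 2 → i ≠ j → ∀ s ≥ M, ∀ (g : G) (t : ℕ),
      dist (ρ g x) x ≤ S →
      ¬ dist (ρ (g * σ (FreeMonoid.of i) ^ s) x) (ρ ((τ (FreeMonoid.of j) ^ t)⁻¹) x) ≤ S := by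
    intro i j
    by_cases hij : i ≠ 2 ∧ i ≠ j
    · obtain ⟨Rz, hRz⟩ := exists_isGoodRay_inv_pow hδ
        (hτ.wwpd (FreeMonoid.of j) (FreeMonoid.of_ne_one j)).1 x
      obtain ⟨M, hM⟩ := (hσ.wwpd (FreeMonoid.of i) (FreeMonoid.of_ne_one i)).exists_bound x hRz
        (hav i j hij.1 hij.2) S
      refine ⟨M, fun _ _ s hs g t h0 => hM s hs g t ?_⟩
      rw [pow_zero, inv_one, map_one]
      exact h0
    · exact ⟨0, fun h1 h2 => absurd ⟨h1, h2⟩ hij⟩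
  choose M hM using key
  refine ⟨∑ i, ∑ j, M i j, fun i j h1 h2 s hs => hM i j h1 h2 s (le_trans ?_ hs)⟩
  exact (Finset.single_le_sum (f := fun j => M i j) (fun _ _ => Nat.zero_le _)
    (Finset.mem_univ j)).trans
    (Finset.single_le_sum (f := fun i => ∑ j, M i j) (fun _ _ => Nat.zero_le _)
      (Finset.mem_univ i))

end Occurrences

/-! ### Long block words do not occur backwards -/

section Reversed

variable {X : Type v} [MetricSpace X] {G : Type u} [Group G] {ρ : G →* (X ≃ᵢ X)} {x : X} {δ : ℝ}
  {σ τ : FreeMonoid (Fin 3) →* G} {R R' : ℝ}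

theorem wordPoint_block {n : ℕ} (hn : 0 < n) (σ : FreeMonoid (Fin 3) →* G) (k q : ℕ) (Y : Fin 3)
    {t : ℕ} (h1 : 3 * n * q + Y * n ≤ t) (h2 : t ≤ 3 * n * q + (Y + 1) * n)
    (h3 : t ≤ 3 * n * k) :
    wordPoint ρ x σ (blockWord n ^ k) t =
      ρ (σ (blockWord n ^ q * blockPrefix n Y) *
        σ (FreeMonoid.of Y) ^ (t - (3 * n * q + Y * n))) x := by
  have h4 : ((Y : ℕ) + 1) * n = Y * n + n := by ring
  have := take_blockWord_pow hn k q Y (s := t - (3 * n * q + Y * n)) (by omega) (by omega)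
  rw [Nat.add_sub_cancel' h1] at this
  rw [wordPoint, this, map_mul σ _ (FreeMonoid.of Y ^ _), map_pow]

/-- Segments of one letter in a translate of a block word do not follow other blocks backwards. -/
theorem sub_lt_of_reversed {n L : ℕ} (hn : 0 < n) {S : ℝ}
    (hL : ∀ i j : Fin 3, i ≠ 2 → i ≠ j → ∀ s ≥ L, ∀ (g : G) (t : ℕ), dist (ρ g x) x ≤ S →
      ¬ dist (ρ (g * σ (FreeMonoid.of i) ^ s) x) (ρ ((τ (FreeMonoid.of j) ^ t)⁻¹) x) ≤ S)
    {k q i i' t t' : ℕ} {g : G} {A Y : Fin 3} (hA : A ≠ 2) (hAY : A ≠ Y)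
    (hi : A * n ≤ i) (hii : i ≤ i') (hi' : i' ≤ (A + 1) * n)
    (ht' : 3 * n * q + Y * n ≤ t') (htt : t' ≤ t) (ht : t ≤ 3 * n * q + (Y + 1) * n)
    (htk : t ≤ 3 * n * k)
    (hd : dist (ρ g (wordPoint ρ x σ (blockWord n) i)) (wordPoint ρ x τ (blockWord n ^ k) t) ≤ S)
    (hd' : dist (ρ g (wordPoint ρ x σ (blockWord n) i'))
      (wordPoint ρ x τ (blockWord n ^ k) t') ≤ S) : i' < i + L := by
  by_contra hlt
  have hA3 : ((A : ℕ) + 1) * n ≤ 3 * n := Nat.mul_le_mul_right _ A.isLt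
  have e : ∀ j, A * n ≤ j → j ≤ (A + 1) * n → wordPoint ρ x σ (blockWord n) j =
      ρ (σ (blockPrefix n A) * σ (FreeMonoid.of A) ^ (j - A * n)) x := by
    intro j h1 h2
    have := wordPoint_block (ρ := ρ) (x := x) hn σ 1 0 A (t := j) (by omega) (by omega) (by omega)
    simpa using this
  rw [e i hi (by omega), wordPoint_block hn τ k q Y (ht'.trans htt) ht htk] at hd
  rw [e i' (by omega) hi', wordPoint_block hn τ k q Y ht' (htt.trans ht) (htt.trans htk)] at hd'
  set a := σ (FreeMonoid.of A) with ha
  set b := τ (FreeMonoid.of Y) with hb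
  set h := τ (blockWord n ^ q * blockPrefix n Y)
  set s := t - (3 * n * q + Y * n)
  set s' := t' - (3 * n * q + Y * n) with hs'
  have hss : s = s' + (t - t') := by omega
  -- Translation takes the point with index `t` on the second path to `x`; from there the second
  -- path runs backwards along powers of the single letter `Y`.
  refine hL A Y hA hAY (i' - i) (by omega)
    ((h * b ^ s)⁻¹ * (g * (σ (blockPrefix n A) * a ^ (i - A * n)))) (t - t') ?_ ?_
  · rw [← (ρ (h * b ^ s)).dist_eq, ← map_mul_apply', mul_inv_cancel_left, map_mul_apply' ρ g]
    exact hd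
  · rw [← (ρ (h * b ^ s)).dist_eq, ← map_mul_apply', ← map_mul_apply', mul_assoc _ _ (a ^ _),
      mul_inv_cancel_left, mul_assoc g, mul_assoc _ (a ^ _), ← pow_add, map_mul_apply' ρ g,
      show i - A * n + (i' - i) = i' - A * n by omega]
    have : h * b ^ s * (b ^ (t - t'))⁻¹ = h * b ^ s' := by rw [hss, pow_add]; group
    rw [this]
    exact hd'

variable [GromovHyperbolic X]

/-- For `n` large, no translate of the segment of the block word `0ⁿ 1ⁿ 2ⁿ` of `σ` lies backwards
near the axis of the block word of `τ`. -/
theorem eventually_not_reversed (hδ : IsHyp X δ) (hσ : IsWWPDSystem ρ x σ R)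
    (hτ : IsWWPDSystem ρ x τ R') (hav : AvoidsReversed ρ x σ τ) (S W : ℝ) :
    ∀ᶠ n in Filter.atTop, ∀ (k : ℕ) (g : G) (y : X), y = ρ (τ (blockWord n) ^ k) x →
      gromovProduct (ρ g x) y x ≤ S →
      gromovProduct (ρ (g * σ (blockWord n)) x) y x ≤ S →
      ¬ dist y (ρ g x) + dist (ρ g x) (ρ (g * σ (blockWord n)) x) ≤
        dist y (ρ (g * σ (blockWord n)) x) + W := by
  have hR := hσ.nonneg
  have hR' := hτ.nonneg
  set R₁ := S + 2 * R + 2 * δ + R' with hR₁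
  obtain ⟨L, hL⟩ := exists_reversed_bound hδ hσ hτ hav R₁
  -- `A` dominates the constants for which the matching `f` below is coarsely Lipschitz (first
  -- entry) and expanding (second and third); `no_reversed_blocks` needs `1 ≤ A`.
  obtain ⟨A, hA⟩ := exists_nat_ge (max (max (R' * (2 * R₁ + R) + R') (R * R'))
    (max (2 * R * R₁ + R) 1))
  simp only [max_le_iff] at hA
  obtain ⟨⟨hA1, hA2⟩, hA3, hA4⟩ := hA
  have hA4' : 1 ≤ A := by exact_mod_cast hA4
  obtain ⟨M, hM⟩ := no_reversed_blocks hA4' L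
  obtain ⟨N, hN⟩ := exists_nat_gt (R * (W + 2 * R₁ + 2 * R') + R)
  filter_upwards [Filter.eventually_ge_atTop M, Filter.eventually_ge_atTop N,
    Filter.eventually_gt_atTop 0] with n hnM hnN hn0 k g y hy hp hq hord
  have hlen : (blockWord n ^ k).length = 3 * n * k := by
    rw [FreeMonoid.length_pow', length_blockWord]; ring
  have hlen1 := length_blockWord n
  set z : ℕ → X := fun i => ρ g (wordPoint ρ x σ (blockWord n) i) with hz
  set Y : ℕ → X := wordPoint ρ x τ (blockWord n ^ k) with hY
  have hYend : Y (3 * n * k) = y := by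
    rw [hY, ← hlen, wordPoint_length, hy, map_pow]
  have hz0 : z 0 = ρ g x := by simp only [hz, wordPoint_zero]
  have hzend : z (3 * n) = ρ (g * σ (blockWord n)) x := by
    simp only [hz]
    rw [← hlen1, wordPoint_length, map_mul_apply']
  have hnear : ∀ i, ∃ t ≤ 3 * n * k, i ≤ 3 * n → dist (z i) (Y t) ≤ R₁ := by
    intro i
    by_cases hi : i ≤ 3 * n
    swap
    · exact ⟨0, Nat.zero_le _, fun h => absurd h hi⟩
    obtain ⟨t, ht, h⟩ := hτ.exists_near_wordPoint (blockWord n ^ k) (z i)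
    rw [hlen] at ht
    refine ⟨t, ht, fun _ => h.trans ?_⟩
    have h1 : gromovProduct (z i) (ρ g x) (ρ (g * σ (blockWord n)) x) ≤ R := by
      have := hσ.gromovProduct_wordPoint_le (blockWord n) (Nat.zero_le i) (hi.trans_eq hlen1.symm)
        le_rfl
      rw [← gromovProduct_map (ρ g), wordPoint_zero, wordPoint_length, ← map_mul_apply'] at this
      exact this
    have h2 := hδ.gromovProduct_le_of_between hp hq h1
    rw [gromovProduct_comm, map_pow, ← hy]
    linarith
  choose f hfk hf using hnear
  have hstep : ∀ i i', i ≤ 3 * n → i' ≤ 3 * n →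
      |(f i' : ℝ) - f i| ≤ R' * (2 * R₁ + dist (z i) (z i')) + R' := by
    intro i i' h1 h2
    have e1 := hτ.abs_sub_le (blockWord n ^ k) ((hfk i).trans_eq hlen.symm)
      ((hfk i').trans_eq hlen.symm)
    have e2 := dist_triangle4 (Y (f i)) (z i) (z i') (Y (f i'))
    rw [dist_comm (Y (f i)) (z i)] at e2
    have e3 := mul_le_mul_of_nonneg_left (show dist (Y (f i)) (Y (f i')) ≤
      2 * R₁ + dist (z i) (z i') by linarith [hf i h1, hf i' h2]) hR'
    change _ ≤ R' * dist (Y (f i)) (Y (f i')) + R' at e1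
    linarith
  have hfT : ∀ i i', i ≤ i' → i' ≤ 3 * n → (i' : ℝ) - i ≤ A * |(f i' : ℝ) - f i| + A := by
    intro i i' h1 h2
    have e0 := hσ.abs_sub_le (blockWord n) (s := i) (t := i') (by omega) (by omega)
    have e1 : dist (z i) (z i') =
      dist (wordPoint ρ x σ (blockWord n) i) (wordPoint ρ x σ (blockWord n) i') := (ρ g).dist_eq _ _
    rw [← e1] at e0
    have e2 := dist_triangle4 (z i) (Y (f i)) (Y (f i')) (z i')
    rw [dist_comm (Y (f i')) (z i')] at e2
    have e3 := hτ.dist_wordPoint_le (blockWord n ^ k) ((hfk i).trans_eq hlen.symm)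
      ((hfk i').trans_eq hlen.symm)
    change dist (Y (f i)) (Y (f i')) ≤ _ at e3
    have e4 := mul_le_mul_of_nonneg_left (show dist (z i) (z i') ≤
      2 * R₁ + R' * |(f i' : ℝ) - f i| by linarith [hf i (h1.trans h2), hf i' h2]) hR
    have e5 := mul_le_mul_of_nonneg_right hA2 (abs_nonneg ((f i' : ℝ) - f i))
    have e6 := le_abs_self ((i' : ℝ) - i)
    linarith
  refine hM n hnM (fun i => (f i : ℤ)) (fun i => Int.natCast_nonneg _) (fun i hi => ?_)
    (fun i i' h1 h2 => by exact_mod_cast hfT i i' h1 h2) ?_ ?_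
  · have e1 := hstep i (i + 1) hi.le hi
    have e2 : dist (z i) (z (i + 1)) ≤ R := by
      have := hσ.dist_wordPoint_le (blockWord n) (s := i) (t := i + 1) (by omega) (by omega)
      rw [← (ρ g).dist_eq] at this
      simpa using this
    have e3 := mul_le_mul_of_nonneg_left (show 2 * R₁ + dist (z i) (z (i + 1)) ≤ 2 * R₁ + R by
      linarith) hR'
    have e4 : |(f (i + 1) : ℝ) - f i| ≤ A := by linarith
    exact_mod_cast e4
  -- If the matching preserved the orientation, the segment would run towards `y`. Since `hord` says
  -- that it runs away from `y`, its ends would be close together, which `n ≥ N` excludes.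
  · by_contra hle
    have hle' : f 0 ≤ f (3 * n) := by exact_mod_cast not_lt.1 hle
    have e1 := hτ.gromovProduct_wordPoint_le (blockWord n ^ k) hle'
      ((hfk (3 * n)).trans_eq rfl) hlen.ge
    change gromovProduct (Y (f (3 * n))) (Y (f 0)) (Y (3 * n * k)) ≤ R' at e1
    rw [hYend] at e1
    have e2 := dist_add_dist_eq (Y (f (3 * n))) (Y (f 0)) y
    have e3 := hf 0 (by omega)
    have e4 := hf (3 * n) le_rfl
    rw [hz0] at e3
    rw [hzend] at e4
    have e5 := dist_triangle y (Y (f (3 * n))) (ρ (g * σ (blockWord n)) x)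
    have e6 := dist_triangle y (ρ g x) (Y (f 0))
    rw [dist_comm y (Y (f (3 * n))), dist_comm (Y (f (3 * n))) (ρ (g * σ (blockWord n)) x)] at e5
    rw [dist_comm y (Y (f 0))] at e6
    have e7 : dist (ρ g x) (ρ (g * σ (blockWord n)) x) ≤ W + 2 * R₁ + 2 * R' := by
      linarith [dist_nonneg (x := Y (f 0)) (y := Y (f (3 * n)))]
    rw [map_mul_apply', (ρ g).dist_eq] at e7
    have e8 := hσ.lower (blockWord n)
    rw [hlen1] at e8
    have e9 := mul_le_mul_of_nonneg_left e7 hR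
    have e10 : (N : ℝ) ≤ (3 * n : ℕ) := by exact_mod_cast (show N ≤ 3 * n by omega)
    linarith
  · intro X' Y' hX' hY' hXY q i i' h1 h2 h3 h4 h5 h6
    refine sub_lt_of_reversed hn0 hL (A := ⟨X', by omega⟩) (Y := ⟨Y', hY'⟩)
      (fun h => by have := congrArg Fin.val h; simp at this; omega)
      (fun h => hXY (congrArg Fin.val h)) h1 h2 h3 (t := f i) (t' := f i') (q := q) (k := k) (g := g)
      ?_ ?_ ?_ (hfk i) (hf i ?_) (hf i' ?_)
    · exact_mod_cast h4
    · exact_mod_cast h5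
    · exact_mod_cast h6
    all_goals
      have : (X' + 1) * n ≤ 3 * n := Nat.mul_le_mul_right _ (by omega)
      omega

end Reversed

/-! ### The nested substitution that prevents reversals -/

section Substitution

variable {X : Type v} [MetricSpace X] {G : Type u} [Group G] {ρ : G →* (X ≃ᵢ X)} {x : X} {δ : ℝ}
  {σ : FreeMonoid (Fin 3) →* G} {R : ℝ}

/-- The substitution `0 ↦ a = 0`, `1 ↦ b = a ^ m * 1`, `2 ↦ b ^ m' * 2`. -/
def nestedSubst (m m' : ℕ) : FreeMonoid (Fin 3) →* FreeMonoid (Fin 3) :=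
  FreeMonoid.lift ![FreeMonoid.of 0, powLetter (FreeMonoid.of 0) 1 m,
    powLetter (powLetter (FreeMonoid.of 0) 1 m) 2 m']

theorem nestedSubst_zero (m m' : ℕ) : nestedSubst m m' (FreeMonoid.of 0) = FreeMonoid.of 0 := by
  simp [nestedSubst]

theorem nestedSubst_one (m m' : ℕ) :
    nestedSubst m m' (FreeMonoid.of 1) = powLetter (FreeMonoid.of 0) 1 m := by
  simp [nestedSubst]

theorem nestedSubst_two (m m' : ℕ) : nestedSubst m m' (FreeMonoid.of 2) =
    powLetter (powLetter (FreeMonoid.of 0) 1 m) 2 m' := by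
  simp [nestedSubst]

theorem length_le_length_nestedSubst (m m' : ℕ) (w : FreeMonoid (Fin 3)) :
    w.length ≤ (nestedSubst m m' w).length := by
  induction w using FreeMonoid.inductionOn' with
  | one => simp
  | of_mul i w ih =>
    have h : 1 ≤ (nestedSubst m m' (FreeMonoid.of i)).length := by
      fin_cases i
      · simp [nestedSubst]
      · simpa [nestedSubst] using one_le_length_powLetter _ _ _
      · simpa [nestedSubst] using one_le_length_powLetter _ _ _
    rw [map_mul, FreeMonoid.length_mul, FreeMonoid.length_mul, FreeMonoid.length_of]
    omega

theorem mem_powLetter (β : FreeMonoid (Fin 3)) (e : Fin 3) (m : ℕ) : e ∈ powLetter β e m := by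
  simpa using mem_powLetter_pow β e m one_pos

theorem notMem_powLetter {β : FreeMonoid (Fin 3)} {e i : Fin 3} (hi : i ∉ β) (hie : i ≠ e) (m : ℕ) :
    i ∉ powLetter β e m := by
  rw [powLetter, FreeMonoid.mem_mul, FreeMonoid.mem_of]
  exact not_or.2 ⟨FreeMonoid.notMem_pow hi m, hie⟩

theorem powLetter_ne_one (β : FreeMonoid (Fin 3)) (e : Fin 3) (m : ℕ) : powLetter β e m ≠ 1 := by
  intro h
  have := one_le_length_powLetter β e m
  simp [h] at this

/-- The image of the letter `1` contains a `1`, unlike that of `0`, and only the image of `2`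
contains a `2`. After removal of common prefixes, the later block therefore contains a letter that
the earlier one lacks. -/
theorem SeparatesWords.separatesBlocks (hsep : SeparatesWords ρ x σ) (m m' : ℕ) :
    SeparatesBlocks ρ x (σ.comp (nestedSubst m m')) := by
  have h10 : (1 : Fin 3) ∉ FreeMonoid.of (0 : Fin 3) := by simp [FreeMonoid.mem_of]
  have h20 : (2 : Fin 3) ∉ FreeMonoid.of (0 : Fin 3) := by simp [FreeMonoid.mem_of]
  have h21 : (2 : Fin 3) ∉ powLetter (FreeMonoid.of 0) 1 m := notMem_powLetter h20 (by decide) m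
  have key : ∀ (e : Fin 3) (w α β : FreeMonoid (Fin 3)), e ∈ nestedSubst m m' α →
      e ∉ nestedSubst m m' β → ¬ Asymptotic
        (fun n => ρ (σ.comp (nestedSubst m m') β ^ n) x)
        (fun n => ρ (σ.comp (nestedSubst m m') w * σ.comp (nestedSubst m m') α ^ n) x) := by
    intro e w α β hα hβ h
    refine hsep e (nestedSubst m m' w) (nestedSubst m m' α) _ (Or.inr hα) hβ ?_
    simpa using h.symm
  intro i j hij n h
  have hcase : ∀ i j : Fin 3, i < j → (i = 0 ∧ j = 1) ∨ (i = 0 ∧ j = 2) ∨ (i = 1 ∧ j = 2) := by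
    decide
  rcases hcase i j hij with ⟨rfl, rfl⟩ | ⟨rfl, rfl⟩ | ⟨rfl, rfl⟩
  · refine key 1 (FreeMonoid.of 0 ^ n) (FreeMonoid.of 1) (FreeMonoid.of 0) ?_ ?_
      (by simpa [blockPrefix] using h)
    · rw [nestedSubst_one]; exact mem_powLetter _ _ _
    · rwa [nestedSubst_zero]
  · refine key 2 (FreeMonoid.of 0 ^ n * FreeMonoid.of 1 ^ n) (FreeMonoid.of 2) (FreeMonoid.of 0)
      ?_ ?_ (by simpa [blockPrefix] using h)
    · rw [nestedSubst_two]; exact mem_powLetter _ _ _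
    · rwa [nestedSubst_zero]
  · refine key 2 (FreeMonoid.of 1 ^ n) (FreeMonoid.of 2) (FreeMonoid.of 1) ?_ ?_ ?_
    · rw [nestedSubst_two]; exact mem_powLetter _ _ _
    · rwa [nestedSubst_one]
    · have h' := h.map (ρ (σ.comp (nestedSubst m m') (FreeMonoid.of 0 ^ n))⁻¹)
      simp only [blockPrefix, ← map_mul_apply'] at h'
      simpa only [map_mul, mul_assoc, inv_mul_cancel_left] using h'

variable [GromovHyperbolic X]

theorem IsWWPDSystem.exists_comp (hδ : IsHyp X δ) (hσ : IsWWPDSystem ρ x σ R)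
    {s : FreeMonoid (Fin 3) →* FreeMonoid (Fin 3)} (hs : ∀ w, w.length ≤ (s w).length) :
    ∃ R', IsWWPDSystem ρ x (σ.comp s) R' := by
  obtain ⟨R', -, hR'⟩ := exists_isWordSystem (σ := σ.comp s) hδ hσ.nonneg hσ.nonneg fun w =>
    (Nat.cast_le.2 (hs w)).trans (hσ.lower (s w))
  refine ⟨R', { toIsWordSystem := hR', wwpd := fun w hw => hσ.wwpd (s w) fun h => hw ?_ }⟩
  have := hs w
  rw [h, FreeMonoid.length_one, Nat.le_zero, FreeMonoid.length_eq_zero] at this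
  exact this

/-- Each exponent only has to be large: `m` handles the pairs `(0, 1)` and `(1, 0)`, and then `m'`,
chosen for this `m`, handles `(0, 2)` and `(1, 2)`. Finiteness of `ι` allows one choice for all
systems. -/
theorem exists_substitution (hδ : IsHyp X δ) {ι : Type*} [Finite ι]
    {τ : ι → FreeMonoid (Fin 3) →* G} (hτ : ∀ l, ∃ R, IsWWPDSystem ρ x (τ l) R)
    (hsep : ∀ l, SeparatesWords ρ x (τ l)) (l₀ : ι) :
    ∃ s : FreeMonoid (Fin 3) →* FreeMonoid (Fin 3),
      (∀ l, ∃ R, IsWWPDSystem ρ x ((τ l).comp s) R) ∧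
      SeparatesBlocks ρ x ((τ l₀).comp s) ∧
      ∀ l, AvoidsReversed ρ x ((τ l₀).comp s) ((τ l).comp s) := by
  have h10 : (1 : Fin 3) ∉ FreeMonoid.of (0 : Fin 3) := by simp [FreeMonoid.mem_of]
  have h20 : (2 : Fin 3) ∉ FreeMonoid.of (0 : Fin 3) := by simp [FreeMonoid.mem_of]
  have h0 : FreeMonoid.of (0 : Fin 3) ≠ 1 := FreeMonoid.of_ne_one 0
  choose R hR using hτ
  have hlox : ∀ l w, w ≠ 1 → IsLoxodromic (ρ (τ l w)) := fun l w hw => ((hR l).wwpd w hw).1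
  obtain ⟨m, hm1, hm2⟩ := ((Filter.eventually_all.2 fun l => not_asymptotic_inv_powLetter hδ (hR l)
    (hsep l) (hlox l₀ _ h0) h0 h10).and (Filter.eventually_all.2 fun l =>
      not_asymptotic_powLetter hδ (hR l₀) (hsep l₀) (hlox l _ h0) h0 h10)).exists
  have h21 : (2 : Fin 3) ∉ powLetter (FreeMonoid.of 0) 1 m := notMem_powLetter h20 (by decide) m
  have h1 := powLetter_ne_one (FreeMonoid.of 0) 1 m
  obtain ⟨m', hm3, hm4⟩ := ((Filter.eventually_all.2 fun l => not_asymptotic_inv_powLetter hδ (hR l)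
    (hsep l) (hlox l₀ _ h0) h1 h21).and (Filter.eventually_all.2 fun l =>
      not_asymptotic_inv_powLetter hδ (hR l) (hsep l) (hlox l₀ _ h1) h1 h21)).exists
  refine ⟨nestedSubst m m', fun l => (hR l).exists_comp hδ (length_le_length_nestedSubst m m'),
    (hsep l₀).separatesBlocks m m', fun l i j hi hij g => ?_⟩
  have hcase : ∀ i j : Fin 3, i ≠ 2 → i ≠ j →
      (i = 0 ∧ j = 1) ∨ (i = 0 ∧ j = 2) ∨ (i = 1 ∧ j = 0) ∨ (i = 1 ∧ j = 2) := by decide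
  rcases hcase i j hi hij with ⟨rfl, rfl⟩ | ⟨rfl, rfl⟩ | ⟨rfl, rfl⟩ | ⟨rfl, rfl⟩ <;>
    simp only [MonoidHom.comp_apply, nestedSubst_zero, nestedSubst_one, nestedSubst_two]
  · exact hm1 l g
  · exact hm3 l g
  · exact hm2 l g
  · exact hm4 l g

end Substitution

/-! ### Counting quasimorphisms -/

section Copies

variable {X : Type v} [MetricSpace X] {G : Type u} [Group G]

/-- `(p, q)` is a translate of the pair `(x, u x)`. -/
def IsCopy (ρ : G →* (X ≃ᵢ X)) (x : X) (u : G) (p q : X) : Prop :=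
  ∃ g, p = ρ g x ∧ q = ρ (g * u) x

/-- The number of copies of `(x, u x)` met on the way from `x` to `g x`, minus those met on the
way back. -/
noncomputable def copyCount (ρ : G →* (X ≃ᵢ X)) (x : X) (u : G) (W : ℝ) (g : G) : ℝ :=
  discDiff (IsCopy ρ x u) W x (ρ g x)

variable {ρ : G →* (X ≃ᵢ X)} {x : X} {u : G} {W δ : ℝ}

theorem isCopy_map_iff (g : G) (p q : X) :
    IsCopy ρ x u p q ↔ IsCopy ρ x u (ρ g p) (ρ g q) := by
  constructor
  · rintro ⟨h, rfl, rfl⟩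
    exact ⟨g * h, by rw [map_mul_apply'], by rw [← map_mul_apply', mul_assoc]⟩
  · rintro ⟨h, hp, hq⟩
    refine ⟨g⁻¹ * h, (ρ g).injective ?_, (ρ g).injective ?_⟩
    · rw [hp, ← map_mul_apply', mul_inv_cancel_left]
    · rw [hq, ← map_mul_apply', mul_assoc, mul_inv_cancel_left]

theorem isLongFor_isCopy (hW : 0 ≤ W) (hu : 2 * W + 1 ≤ dist x (ρ u x)) :
    IsLongFor W (IsCopy ρ x u) := by
  refine ⟨hW, ?_⟩
  rintro p q ⟨g, rfl, rfl⟩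
  rwa [map_mul_apply', (ρ g).dist_eq]

theorem abs_copyCount_le (hu : IsLongFor W (IsCopy ρ x u)) (g : G) :
    |copyCount ρ x u W g| ≤ dist x (ρ g x) :=
  abs_discDiff_le hu _ _

theorem exists_copyCount_defect_bound (hδ : IsHyp X δ) (hX : IsLengthSpace X) (hW : 0 ≤ W) :
    ∃ B : ℝ, 0 ≤ B ∧ ∀ (ρ : G →* (X ≃ᵢ X)) (x : X) (u : G), IsLongFor W (IsCopy ρ x u) →
      ∀ g h, |copyCount ρ x u W g + copyCount ρ x u W h - copyCount ρ x u W (g * h)| ≤ B := by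
  obtain ⟨B, hB0, hB⟩ := exists_discDiff_cocycle_bound hδ hX hW
  refine ⟨B, hB0, fun ρ x u hu g h => ?_⟩
  have h1 := hB _ hu x (ρ g x) (ρ (g * h) x)
  have h2 : discDiff (IsCopy ρ x u) W (ρ g x) (ρ (g * h) x) = copyCount ρ x u W h := by
    rw [copyCount, discDiff, discDiff, map_mul_apply', discDist_map (isCopy_map_iff g),
      discDist_map (isCopy_map_iff g)]
  rwa [h2] at h1

theorem discDist_pow_le (hu : IsLongFor W (IsCopy ρ x u)) (k : ℕ) :
    discDist (IsCopy ρ x u) W x (ρ (u ^ k) x) ≤ k * (dist x (ρ u x) - W) := by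
  induction k with
  | zero => simpa using discDist_le_dist hu x x
  | succ k ih =>
    have h1 := discDist_triangle hu x (ρ (u ^ k) x) (ρ (u ^ (k + 1)) x)
    have h2 := discDist_pair_le hu ⟨u ^ k, rfl, rfl⟩
    rw [map_mul_apply' ρ (u ^ k), (ρ (u ^ k)).dist_eq, ← map_mul_apply', ← pow_succ] at h2
    push_cast
    linarith

theorem IsWordSystem.le_dist_pow {σ : FreeMonoid (Fin 3) →* G} {R : ℝ} (h : IsWordSystem ρ x σ R)
    (w : FreeMonoid (Fin 3)) (k : ℕ) :
    k * (dist x (ρ (σ w) x) - 2 * R) ≤ dist x (ρ (σ w ^ k) x) := by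
  induction k with
  | zero => simp
  | succ k ih =>
    have h1 := h.between (w ^ k) w
    have h2 := dist_add_dist_eq (ρ (σ (w ^ k)) x) x (ρ (σ (w ^ k * w)) x)
    rw [dist_word_mul, ← pow_succ, map_pow σ, map_pow σ] at h2
    rw [← pow_succ, map_pow σ, map_pow σ] at h1
    push_cast
    linarith

end Copies

/-! ### A triangular family of quasimorphisms -/

section Family

variable {X : Type v} [MetricSpace X] {G : Type u} [Group G] {ρ : G →* (X ≃ᵢ X)} {x : X} {δ : ℝ}
  [GromovHyperbolic X]

/-- Quasimorphisms of `G` with uniform defect, the `n`-th of which is unbounded on the powers of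
`τ l₀ (f n)`, nonnegative on those of `τ l (f n)` and zero on those of `τ l (f i)` with `i < n`. -/
theorem exists_quasimorphisms (hδ : IsHyp X δ) (hX : IsLengthSpace X) {ι : Type*} [Finite ι]
    {τ : ι → FreeMonoid (Fin 3) →* G} (hτ : ∀ l, ∃ R, IsWWPDSystem ρ x (τ l) R)
    (hsep : ∀ l, SeparatesWords ρ x (τ l)) (l₀ : ι) :
    ∃ (B : ℝ) (f : ℕ → FreeMonoid (Fin 3)) (q : ℕ → G → ℝ), 0 ≤ B ∧
      (∀ n g, |q n g| ≤ dist x (ρ g x)) ∧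
      (∀ n g h, |q n g + q n h - q n (g * h)| ≤ B) ∧
      (∀ n (k : ℕ), k ≤ q n (τ l₀ (f n) ^ k)) ∧
      (∀ n l (k : ℕ), 0 ≤ q n (τ l (f n) ^ k)) ∧
      ∀ i n, i < n → ∀ l (k : ℕ), q n (τ l (f i) ^ k) = 0 := by
  obtain ⟨s, hs, hblocks, hav⟩ := exists_substitution hδ hτ hsep l₀
  choose R hR using hs
  -- The length of `u ^ k` falls short of `k` times that of `u` by at most `2 * R l₀` per period. A
  -- discount larger by `1` leaves a gain of at least `1` per period.
  set W := 2 * R l₀ + 1 with hWdef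
  have hW : 0 ≤ W := by have := (hR l₀).nonneg; positivity
  obtain ⟨B, hB0, hB⟩ := exists_copyCount_defect_bound (G := G) hδ hX hW
  obtain ⟨S, -, hS⟩ := exists_pair_of_discDist_lt hδ hX hW
  let u : ℕ → G := fun n => τ l₀ (s (blockWord n))
  have hlong : ∀ᶠ n in Filter.atTop, IsLongFor W (IsCopy ρ x (u n)) := by
    obtain ⟨k, hk⟩ := (hR l₀).tendsto (2 * W + 1)
    filter_upwards [Filter.eventually_ge_atTop k] with n hn
    exact isLongFor_isCopy hW (hk (blockWord n) (by rw [length_blockWord]; omega))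
  have hback : ∀ᶠ n in Filter.atTop, ∀ l (k : ℕ) (g : G) (y : X),
      y = ρ (τ l (s (blockWord n)) ^ k) x → gromovProduct (ρ g x) y x ≤ S →
      gromovProduct (ρ (g * u n) x) y x ≤ S →
      ¬ dist y (ρ g x) + dist (ρ g x) (ρ (g * u n) x) ≤ dist y (ρ (g * u n) x) + (W + 1) :=
    Filter.eventually_all.2 fun l => eventually_not_reversed hδ (hR l₀) (hR l) (hav l) S (W + 1)
  have hfar : ∀ i, 0 < i → ∀ᶠ n in Filter.atTop, ∀ l (k : ℕ) (g : G),
      gromovProduct (ρ g x) x (ρ (τ l (s (blockWord i)) ^ k) x) ≤ S →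
      ¬ gromovProduct (ρ (g * u n) x) x (ρ (τ l (s (blockWord i)) ^ k) x) ≤ S := by
    intro i hi
    have hne : blockWord i ≠ 1 := fun h => by
      have := length_blockWord i
      rw [h, FreeMonoid.length_one] at this
      omega
    exact Filter.eventually_all.2 fun l =>
      eventually_not_near_axis hδ (hR l₀) hblocks (hR l) hne S
  -- All conditions on one exponent, and on one exponent relative to finitely many earlier ones,
  -- hold eventually, so a sparse sequence satisfies them.
  obtain ⟨N, hN, hNN⟩ := exists_seq_of_forall_finset_exists
    (fun n : ℕ => 0 < n ∧ IsLongFor W (IsCopy ρ x (u n)) ∧ ∀ l (k : ℕ) (g : G) (y : X),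
      y = ρ (τ l (s (blockWord n)) ^ k) x → gromovProduct (ρ g x) y x ≤ S →
      gromovProduct (ρ (g * u n) x) y x ≤ S →
      ¬ dist y (ρ g x) + dist (ρ g x) (ρ (g * u n) x) ≤ dist y (ρ (g * u n) x) + (W + 1))
    (fun i n => ∀ l (k : ℕ) (g : G),
      gromovProduct (ρ g x) x (ρ (τ l (s (blockWord i)) ^ k) x) ≤ S →
      ¬ gromovProduct (ρ (g * u n) x) x (ρ (τ l (s (blockWord i)) ^ k) x) ≤ S)
    (fun t ht => (((Filter.eventually_gt_atTop 0).and (hlong.and hback)).and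
      ((Finset.eventually_all t).2 fun i hi => hfar i (ht i hi).1)).exists)
  have hlen : ∀ n, IsLongFor W (IsCopy ρ x (u (N n))) := fun n => (hN n).2.1
  -- On the way back there is no discount, since it would require a copy lying backwards along the
  -- axis.
  have hreturn : ∀ n l (k : ℕ),
      discDist (IsCopy ρ x (u (N n))) W (ρ (τ l (s (blockWord (N n))) ^ k) x) x =
        dist x (ρ (τ l (s (blockWord (N n))) ^ k) x) := by
    intro n l k
    by_contra hne
    have hlt := lt_of_le_of_ne (discDist_le_dist (hlen n) _ _) (by rwa [dist_comm] at hne)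
    obtain ⟨p, q, ⟨g, rfl, rfl⟩, hp, hq, hpq⟩ := hS _ (hlen n) _ _ hlt
    exact (hN n).2.2 l k g _ rfl hp hq (by linarith)
  refine ⟨B, fun n => s (blockWord (N n)), fun n => copyCount ρ x (u (N n)) W, hB0,
    fun n g => abs_copyCount_le (hlen n) g, fun n => hB ρ x _ (hlen n), fun n k => ?_,
    fun n l k => ?_, fun i n hin l k => ?_⟩
  · have h1 := discDist_pow_le (hlen n) k
    have h2 := (hR l₀).le_dist_pow (blockWord (N n)) k
    have h3 : (k : ℝ) * (dist x (ρ (u (N n)) x) - W) =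
        k * (dist x (ρ (u (N n)) x) - 2 * R l₀) - k := by rw [hWdef]; ring
    simp only [copyCount, discDiff, hreturn]
    simp only [MonoidHom.comp_apply] at h2
    simp only [u] at h1 h3 ⊢
    linarith
  · simp only [copyCount, discDiff, hreturn]
    linarith [discDist_le_dist (hlen n) x (ρ (τ l (s (blockWord (N n))) ^ k) x)]
  · have h1 : discDist (IsCopy ρ x (u (N n))) W x (ρ (τ l (s (blockWord (N i))) ^ k) x) =
        dist x (ρ (τ l (s (blockWord (N i))) ^ k) x) := by
      by_contra hne
      obtain ⟨p, q, ⟨g, rfl, rfl⟩, hp, hq, -⟩ :=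
        hS _ (hlen n) _ _ (lt_of_le_of_ne (discDist_le_dist (hlen n) _ _) hne)
      exact hNN i n hin l k g hp hq
    have h2 : discDist (IsCopy ρ x (u (N n))) W (ρ (τ l (s (blockWord (N i))) ^ k) x) x =
        dist (ρ (τ l (s (blockWord (N i))) ^ k) x) x := by
      by_contra hne
      obtain ⟨p, q, ⟨g, rfl, rfl⟩, hp, hq, -⟩ :=
        hS _ (hlen n) _ _ (lt_of_le_of_ne (discDist_le_dist (hlen n) _ _) hne)
      rw [gromovProduct_comm] at hp hq
      exact hNN i n hin l k g hp hq
    simp only [copyCount, discDiff, h1, h2, dist_comm, sub_self]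

end Family

/-! ### Word systems from Schottky WWPD subgroups -/

section FreeSubgroup

variable {X : Type v} [MetricSpace X] {G : Type u} [Group G] {ρ : G →* (X ≃ᵢ X)} {F : Subgroup G}

/-- Positive words in the three letters, as elements of a free group of rank two. -/
def freeWord (b : FreeGroupBasis (Fin 2) F) : FreeMonoid (Fin 3) →* G :=
  F.subtype.comp (b.repr.symm.toMonoidHom.comp wordHom)

theorem freeWord_mem (b : FreeGroupBasis (Fin 2) F) (w : FreeMonoid (Fin 3)) :
    freeWord b w ∈ F :=
  (b.repr.symm (wordHom w)).2

theorem freeWord_ne_one (b : FreeGroupBasis (Fin 2) F) {w : FreeMonoid (Fin 3)} (hw : w ≠ 1) :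
    freeWord b w ≠ 1 := by
  intro h
  have h1 : b.repr.symm (wordHom w) = 1 := Subtype.ext h
  have h2 : wordHom w = 1 := (MulEquiv.map_eq_one_iff _).1 h1
  have h3 := length_le_norm_wordHom w
  rw [h2, FreeGroup.norm_one, Nat.le_zero, FreeMonoid.length_eq_zero] at h3
  exact hw h3

/-- The basis provided by `IsSchottky` need not be `b`; a change of basis distorts word lengths by
at most a factor. -/
theorem IsSchottky.exists_norm_le (h : IsSchottky (ρ.comp F.subtype))
    (b : FreeGroupBasis (Fin 2) F) (x : X) : ∃ K C : ℝ, 0 ≤ K ∧ 0 ≤ C ∧ ∀ f f' : F,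
      ((b.repr (f⁻¹ * f')).norm : ℝ) ≤ K * dist (ρ f x) (ρ f' x) + C := by
  obtain ⟨n, b', h⟩ := h
  obtain ⟨K, C, hK, hC, hKC⟩ := h x
  obtain ⟨K', hK'⟩ := exists_norm_map_le (b'.repr.symm.trans b.repr).toMonoidHom
  have hK0 : 0 < K := by linarith
  refine ⟨K' * K, K' * K * C, by positivity, by positivity, fun f f' => ?_⟩
  have h1 : (b.repr (f⁻¹ * f')).norm ≤ K' * (b'.repr (f⁻¹ * f')).norm := by
    simpa using hK' (b'.repr (f⁻¹ * f'))
  have h2 : ((b'.repr (f⁻¹ * f')).norm : ℝ) ≤ K * (dist (ρ f x) (ρ f' x) + C) := by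
    have := (hKC f f').1
    rw [sub_le_iff_le_add, div_le_iff₀ hK0, mul_comm] at this
    exact this
  calc ((b.repr (f⁻¹ * f')).norm : ℝ) ≤ K' * (b'.repr (f⁻¹ * f')).norm := by exact_mod_cast h1
    _ ≤ K' * (K * (dist (ρ f x) (ρ f' x) + C)) := by gcongr
    _ = _ := by ring

variable [GromovHyperbolic X]

theorem IsWWPDSchottky.exists_isWWPDSystem {δ : ℝ} (hδ : IsHyp X δ) (h : IsWWPDSchottky ρ F)
    (b : FreeGroupBasis (Fin 2) F) (x : X) :
    (∃ R, IsWWPDSystem ρ x (freeWord b) R) ∧ SeparatesWords ρ x (freeWord b) := by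
  obtain ⟨K, C, hK, hC, hKC⟩ := h.1.exists_norm_le b x
  have hlow : ∀ w : FreeMonoid (Fin 3),
      (w.length : ℝ) ≤ K * dist x (ρ (freeWord b w) x) + C := by
    intro w
    have h1 := hKC 1 (b.repr.symm (wordHom w))
    rw [inv_one, one_mul, MulEquiv.apply_symm_apply, OneMemClass.coe_one, map_one] at h1
    exact (Nat.cast_le.2 (length_le_norm_wordHom w)).trans h1
  obtain ⟨R, -, hR⟩ := exists_isWordSystem hδ hK hC hlow
  obtain ⟨R', hR0', hR'⟩ := exists_fork_bound hδ hK hC hlow fun i j hij w w' => by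
    have h1 := hKC (b.repr.symm (wordHom (FreeMonoid.of i * w)))
      (b.repr.symm (wordHom (FreeMonoid.of j * w')))
    rw [map_mul, map_inv, MulEquiv.apply_symm_apply, MulEquiv.apply_symm_apply] at h1
    exact (Nat.cast_le.2 (length_add_le_norm_wordHom hij w w')).trans h1
  have hwwpd : ∀ w : FreeMonoid (Fin 3), w ≠ 1 → IsWWPD ρ (freeWord b w) := fun w hw =>
    h.2 _ (freeWord_mem b w) (freeWord_ne_one b hw)
  exact ⟨⟨R, { toIsWordSystem := hR, wwpd := hwwpd }⟩, separatesWords_of_fork hR0' hR'⟩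

/-- Twisting relabels the group without changing the isometries, and end stabilizers correspond
under `α`. Hence all Schottky twists of `F` can be treated as word systems for the one action `ρ`.
-/
theorem IsWWPD.of_comp {α : G ≃* G} {f : G} (h : IsWWPD (ρ.comp α.toMonoidHom) f) :
    IsWWPD ρ (α f) := by
  refine ⟨h.1, fun x R hR => ?_⟩
  obtain ⟨M, hM, hZ⟩ := h.2 x R hR
  refine ⟨M, hM, fun Z h1 h2 => ?_⟩
  have hfin : (α ⁻¹' Z).Finite := by
    refine hZ _ (fun g hg => ?_) fun g hg g' hg' hne hmem => ?_
    · have := h1 (α g) hg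
      rw [← map_pow] at this
      exact this
    · refine h2 (α g) hg (α g') hg' (fun e => hne (α.injective e)) ?_
      rw [← map_inv, ← map_mul]
      exact hmem
  exact hfin.of_preimage α.surjective

theorem IsWWPDSystem.of_comp {α : G ≃* G} {x : X} {τ : FreeMonoid (Fin 3) →* G} {R : ℝ}
    (h : IsWWPDSystem (ρ.comp α.toMonoidHom) x τ R) :
    IsWWPDSystem ρ x (α.toMonoidHom.comp τ) R where
  lower := h.lower
  upper := h.upper
  between := h.between
  near := h.near
  wwpd w hw := (h.wwpd w hw).of_comp

end FreeSubgroup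

/-! ### Transfer from the finite-index subgroup -/

section Transfer

variable {Γ : Type u} [Group Γ] {N : Subgroup Γ} [N.Normal] {s : Γ ⧸ N → Γ}

/-- The cocycle with values in `N` of a section `s` of `Γ → Γ ⧸ N`. -/
def sectionCocycle (hs : ∀ c, (s c : Γ ⧸ N) = c) (c : Γ ⧸ N) (g : Γ) : N :=
  ⟨s c * g * (s (c * g))⁻¹, by
    rw [← QuotientGroup.eq_one_iff, QuotientGroup.mk_mul, QuotientGroup.mk_mul,
      QuotientGroup.mk_inv, hs, hs, mul_inv_cancel]⟩

theorem sectionCocycle_mul (hs : ∀ c, (s c : Γ ⧸ N) = c) (c : Γ ⧸ N) (g h : Γ) :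
    sectionCocycle hs c (g * h) = sectionCocycle hs c g * sectionCocycle hs (c * g) h := by
  apply Subtype.ext
  simp only [sectionCocycle, Subgroup.coe_mul, QuotientGroup.mk_mul, mul_assoc,
    inv_mul_cancel_left]

/-- `N` fixes every coset. On `N` the transfer is thus a sum over conjugates, that is, over the
twists of the action. -/
theorem sectionCocycle_coe (hs : ∀ c, (s c : Γ ⧸ N) = c) (c : Γ ⧸ N) (μ : N) :
    sectionCocycle hs c (μ : Γ) = MulAut.conjNormal (s c) μ := by
  apply Subtype.ext
  have h : ((μ : Γ) : Γ ⧸ N) = 1 := (QuotientGroup.eq_one_iff _).2 μ.2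
  simp only [sectionCocycle, h, mul_one, MulAut.conjNormal_apply]

variable [Fintype (Γ ⧸ N)]

/-- The transfer of a function on `N` to `Γ`. -/
def transfer (hs : ∀ c, (s c : Γ ⧸ N) = c) (q : N → ℝ) (g : Γ) : ℝ :=
  ∑ c, q (sectionCocycle hs c g)

theorem abs_transfer_defect_le (hs : ∀ c, (s c : Γ ⧸ N) = c) {q : N → ℝ} {B : ℝ}
    (hq : ∀ a b, |q a + q b - q (a * b)| ≤ B) (g h : Γ) :
    |transfer hs q g + transfer hs q h - transfer hs q (g * h)| ≤ Fintype.card (Γ ⧸ N) * B := by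
  -- Reindexing by right multiplication matches the cocycle identity, so the defect is estimated
  -- coset by coset.
  have h1 : transfer hs q h = ∑ c : Γ ⧸ N, q (sectionCocycle hs (c * g) h) :=
    (Equiv.sum_comp (Equiv.mulRight (g : Γ ⧸ N)) fun c => q (sectionCocycle hs c h)).symm
  rw [h1, transfer, transfer, ← Finset.sum_add_distrib, ← Finset.sum_sub_distrib]
  refine (Finset.abs_sum_le_sum_abs _ _).trans ((Finset.sum_le_sum fun c _ => ?_).trans_eq
    (by rw [Finset.sum_const, nsmul_eq_mul, Finset.card_univ]))
  rw [sectionCocycle_mul]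
  exact hq _ _

end Transfer

/-! ### From quasimorphisms to a bounded linear map on `ℓ¹` -/

section LinearMap

variable {Γ : Type u} [Group Γ]

theorem summable_mul_of_lp (t : lp (fun _ : ℕ => ℝ) 1) {a : ℕ → ℝ} {L : ℝ} (ha : ∀ n, |a n| ≤ L) :
    Summable fun n => t n * a n := by
  have h1 : Summable fun n => |t n| := by simpa using (lp.memℓp t).summable (by simp)
  refine Summable.of_norm_bounded (h1.mul_right L) fun n => ?_
  rw [Real.norm_eq_abs, abs_mul]
  gcongr
  exact ha n

theorem abs_tsum_mul_le (t : lp (fun _ : ℕ => ℝ) 1) {a : ℕ → ℝ} {L : ℝ}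
    (ha : ∀ n, |a n| ≤ L) : |∑' n, t n * a n| ≤ L * ‖t‖ := by
  have h1 : HasSum (fun n => |t n|) ‖t‖ := by
    simpa using lp.hasSum_norm (p := 1) (by simp) t
  rw [← Real.norm_eq_abs]
  refine tsum_of_norm_bounded (h1.mul_left L) fun n => ?_
  rw [Real.norm_eq_abs, abs_mul, mul_comm L]
  gcongr
  exact ha n

/-- A sequence of pointwise bounded functions with uniformly bounded defect induces a bounded linear
map on `ℓ¹`. -/
theorem exists_linearMap_of_quasimorphisms {Q : ℕ → Γ → ℝ} {L : Γ → ℝ} {B : ℝ}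
    (hL : ∀ n g, |Q n g| ≤ L g) (hB : ∀ n g h, |Q n g + Q n h - Q n (g * h)| ≤ B) :
    ∃ φ : lp (fun _ : ℕ => ℝ) 1 →ₗ[ℝ] H2b Γ,
      (∀ t, φ t = 0 → ∃ (ψ : Γ →* Multiplicative ℝ) (C : ℝ),
        ∀ g, |∑' n, t n * Q n g - (ψ g).toAdd| ≤ C) ∧
      ∀ t : lp (fun _ : ℕ => ℝ) 1, ∃ z : boundedCocycles₂ Γ,
        φ t = Submodule.Quotient.mk z ∧ ∀ g g' : Γ, |z.1 g g'| ≤ B * ‖t‖ := by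
  have hsum : ∀ (t : lp (fun _ : ℕ => ℝ) 1) g, Summable fun n => t n * Q n g := fun t g =>
    summable_mul_of_lp t fun n => hL n g
  -- Summing defects instead of functions shows the bound `B * ‖t‖`. The sum `∑ t n * Q n` converges
  -- pointwise, so `z t` is its coboundary and therefore a cocycle.
  let z : lp (fun _ : ℕ => ℝ) 1 → Γ → Γ → ℝ := fun t g h =>
    ∑' n, t n * (Q n g + Q n h - Q n (g * h))
  have hz : ∀ t g h, z t g h =
      ∑' n, t n * Q n g + ∑' n, t n * Q n h - ∑' n, t n * Q n (g * h) := by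
    intro t g h
    rw [← (hsum t g).tsum_add (hsum t h), ← ((hsum t g).add (hsum t h)).tsum_sub (hsum t (g * h))]
    simp only [z, mul_add, mul_sub]
  have hzB : ∀ t g h, |z t g h| ≤ B * ‖t‖ := fun t g h => abs_tsum_mul_le t fun n => hB n g h
  have hmem : ∀ t, z t ∈ boundedCocycles₂ Γ := by
    refine fun t => ⟨⟨B * ‖t‖, hzB t⟩, fun g h k => ?_⟩
    simp only [hz, mul_assoc]
    ring
  let Z : lp (fun _ : ℕ => ℝ) 1 →ₗ[ℝ] boundedCocycles₂ Γ :=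
    { toFun := fun t => ⟨z t, hmem t⟩
      map_add' := fun t t' => Subtype.ext <| funext fun g => funext fun h => by
        have e := fun t => summable_mul_of_lp t fun n => hB n g h
        simpa [z, add_mul] using (e t).tsum_add (e t')
      map_smul' := fun r t => Subtype.ext <| funext fun g => funext fun h => by
        simp [z, mul_assoc, tsum_mul_left] }
  refine ⟨(Submodule.mkQ _).comp Z, fun t ht => ?_, fun t => ⟨Z t, rfl, hzB t⟩⟩
  have ht' : Z t ∈ (boundedCoboundaries₂ Γ).submoduleOf (boundedCocycles₂ Γ) :=
    (Submodule.Quotient.mk_eq_zero _).1 ht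
  obtain ⟨f, ⟨C, hC⟩, hf⟩ : z t ∈ boundedCoboundaries₂ Γ := ht'
  have hmul : ∀ g h, ∑' n, t n * Q n (g * h) - f (g * h) =
      (∑' n, t n * Q n g - f g) + (∑' n, t n * Q n h - f h) := fun g h => by
    linarith [hf g h, hz t g h]
  refine ⟨MonoidHom.mk' (fun g => Multiplicative.ofAdd (∑' n, t n * Q n g - f g)) fun g h => ?_,
    C, fun g => ?_⟩
  · rw [hmul, ofAdd_add]
  · simpa using hC g

end LinearMap

/-! ### The quasimorphisms of `Γ` and injectivity -/

section Main

variable {X : Type v} [MetricSpace X]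

theorem IsElliptic.exists_dist_pow_le {h : X ≃ᵢ X} (hh : IsElliptic h) (x : X) :
    ∃ D : ℝ, 0 ≤ D ∧ ∀ k : ℕ, dist x ((h ^ k) x) ≤ D := by
  obtain ⟨D, hD⟩ := (Metric.isBounded_iff_subset_closedBall x).1 (hh x)
  have h1 : ∀ k : ℕ, dist x ((h ^ k) x) ≤ D := fun k => by
    simpa [dist_comm] using hD ⟨(k : ℤ), rfl⟩
  exact ⟨D, dist_nonneg.trans (h1 0), h1⟩

variable {Γ : Type u} [Group Γ]

theorem twist_one {N : Subgroup Γ} [N.Normal] (ρ : N →* (X ≃ᵢ X)) : twist ρ (1 : Γ) = ρ := by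
  ext1 μ
  simp [twist]

variable [GromovHyperbolic X]

/-- Quasimorphisms of `Γ` with uniform defect that are independent on powers of words of `F`. -/
theorem GlobalWWPD.exists_quasimorphisms (hX : IsLengthSpace X) {N : Subgroup Γ} [N.Normal]
    {ρ : N →* (X ≃ᵢ X)} {F : Subgroup N} (h : GlobalWWPD N ρ F) (x : X)
    (b : FreeGroupBasis (Fin 2) F) :
    ∃ (B : ℝ) (L : Γ → ℝ) (f : ℕ → FreeMonoid (Fin 3)) (Q : ℕ → Γ → ℝ) (D : ℕ → ℝ),
      (∀ n g, |Q n g| ≤ L g) ∧ (∀ n g h, |Q n g + Q n h - Q n (g * h)| ≤ B) ∧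
      (∀ i, 0 ≤ D i) ∧
      (∀ i (k : ℕ), k - D i ≤ Q i (freeWord b (f i ^ k) : Γ)) ∧
      ∀ i n, i < n → ∀ k : ℕ, |Q n (freeWord b (f i ^ k) : Γ)| ≤ D i := by
  classical
  obtain ⟨δ, hδ⟩ := exists_isHyp (X := X)
  have := h.finiteIndex
  let _ : Fintype (Γ ⧸ N) := Fintype.ofFinite _
  -- The representative of the trivial coset is `1`, so that the untwisted action is one of the
  -- systems, namely `l₀`.
  let s : Γ ⧸ N → Γ := fun c => if c = 1 then 1 else c.out
  have hs : ∀ c, (s c : Γ ⧸ N) = c := by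
    intro c
    by_cases hc : c = 1
    · simp [s, hc]
    · simp [s, hc]
  have hs1 : s 1 = 1 := if_pos rfl
  let ι := {c : Γ ⧸ N // IsWWPDSchottky (twist ρ (s c)) F}
  let l₀ : ι := ⟨1, by rw [hs1, twist_one]; exact h.schottky⟩
  let τ : ι → FreeMonoid (Fin 3) →* N := fun l =>
    (MulAut.conjNormal (s l.1) : MulAut N).toMonoidHom.comp (freeWord b)
  obtain ⟨B, f, q, hB0, hqd, hqB, hq0, hq1, hq2⟩ := WWPD.exists_quasimorphisms (τ := τ) (x := x)
    hδ hX (fun l => (l.2.exists_isWWPDSystem hδ b x).1.imp fun R hR => hR.of_comp)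
    (fun l => (l.2.exists_isWWPDSystem hδ b x).2) l₀
  -- For an elliptic twist the orbit of the powers is bounded. As every `q n` is dominated by
  -- displacement, the bound depends on `i` but not on `n` or `k`.
  have hell : ∀ (i : ℕ) (c : Γ ⧸ N), ∃ D : ℝ, 0 ≤ D ∧ (¬ IsWWPDSchottky (twist ρ (s c)) F →
      ∀ k : ℕ, dist x (ρ (MulAut.conjNormal (s c) (freeWord b (f i)) ^ k) x) ≤ D) := by
    intro i c
    rcases h.twisted (s c) with hc | hc
    · exact ⟨0, le_rfl, fun h => absurd hc h⟩
    · obtain ⟨D, hD0, hD⟩ := (hc _ (freeWord_mem b (f i))).exists_dist_pow_le x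
      refine ⟨D, hD0, fun _ k => ?_⟩
      rw [map_pow]
      exact hD k
  choose D hD0 hD using hell
  have hval : ∀ n i (k : ℕ), transfer hs (q n) (freeWord b (f i ^ k) : Γ) =
      ∑ c, q n (MulAut.conjNormal (s c) (freeWord b (f i)) ^ k) := by
    intro n i k
    simp only [transfer, sectionCocycle_coe, map_pow]
  have hsch : ∀ n i (k : ℕ) (c : Γ ⧸ N) (hc : IsWWPDSchottky (twist ρ (s c)) F),
      q n (MulAut.conjNormal (s c) (freeWord b (f i)) ^ k) = q n (τ ⟨c, hc⟩ (f i) ^ k) :=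
    fun _ _ _ _ _ => rfl
  refine ⟨Fintype.card (Γ ⧸ N) * B, fun g => ∑ c, dist x (ρ (sectionCocycle hs c g) x), f,
    fun n => transfer hs (q n), fun i => ∑ c, D i c, fun n g => ?_,
    fun n => abs_transfer_defect_le hs (hqB n), fun i => Finset.sum_nonneg fun c _ => hD0 i c,
    fun i k => ?_, fun i n hin k => ?_⟩
  · exact (Finset.abs_sum_le_sum_abs _ _).trans (Finset.sum_le_sum fun c _ => hqd n _)
  · simp only [hval]
    rw [sub_le_iff_le_add, ← Finset.sum_add_distrib]
    have hterm : ∀ c, 0 ≤ q i (MulAut.conjNormal (s c) (freeWord b (f i)) ^ k) + D i c := by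
      intro c
      by_cases hc : IsWWPDSchottky (twist ρ (s c)) F
      · rw [hsch i i k c hc]
        exact add_nonneg (hq1 i _ k) (hD0 i c)
      · linarith [neg_abs_le (q i (MulAut.conjNormal (s c) (freeWord b (f i)) ^ k)),
          hqd i (MulAut.conjNormal (s c) (freeWord b (f i)) ^ k), hD i c hc k]
    refine le_trans ?_ (Finset.single_le_sum (fun c _ => hterm c) (Finset.mem_univ 1))
    rw [hsch i i k 1 l₀.2]
    exact le_add_of_le_of_nonneg (hq0 i k) (hD0 i 1)
  · simp only [hval]
    refine (Finset.abs_sum_le_sum_abs _ _).trans (Finset.sum_le_sum fun c _ => ?_)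
    by_cases hc : IsWWPDSchottky (twist ρ (s c)) F
    · rw [hsch n i k c hc, hq2 i n hin, abs_zero]
      exact hD0 i c
    · exact (hqd n _).trans (hD i c hc k)

end Main

end WWPD

theorem theoremD {Γ : Type u} [Group Γ] {X : Type v} [MetricSpace X] [Nonempty X]
    [WWPD.GromovHyperbolic X] (hX : WWPD.IsLengthSpace X)
    (N : Subgroup Γ) [N.Normal] (ρ : N →* (X ≃ᵢ X)) (F : Subgroup N)
    (h : WWPD.GlobalWWPD N ρ F) :
    ∃ φ : lp (fun _ : ℕ => ℝ) 1 →ₗ[ℝ] WWPD.H2b Γ, Function.Injective φ ∧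
      ∃ C : ℝ, ∀ t : lp (fun _ : ℕ => ℝ) 1, ∃ z : WWPD.boundedCocycles₂ Γ,
        φ t = Submodule.Quotient.mk z ∧ ∀ g g' : Γ, |z.1 g g'| ≤ C * ‖t‖ := by
  classical
  obtain ⟨x⟩ := ‹Nonempty X›
  obtain ⟨b⟩ := h.rank_two
  obtain ⟨B, L, f, Q, D, hL, hB, hD0, hdiag, hoff⟩ := h.exists_quasimorphisms hX x b
  obtain ⟨φ, hφ, hφB⟩ := WWPD.exists_linearMap_of_quasimorphisms hL hB
  refine ⟨φ, (injective_iff_map_eq_zero φ).2 fun t ht => ?_, B, hφB⟩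
  obtain ⟨ψ, C, hC⟩ := hφ t ht
  by_contra hne
  have hex : ∃ i, t i ≠ 0 := by
    by_contra! h0
    exact hne (lp.ext (funext h0))
  -- The family is controlled on `f i` only for indices `n ≥ i`, so the first nonzero coefficient is
  -- used.
  obtain ⟨i, hi, hmin⟩ : ∃ i, t i ≠ 0 ∧ ∀ n < i, t n = 0 :=
    ⟨Nat.find hex, Nat.find_spec hex, fun n hn => not_not.1 (Nat.find_min hex hn)⟩
  have hψ : ∀ w, ψ (WWPD.freeWord b w : Γ) = 1 := fun w =>
    WWPD.map_wordHom_eq_one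
      (((ψ.comp N.subtype).comp F.subtype).comp b.repr.symm.toMonoidHom) w
  have hbound : ∀ k : ℕ, |t i| * (k - D i) ≤ C + D i * ‖t‖ := by
    intro k
    have h1 := hC (WWPD.freeWord b (f i ^ k) : Γ)
    rw [hψ, toAdd_one, sub_zero, (WWPD.summable_mul_of_lp t fun n => hL n _).tsum_eq_add_tsum_ite i]
      at h1
    have h2 : |∑' n, if n = i then 0 else t n * Q n (WWPD.freeWord b (f i ^ k) : Γ)| ≤
        D i * ‖t‖ := by
      -- The terms with `n ≤ i` are replaced by zero, since no bound uniform in `k` is available for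
      -- them; those with `n < i` vanish anyway, and `n = i` is treated separately.
      have h3 := WWPD.abs_tsum_mul_le t (L := D i)
        (a := fun n => if n ≤ i then 0 else Q n (WWPD.freeWord b (f i ^ k) : Γ)) fun n => by
          split_ifs with hn
          · rw [abs_zero]; exact hD0 i
          · exact hoff i n (not_le.1 hn) k
      convert h3 using 4 with n
      rcases lt_trichotomy n i with hn | rfl | hn
      · simp [hmin n hn]
      · simp
      · simp [hn.ne', not_le.2 hn]
    have h4 : |t i| * (k - D i) ≤ |t i * Q i (WWPD.freeWord b (f i ^ k) : Γ)| := by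
      rw [abs_mul]
      exact mul_le_mul_of_nonneg_left ((hdiag i k).trans (le_abs_self _)) (abs_nonneg _)
    have h5 := abs_sub_abs_le_abs_add (t i * Q i (WWPD.freeWord b (f i ^ k) : Γ))
      (∑' n, if n = i then 0 else t n * Q n (WWPD.freeWord b (f i ^ k) : Γ))
    linarith
  obtain ⟨k, hk⟩ := exists_nat_gt ((C + D i * ‖t‖) / |t i| + D i)
  have h6 : (C + D i * ‖t‖) / |t i| < k - D i := by linarith
  rw [div_lt_iff₀ (abs_pos.2 hi), mul_comm _ |t i|] at h6
  exact absurd (hbound k) (not_le.2 h6)
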